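/- Let $C,\gamma,\lambda>0$, let $\nu$ be a probability measure on $[C^{-1},C]$, let $\mathbf m=(m_x)_{x\in\mathbb Z}$ be i.i.d. with law $\nu$, with joint law $\mathbb P=\nu^{\otimes\mathbb Z}$ on $\Omega_{\mathcal D}=[C^{-1},C]^{\mathbb Z}$, let $\mu_1$ be the law on $\Omega=\mathbb R^{\mathbb Z}$ of i.i.d. standard Gaussian variables $\omega=(\omega_x)_{x\in\mathbb Z}$, and let $\mathbb E_1^\star$ be the expectation under $\mathbb P\otimes\mu_1$. *Operators.* For functions $f$ of $(\mathbf m,\omega)$ put $\tau_xf(\mathbf m,\omega)=f(m_{x+\cdot},\omega_{x+\cdot})$, $\nabla_xf(\mathbf m,\omega)=f(\mathbf m,\omega^x)-f(\mathbf m,\omega)$ and $\nabla_{x,x+1}f(\mathbf m,\omega)=f(\mathbf m,\omega^{x,x+1})-f(\mathbf m,\omega)$, where $\omega^x$ is $\omega$ with the sign of $\omega_x$ changed and $\omega^{x,x+1}$ is $\omega$ with $\omega_x,\omega_{x+1}$ exchanged. The generator is $\mathcal L^{\mathbf m}=\mathcal A^{\mathbf m}+\mathcal S$ with $$\mathcal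 A^{\mathbf m}=\sum_{x\in\mathbb Z}\Big(\frac{\omega_{x+1}}{\sqrt{m_xm_{x+1}}}-\frac{\omega_{x-1}}{\sqrt{m_{x-1}m_x}}\Big)\frac{\partial}{\partial\omega_x},\qquad \mathcal S=\gamma\sum_{x\in\mathbb Z}\nabla_x+\lambda\sum_{x\in\mathbb Z}\nabla_{x,x+1}.$$ The currents are $j^S_{0,1}=\lambda(\omega_1^2-\omega_0^2)$ and $j_{0,1}=\dfrac{2\omega_0\omega_1}{\sqrt{m_0m_1}}+j^S_{0,1}$. *Quadratic functions.* $\mathcal Q$ is the space of the functions $\sum_i\psi_{i,i}(\mathbf m)(\omega_{i+1}^2-\omega_i^2)+\sum_{i\ne j}\psi_{i,j}(\mathbf m)\omega_i\omega_j$, where $(\psi_{i,j})$ is a symmetric family of continuous cylinder functions on $\Omega_{\mathcal D}$, all but finitely many of which vanish. $\mathcal Q_0$ is the space of the functions $\sum_{x\in\Lambda}\{\nabla_x(F_x)+\nabla_{x,x+1}(G_x)\}$, where $\Lambda\subset\mathbb Z$ is finite and $F_x,G_x$ are homogeneous polynomials of degree two in finitely many of the $\omega_i$ whose coefficients are continuous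 cylinder functions on $\Omega_{\mathcal D}$. *Hilbert space.* For $\varphi\in\mathcal Q_0$ and $g\in\mathcal Q$ put $\ll\varphi,g\gg_{1,\star}=\sum_{x}\mathbb E_1^\star[\varphi\,\tau_xg]$, $\ll\varphi\gg_{1,\star\star}=\sum_xx\,\mathbb E_1^\star[\varphi\,\omega_x^2]$, and, for the formal sum $\Gamma_g=\sum_x\tau_xg$ and $a\in\mathbb R$, $$\mathcal D_0(a\omega_0^2+\Gamma_g)=\frac\gamma2\,\mathbb E_1^\star\big[(\nabla_0(a\omega_0^2+\Gamma_g))^2\big]+\frac\lambda2\,\mathbb E_1^\star\big[(\nabla_{0,1}(a\omega_0^2+\Gamma_g))^2\big].$$ Then $$|||\varphi|||_1^2=\sup_{g\in\mathcal Q,\,a\in\mathbb R}\big\{2\ll\varphi,g\gg_{1,\star}+2a\ll\varphi\gg_{1,\star\star}-\mathcal D_0(a\omega_0^2+\Gamma_g)\big\}$$ is the square of a Hilbertian semi-norm on $\mathcal Q_0$. Let $\mathcal H_1$ be the Hilbert space obtained by completing the quotient of $\mathcal Q_0$ by the kernel of $|||\cdot|||_1$. The space $\mathcal L^{\mathbf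 m}\mathcal Q=\{\mathcal L^{\mathbf m}f:f\in\mathcal Q\}$ is contained in $\mathcal Q_0$; let $\overline{\mathcal L^{\mathbf m}\mathcal Q}$ be the closure of its image in $\mathcal H_1$. **Theorem.** 1. $\mathcal H_1=\overline{\mathcal L^{\mathbf m}\mathcal Q}\oplus\mathbb R\,j^S_{0,1}$ (direct sum, not necessarily orthogonal). 2. For every $g\in\mathcal Q_0$ there is a unique $a\in\mathbb R$ such that $g+a(\omega_1^2-\omega_0^2)\in\overline{\mathcal L^{\mathbf m}\mathcal Q}$ in $\mathcal H_1$. 3. There is a unique $D\in\mathbb R$ for which there exists a sequence $(f_k)$ in $\mathcal Q$ with $|||j_{0,1}-D(\omega_1^2-\omega_0^2)-\mathcal L^{\mathbf m}f_k|||_1\to0$ as $k\to\infty$. -/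

import Mathlib

open MeasureTheory ProbabilityTheory Filter Topology

noncomputable section

/-- The parameters of the infinite disordered chain: the masses are i.i.d. with law `massLaw` on
`[C⁻¹, C]`, each site carries a flip noise of rate `γ` and each bond an exchange noise of
rate `lam`. -/
structure DisorderedChain where
  C : ℝ
  C_pos : 0 < C
  massLaw : Measure (Set.Icc C⁻¹ C)
  isProbabilityMeasure_massLaw : IsProbabilityMeasure massLaw
  γ : ℝ
  γ_pos : 0 < γ
  lam : ℝ
  lam_pos : 0 < lam

namespace DisorderedChain

variable (p : DisorderedChain)

/-- The disorder fields `m = (m_x)`, with `m_x ∈ [C⁻¹, C]` for all `x`. -/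
abbrev Disorder : Type := ℤ → Set.Icc p.C⁻¹ p.C

/-- Pairs `(m, ω)` of a disorder field and a configuration `ω ∈ ℝ^ℤ`. -/
abbrev Phase : Type := p.Disorder × (ℤ → ℝ)

/-- Real functions of `(m, ω)`. -/
abbrev Observable : Type := p.Phase → ℝ

/-- The product law `P` of the disorder. -/
def disorderLaw : Measure p.Disorder := Measure.infinitePi fun _ : ℤ => p.massLaw

/-- The product Gibbs measure at inverse temperature `β = 1`: i.i.d. standard Gaussians. -/
def gibbs : Measure (ℤ → ℝ) := Measure.infinitePi fun _ : ℤ => gaussianReal 0 1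

/-- The measure `P ⊗ μ₁`. -/
def law : Measure p.Phase := p.disorderLaw.prod gibbs

/-! ### Translations, flips, exchanges -/

variable {p}

/-- `(m, ω) ↦ (τ_x m, τ_x ω)`, with `(τ_x m)_z = m_{x+z}` and `(τ_x ω)_z = ω_{x+z}`. -/
def shift (x : ℤ) (z : p.Phase) : p.Phase := (fun y => z.1 (x + y), fun y => z.2 (x + y))

/-- `(m, ω) ↦ (m, ω^x)`: the value at `x` changes sign. -/
def flip (x : ℤ) (z : p.Phase) : p.Phase := (z.1, Function.update z.2 x (-z.2 x))

/-- `(m, ω) ↦ (m, ω^{x,y})`: the values at `x` and `y` are exchanged. -/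
def exchange (x y : ℤ) (z : p.Phase) : p.Phase := (z.1, fun u => z.2 (Equiv.swap x y u))

/-- `f ↦ τ_x f`. -/
def translate (x : ℤ) (f : p.Observable) : p.Observable := fun z => f (shift x z)

/-- `f ↦ f ∘ θ - f`. -/
def increment (θ : p.Phase → p.Phase) (f : p.Observable) : p.Observable :=
  fun z => f (θ z) - f z

/-- `∇_x f (m, ω) = f (m, ω^x) - f (m, ω)`. -/
def siteGrad (x : ℤ) (f : p.Observable) : p.Observable := increment (flip x) f

/-- `∇_{x,x+1} f (m, ω) = f (m, ω^{x,x+1}) - f (m, ω)`. -/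
def bondGrad (x : ℤ) (f : p.Observable) : p.Observable := increment (exchange x (x + 1)) f

/-- `∇_0 (Γ_f)` for the formal sum `Γ_f = ∑_x τ_x f` (only finitely many increments are nonzero
when `f` is a cylinder function). -/
def siteGradSum (f : p.Observable) : p.Observable :=
  fun z => ∑ᶠ x : ℤ, siteGrad 0 (translate x f) z

/-- `∇_{0,1} (Γ_f)` for the formal sum `Γ_f = ∑_x τ_x f`. -/
def bondGradSum (f : p.Observable) : p.Observable :=
  fun z => ∑ᶠ x : ℤ, bondGrad 0 (translate x f) z

/-! ### The generator -/

/-- `A^m f = ∑_x (ω_{x+1} / √(m_x m_{x+1}) - ω_{x-1} / √(m_{x-1} m_x)) ∂f/∂ω_x`. -/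
def antisymGen (f : p.Observable) : p.Observable := fun z =>
  ∑ᶠ x : ℤ, (z.2 (x + 1) / √((z.1 x : ℝ) * z.1 (x + 1)) -
      z.2 (x - 1) / √((z.1 (x - 1) : ℝ) * z.1 x)) *
    deriv (fun t : ℝ => f (z.1, Function.update z.2 x t)) (z.2 x)

variable (p) in
/-- `S f = γ ∑_x ∇_x f + λ ∑_x ∇_{x,x+1} f`. -/
def symGen (f : p.Observable) : p.Observable := fun z =>
  p.γ * (∑ᶠ x : ℤ, siteGrad x f z) + p.lam * ∑ᶠ x : ℤ, bondGrad x f z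

variable (p) in
/-- The generator `L^m = A^m + S`. -/
def gen (f : p.Observable) : p.Observable := antisymGen f + p.symGen f

/-! ### Quadratic functions -/

variable (p) in
/-- The continuous cylinder functions of the disorder. -/
def Coeff : Subalgebra ℝ (p.Disorder → ℝ) where
  carrier := {b | Continuous b ∧ ∃ Λ : Finset ℤ, DependsOn b (Λ : Set ℤ)}
  mul_mem' := by
    rintro a b ⟨ha, Λ, hΛ⟩ ⟨hb, Λ', hΛ'⟩
    refine ⟨ha.mul hb, Λ ∪ Λ', fun x y h => ?_⟩
    have h1 := hΛ (x := x) (y := y) fun i hi => h i (by simp at hi ⊢; tauto)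
    have h2 := hΛ' (x := x) (y := y) fun i hi => h i (by simp at hi ⊢; tauto)
    simp [h1, h2]
  add_mem' := by
    rintro a b ⟨ha, Λ, hΛ⟩ ⟨hb, Λ', hΛ'⟩
    refine ⟨ha.add hb, Λ ∪ Λ', fun x y h => ?_⟩
    have h1 := hΛ (x := x) (y := y) fun i hi => h i (by simp at hi ⊢; tauto)
    have h2 := hΛ' (x := x) (y := y) fun i hi => h i (by simp at hi ⊢; tauto)
    simp [h1, h2]
  algebraMap_mem' r := ⟨continuous_const, ∅, fun _ _ _ => rfl⟩

/-- `b ↦ b(m) P(ω)`. -/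
def weighted (P : (ℤ → ℝ) → ℝ) : p.Coeff →ₗ[ℝ] p.Observable where
  toFun b := fun z => (b : p.Disorder → ℝ) z.1 * P z.2
  map_add' a b := by ext z; simp [add_mul]
  map_smul' r b := by ext z; simp [mul_assoc]

variable (p) in
/-- The homogeneous polynomials of degree two in `ω`, `∑_{i,j} c_{i,j}(m) ω_i ω_j` (finite sum),
whose coefficients are continuous cylinder functions of the disorder. -/
def HomQuad : Submodule ℝ p.Observable :=
  LinearMap.range (Finsupp.lsum ℝ fun ij : ℤ × ℤ =>
    weighted (p := p) fun ω => ω ij.1 * ω ij.2)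

variable (p) in
/-- The symmetric, finitely supported families `(ψ_{i,j})` of continuous cylinder functions of
the disorder. -/
def SymmCoeff : Submodule ℝ (ℤ × ℤ →₀ p.Coeff) where
  carrier := {ψ | ∀ i j, ψ (i, j) = ψ (j, i)}
  add_mem' h h' i j := by simp [h i j, h' i j]
  zero_mem' i j := rfl
  smul_mem' r ψ h i j := by simp [h i j]

variable (p) in
/-- The space `Q` of quadratic cylinder functions
`∑_i ψ_{i,i}(m) (ω_{i+1}² - ω_i²) + ∑_{i ≠ j} ψ_{i,j}(m) ω_i ω_j`. -/
def Quad : Submodule ℝ p.Observable :=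
  p.SymmCoeff.map (Finsupp.lsum ℝ fun ij : ℤ × ℤ =>
    weighted (p := p) fun ω =>
      if ij.1 = ij.2 then ω (ij.1 + 1) ^ 2 - ω ij.1 ^ 2 else ω ij.1 * ω ij.2)

variable (p) in
/-- The space `Q₀` of the functions `∑_{x ∈ Λ} (∇_x F_x + ∇_{x,x+1} G_x)`, where `Λ` is finite and
`F_x`, `G_x` are homogeneous polynomials of degree two in `ω`. -/
def Quad₀ : Submodule ℝ p.Observable where
  carrier := {φ | ∃ (Λ : Finset ℤ) (F G : ℤ → p.Observable),
    (∀ x ∈ Λ, F x ∈ p.HomQuad ∧ G x ∈ p.HomQuad) ∧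
      φ = ∑ x ∈ Λ, (siteGrad x (F x) + bondGrad x (G x))}
  zero_mem' := ⟨∅, 0, 0, by simp, by simp⟩
  add_mem' := by
    classical
    rintro _ _ ⟨Λ, F, G, h, rfl⟩ ⟨Λ', F', G', h', rfl⟩
    refine ⟨Λ ∪ Λ', fun x => (if x ∈ Λ then F x else 0) + (if x ∈ Λ' then F' x else 0),
      fun x => (if x ∈ Λ then G x else 0) + (if x ∈ Λ' then G' x else 0), ?_, ?_⟩
    · intro x _
      constructor
      · refine add_mem ?_ ?_ <;> split_ifs with hx
        exacts [(h x hx).1, zero_mem _, (h' x hx).1, zero_mem _]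
      · refine add_mem ?_ ?_ <;> split_ifs with hx
        exacts [(h x hx).2, zero_mem _, (h' x hx).2, zero_mem _]
    · have e1 : ∑ x ∈ Λ, (siteGrad x (F x) + bondGrad x (G x)) =
          ∑ x ∈ Λ ∪ Λ', if x ∈ Λ then siteGrad x (F x) + bondGrad x (G x) else 0 := by
        rw [← Finset.sum_filter]
        congr 1
        ext x; simp +contextual
      have e2 : ∑ x ∈ Λ', (siteGrad x (F' x) + bondGrad x (G' x)) =
          ∑ x ∈ Λ ∪ Λ', if x ∈ Λ' then siteGrad x (F' x) + bondGrad x (G' x) else 0 := by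
        rw [← Finset.sum_filter]
        congr 1
        ext x; simp +contextual
      rw [e1, e2, ← Finset.sum_add_distrib]
      refine Finset.sum_congr rfl fun x _ => ?_
      ext z
      by_cases h1 : x ∈ Λ <;> by_cases h2 : x ∈ Λ' <;>
        (simp [h1, h2, siteGrad, bondGrad, increment]; try ring)
  smul_mem' := by
    rintro r _ ⟨Λ, F, G, h, rfl⟩
    refine ⟨Λ, fun x => r • F x, fun x => r • G x,
      fun x hx => ⟨Submodule.smul_mem _ _ (h x hx).1, Submodule.smul_mem _ _ (h x hx).2⟩, ?_⟩
    rw [Finset.smul_sum]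
    refine Finset.sum_congr rfl fun x _ => ?_
    ext z
    simp [siteGrad, bondGrad, increment]
    ring

/-! ### Currents -/

variable (p) in
/-- `ω_1² - ω_0²`. -/
def energyGrad : p.Observable := fun z => z.2 1 ^ 2 - z.2 0 ^ 2

variable (p) in
/-- `j^A_{0,1} = 2 ω_0 ω_1 / √(m_0 m_1)`. -/
def antisymCurrent : p.Observable := fun z => 2 * z.2 0 * z.2 1 / √((z.1 0 : ℝ) * z.1 1)

variable (p) in
/-- `j^S_{0,1} = λ (ω_1² - ω_0²)`. -/
def symCurrent : p.Observable := fun z => p.lam * (z.2 1 ^ 2 - z.2 0 ^ 2)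

variable (p) in
/-- The instantaneous energy current `j_{0,1} = j^A_{0,1} + j^S_{0,1}`. -/
def current : p.Observable := p.antisymCurrent + p.symCurrent

/-! ### The semi-norm -/

/-- `≪ g, h ≫_⋆ = ∑_x E[g τ_x h]`. -/
def pairing (g h : p.Observable) : ℝ := ∑ᶠ x : ℤ, ∫ z, g z * translate x h z ∂p.law

/-- `≪ g ≫_⋆⋆ = ∑_x x E[g ω_x²]`. -/
def moment (g : p.Observable) : ℝ := ∑ᶠ x : ℤ, (x : ℝ) * ∫ z, g z * z.2 x ^ 2 ∂p.law

/-- The Dirichlet form at the origin of the formal sum `a ω_0² + Γ_g`,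
`(γ/2) E[(∇_0 (a ω_0² + Γ_g))²] + (λ/2) E[(∇_{0,1} (a ω_0² + Γ_g))²]`. -/
def dirichlet (a : ℝ) (g : p.Observable) : ℝ :=
  p.γ / 2 * ∫ z, (a * siteGrad 0 (fun z => z.2 0 ^ 2) z + siteGradSum g z) ^ 2 ∂p.law +
  p.lam / 2 * ∫ z, (a * bondGrad 0 (fun z => z.2 0 ^ 2) z + bondGradSum g z) ^ 2 ∂p.law

/-- `|||φ|||₁² = sup { 2 ≪φ, g≫_⋆ + 2 a ≪φ≫_⋆⋆ - D_0(a ω_0² + Γ_g) ; g ∈ Q, a ∈ ℝ }`. -/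
def tripleNormSq (φ : p.Observable) : ℝ :=
  ⨆ w : p.Quad × ℝ, (2 * pairing φ w.1 + 2 * w.2 * moment φ - dirichlet w.2 (w.1 : p.Observable))

/-- The semi-norm `|||φ|||₁`. -/
def tripleNorm (φ : p.Observable) : ℝ := √(tripleNormSq φ)

/-! ### Invariance of the measure -/

instance : IsProbabilityMeasure p.massLaw := p.isProbabilityMeasure_massLaw

instance : IsProbabilityMeasure p.disorderLaw := by unfold disorderLaw; infer_instance

instance : IsProbabilityMeasure gibbs := by unfold gibbs; infer_instance

instance : IsProbabilityMeasure p.law := by unfold law; infer_instance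

lemma measurePreserving_reindex {X : Type*} [MeasurableSpace X] (μ : Measure X)
    [IsProbabilityMeasure μ] (e : ℤ ≃ ℤ) :
    MeasurePreserving (fun (f : ℤ → X) (x : ℤ) => f (e x))
      (Measure.infinitePi fun _ : ℤ => μ) (Measure.infinitePi fun _ : ℤ => μ) := by
  refine ⟨by fun_prop, ?_⟩
  have h := Measure.infinitePi_map_piCongrLeft (fun _ : ℤ => μ) e.symm
  have h2 : (⇑(MeasurableEquiv.piCongrLeft (fun _ : ℤ => X) e.symm)) =
      (fun (f : ℤ → X) (x : ℤ) => f (e x)) := by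
    ext f x
    have := MeasurableEquiv.piCongrLeft_apply_apply (β := fun _ : ℤ => X) e.symm f (e x)
    simpa using this
  rwa [h2] at h

lemma measurePreserving_shift (x : ℤ) : MeasurePreserving (shift (p := p) x) p.law p.law :=
  (measurePreserving_reindex p.massLaw (Equiv.addLeft x)).prod
    (measurePreserving_reindex (gaussianReal 0 1) (Equiv.addLeft x))

lemma measurePreserving_exchange (x y : ℤ) :
    MeasurePreserving (exchange (p := p) x y) p.law p.law :=
  (MeasurePreserving.id p.disorderLaw).prod
    (measurePreserving_reindex (gaussianReal 0 1) (Equiv.swap x y))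

lemma measurePreserving_flip (x : ℤ) : MeasurePreserving (flip (p := p) x) p.law p.law := by
  refine (MeasurePreserving.id p.disorderLaw).prod
    (g := fun ω : ℤ → ℝ => Function.update ω x (-ω x)) ?_
  have h1 : (fun ω : ℤ → ℝ => Function.update ω x (-ω x)) =
      fun (ω : ℤ → ℝ) (i : ℤ) => (if i = x then (fun t : ℝ => -t) else id) (ω i) := by
    ext ω i
    by_cases h : i = x
    · subst h; simp
    · simp [h]
  have hm : ∀ i : ℤ, Measurable (if i = x then (fun t : ℝ => -t) else id) := by
    intro i; split_ifs <;> fun_prop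
  rw [h1]
  refine ⟨measurable_pi_lambda _ fun i => (hm i).comp (measurable_pi_apply i), ?_⟩
  unfold gibbs
  rw [Measure.infinitePi_map_pi (μ := fun _ : ℤ => gaussianReal 0 1) hm]
  congr 1
  ext1 i
  split_ifs
  · simpa using gaussianReal_map_neg (μ := 0) (v := 1)
  · simp

/-! ### Square integrable local functions -/

/-- `f (m, ω)` depends on `ω` only through its values in `Λ`. -/
def LocalIn (Λ : Finset ℤ) (f : p.Observable) : Prop :=
  ∀ m ω ω', (∀ x ∈ Λ, ω x = ω' x) → f (m, ω) = f (m, ω')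

variable (p) in
/-- The square integrable functions that depend on finitely many coordinates of `ω`. -/
def LocalSq : Submodule ℝ p.Observable where
  carrier := {f | MemLp f 2 p.law ∧ ∃ Λ : Finset ℤ, LocalIn Λ f}
  zero_mem' := ⟨MemLp.zero, ∅, fun _ _ _ _ => rfl⟩
  add_mem' := by
    classical
    rintro f g ⟨hf, Λ, hΛ⟩ ⟨hg, Λ', hΛ'⟩
    refine ⟨hf.add hg, Λ ∪ Λ', fun m ω ω' h => ?_⟩
    simp only [Pi.add_apply]
    rw [hΛ m ω ω' fun x hx => h x (Finset.mem_union_left _ hx),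
      hΛ' m ω ω' fun x hx => h x (Finset.mem_union_right _ hx)]
  smul_mem' := by
    rintro r f ⟨hf, Λ, hΛ⟩
    exact ⟨hf.const_smul r, Λ, fun m ω ω' h => by simp [hΛ m ω ω' h]⟩

lemma memLp_coord (x : ℤ) : MemLp (fun z : p.Phase => z.2 x) 4 p.law := by
  have h1 : MeasurePreserving (fun z : p.Phase => z.2 x) p.law (gaussianReal 0 1) :=
    (measurePreserving_eval_infinitePi (fun _ : ℤ => gaussianReal 0 1) x).comp
      measurePreserving_snd
  exact (memLp_id_gaussianReal' 4 (by simp)).comp_measurePreserving h1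

lemma memLp_coord_mul (x y : ℤ) : MemLp (fun z : p.Phase => z.2 x * z.2 y) 2 p.law := by
  have : ENNReal.HolderTriple 4 4 2 := ⟨by
    rw [← ENNReal.toReal_eq_toReal_iff' (by simp) (by simp)]
    rw [ENNReal.toReal_add (by simp) (by simp)]
    norm_num⟩
  exact (memLp_coord y).mul (memLp_coord x)

lemma homQuad_le {S : Submodule ℝ p.Observable}
    (h : ∀ (b : p.Coeff) (i j : ℤ), weighted (fun ω => ω i * ω j) b ∈ S) : p.HomQuad ≤ S := by
  rintro _ ⟨c, rfl⟩
  rw [Finsupp.coe_lsum]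
  exact Submodule.sum_mem _ fun ij _ => h _ _ _

lemma weighted_mem (b : p.Coeff) (i j : ℤ) :
    weighted (fun ω => ω i * ω j) b ∈ p.HomQuad :=
  ⟨Finsupp.single (i, j) b, by simp⟩

lemma quad_le {S : Submodule ℝ p.Observable}
    (h : ∀ (b : p.Coeff) (i j : ℤ), i ≠ j → weighted (fun ω => ω i * ω j) b ∈ S)
    (h' : ∀ (b : p.Coeff) (i : ℤ), weighted (fun ω => ω (i + 1) ^ 2 - ω i ^ 2) b ∈ S) :
    p.Quad ≤ S := by
  rintro _ ⟨ψ, _, rfl⟩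
  rw [Finsupp.coe_lsum]
  refine Submodule.sum_mem _ fun ij _ => ?_
  by_cases hij : ij.1 = ij.2
  · simpa only [if_pos hij] using h' (ψ ij) ij.1
  · simpa only [if_neg hij] using h (ψ ij) ij.1 ij.2 hij

lemma quad_le_homQuad : p.Quad ≤ p.HomQuad := by
  refine quad_le (fun b i j _ => weighted_mem b i j) fun b i => ?_
  convert sub_mem (weighted_mem b (i + 1) (i + 1)) (weighted_mem b i i) using 1
  ext z
  simp [weighted]
  ring

lemma homQuad_le_localSq : p.HomQuad ≤ p.LocalSq := by
  classical
  refine homQuad_le fun b i j => ⟨?_, {i, j}, fun m ω ω' h => ?_⟩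
  · have hc : Continuous (b : p.Disorder → ℝ) := b.2.1
    obtain ⟨K, hK⟩ := (isCompact_range hc).isBounded.exists_norm_le
    refine (memLp_coord_mul i j).of_le_mul (c := K) ?_ (Eventually.of_forall fun z => ?_)
    · exact (hc.measurable.comp measurable_fst).aestronglyMeasurable.mul
        (memLp_coord_mul i j).aestronglyMeasurable
    · rw [show weighted (fun ω => ω i * ω j) b z =
        (b : p.Disorder → ℝ) z.1 * (z.2 i * z.2 j) from rfl, norm_mul]
      exact mul_le_mul_of_nonneg_right (hK _ ⟨z.1, rfl⟩) (norm_nonneg _)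
  · simp [weighted, h i (by simp), h j (by simp)]

lemma increment_add (θ : p.Phase → p.Phase) (f g : p.Observable) :
    increment θ (f + g) = increment θ f + increment θ g := by
  ext z; simp [increment]; ring

lemma increment_smul (θ : p.Phase → p.Phase) (r : ℝ) (f : p.Observable) :
    increment θ (r • f) = r • increment θ f := by
  ext z; simp [increment]; ring

lemma MemLp.increment {θ : p.Phase → p.Phase} (hθ : MeasurePreserving θ p.law p.law)
    {f : p.Observable} (hf : MemLp f 2 p.law) : MemLp (increment θ f) 2 p.law :=
  (hf.comp_measurePreserving hθ).sub hf

/-- The increment operator of a measure preserving involution is symmetric. -/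
lemma integral_increment_mul {θ : p.Phase → p.Phase} (hθ : MeasurePreserving θ p.law p.law)
    (hi : Function.Involutive θ) {f g : p.Observable} (hf : MemLp f 2 p.law)
    (hg : MemLp g 2 p.law) :
    ∫ z, increment θ f z * g z ∂p.law = ∫ z, f z * increment θ g z ∂p.law := by
  have e : MeasurableEmbedding θ :=
    (MeasurableEquiv.mk (hi.toPerm θ) hθ.measurable hθ.measurable).measurableEmbedding
  have h1 := hθ.integral_comp e (fun z => f z * g (θ z))
  simp only [hi _] at h1
  have i1 : Integrable (fun z => f (θ z) * g z) p.law :=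
    (hf.comp_measurePreserving hθ).integrable_mul hg
  have i2 : Integrable (fun z => f z * g z) p.law := hf.integrable_mul hg
  have i3 : Integrable (fun z => f z * g (θ z)) p.law :=
    hf.integrable_mul (hg.comp_measurePreserving hθ)
  simp only [DisorderedChain.increment, sub_mul, mul_sub]
  rw [integral_sub i1 i2, integral_sub i3 i2, h1]

lemma flip_involutive (x : ℤ) : Function.Involutive (flip (p := p) x) := by
  intro z; ext <;> simp [flip]

lemma exchange_involutive (x y : ℤ) : Function.Involutive (exchange (p := p) x y) := by
  intro z; ext <;> simp [exchange]

lemma localIn_flip {Λ : Finset ℤ} {f : p.Observable} (h : LocalIn Λ f) {x : ℤ} (hx : x ∉ Λ) :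
    increment (flip x) f = 0 := by
  ext z
  refine sub_eq_zero.2 (h _ _ _ fun y hy => ?_)
  rw [Function.update_of_ne (by rintro rfl; exact hx hy)]

lemma localIn_exchange {Λ : Finset ℤ} {f : p.Observable} (h : LocalIn Λ f) {x y : ℤ}
    (hx : x ∉ Λ) (hy : y ∉ Λ) : increment (exchange x y) f = 0 := by
  ext z
  refine sub_eq_zero.2 (h _ _ _ fun u hu => ?_)
  rw [Equiv.swap_apply_of_ne_of_ne (by rintro rfl; exact hx hu) (by rintro rfl; exact hy hu)]

lemma localIn_translate {Λ : Finset ℤ} {f : p.Observable} (h : LocalIn Λ f) (x : ℤ) :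
    LocalIn (Λ.map (Equiv.addLeft x).toEmbedding) (translate x f) := by
  intro m ω ω' hω
  exact h _ _ _ fun y hy => hω _ (by simpa using hy)

lemma memLp_translate {f : p.Observable} (hf : MemLp f 2 p.law) (x : ℤ) :
    MemLp (translate x f) 2 p.law :=
  hf.comp_measurePreserving (measurePreserving_shift x)

lemma integrable_fun_mul {f g : p.Observable} (hf : MemLp f 2 p.law) (hg : MemLp g 2 p.law) :
    Integrable (fun z => f z * g z) p.law :=
  hf.integrable_mul hg

/-! ### Formal sums of increments -/

/-- `∑_x (τ_x g ∘ θ - τ_x g)`. -/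
def gradSum (θ : p.Phase → p.Phase) (g : p.Observable) : p.Observable :=
  fun z => ∑ᶠ x : ℤ, increment θ (translate x g) z

/-- Measure preserving involutions of `(m, ω)` that only change finitely many coordinates. -/
structure IsLocalMove (θ : p.Phase → p.Phase) : Prop where
  measurePreserving : MeasurePreserving θ p.law p.law
  involutive : Function.Involutive θ
  finite : ∀ g ∈ p.LocalSq, {x | increment θ (translate x g) ≠ 0}.Finite

lemma isLocalMove_flip (y : ℤ) : IsLocalMove (flip (p := p) y) where
  measurePreserving := measurePreserving_flip y
  involutive := flip_involutive y
  finite := by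
    rintro g ⟨-, Λ, hΛ⟩
    refine (Λ.finite_toSet.image fun u => y - u).subset fun x hx => ?_
    by_contra h
    refine hx (localIn_flip (localIn_translate hΛ x) fun hy => h ?_)
    obtain ⟨u, hu, rfl⟩ := Finset.mem_map.1 hy
    exact ⟨u, hu, by simp⟩

lemma isLocalMove_exchange (y v : ℤ) : IsLocalMove (exchange (p := p) y v) where
  measurePreserving := measurePreserving_exchange y v
  involutive := exchange_involutive y v
  finite := by
    rintro g ⟨-, Λ, hΛ⟩
    refine ((Λ.finite_toSet.image fun u => y - u).union
      (Λ.finite_toSet.image fun u => v - u)).subset fun x hx => ?_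
    by_contra h
    refine hx (localIn_exchange (localIn_translate hΛ x)
      (fun hy => h (Or.inl ?_)) (fun hy => h (Or.inr ?_)))
    · obtain ⟨u, hu, rfl⟩ := Finset.mem_map.1 hy
      exact ⟨u, hu, by simp⟩
    · obtain ⟨u, hu, rfl⟩ := Finset.mem_map.1 hy
      exact ⟨u, hu, by simp⟩

namespace IsLocalMove

variable {θ : p.Phase → p.Phase}

lemma gradSum_eq (hθ : IsLocalMove θ) {g : p.Observable} (hg : g ∈ p.LocalSq) :
    gradSum θ g = ∑ x ∈ (hθ.finite g hg).toFinset, increment θ (translate x g) := by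
  ext z
  rw [Finset.sum_apply]
  refine finsum_eq_sum_of_support_subset _ fun x hx => ?_
  simp only [Set.Finite.coe_toFinset, Set.mem_ofPred_eq]
  rintro h
  exact hx (by simp [h])

lemma memLp_gradSum (hθ : IsLocalMove θ) {g : p.Observable} (hg : g ∈ p.LocalSq) :
    MemLp (gradSum θ g) 2 p.law := by
  rw [hθ.gradSum_eq hg]
  exact memLp_finsetSum' _ fun x _ => MemLp.increment hθ.1 (memLp_translate hg.1 x)

lemma finite_apply (hθ : IsLocalMove θ) {g : p.Observable} (hg : g ∈ p.LocalSq) (z : p.Phase) :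
    (Function.support fun x => increment θ (translate x g) z).Finite :=
  (hθ.finite g hg).subset fun x hx h => hx (by simp [h])

lemma gradSum_add (hθ : IsLocalMove θ) {g h : p.Observable} (hg : g ∈ p.LocalSq)
    (hh : h ∈ p.LocalSq) :
    gradSum θ (g + h) = gradSum θ g + gradSum θ h := by
  ext z
  simp only [gradSum, Pi.add_apply]
  rw [← finsum_add_distrib (hθ.finite_apply hg z) (hθ.finite_apply hh z)]
  refine finsum_congr fun x => ?_
  simp [increment, translate]; ring

lemma gradSum_smul (r : ℝ) (g : p.Observable) :
    gradSum θ (r • g) = r • gradSum θ g := by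
  ext z
  simp only [gradSum, Pi.smul_apply, smul_eq_mul]
  rw [← smul_eq_mul, smul_finsum]
  refine finsum_congr fun x => ?_
  simp [increment, translate]; ring

lemma integral_increment_translate (hθ : IsLocalMove θ) {F g : p.Observable} (hF : MemLp F 2 p.law)
    (hg : g ∈ p.LocalSq) (x : ℤ) :
    ∫ z, increment θ F z * translate x g z ∂p.law =
      ∫ z, F z * increment θ (translate x g) z ∂p.law :=
  integral_increment_mul hθ.1 hθ.2 hF (memLp_translate hg.1 x)

lemma finite_integral (hθ : IsLocalMove θ) {F g : p.Observable} (hF : MemLp F 2 p.law)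
    (hg : g ∈ p.LocalSq) :
    (Function.support fun x => ∫ z, increment θ F z * translate x g z ∂p.law).Finite := by
  refine (hθ.finite g hg).subset fun x hx h => hx ?_
  simp only [hθ.integral_increment_translate hF hg, h]
  simp

lemma pairing_increment (hθ : IsLocalMove θ) {F g : p.Observable} (hF : MemLp F 2 p.law) (hg : g ∈ p.LocalSq) :
    pairing (increment θ F) g = ∫ z, F z * gradSum θ g z ∂p.law := by
  unfold pairing
  simp only [hθ.integral_increment_translate hF hg]
  rw [finsum_eq_sum_of_support_subset (s := (hθ.finite g hg).toFinset) _ fun x hx => by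
    simp only [Set.Finite.coe_toFinset, Set.mem_ofPred_eq]
    rintro h
    exact hx (by simp [h])]
  rw [hθ.gradSum_eq hg, ← integral_finsetSum _ fun x _ =>
    integrable_fun_mul hF (MemLp.increment hθ.1 (memLp_translate hg.1 x))]
  refine integral_congr_ae (Eventually.of_forall fun z => ?_)
  simp [Finset.mul_sum]

end IsLocalMove

/-- The site energy `ω_0²`. -/
def siteEnergy : p.Observable := fun z => z.2 0 ^ 2

lemma translate_siteEnergy (x : ℤ) :
    translate x (siteEnergy (p := p)) = fun z => z.2 x ^ 2 := by
  ext z; simp [translate, shift, siteEnergy]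

lemma siteEnergy_mem : siteEnergy (p := p) ∈ p.LocalSq := by
  refine ⟨?_, {0}, fun m ω ω' h => by simp [siteEnergy, h 0]⟩
  convert memLp_coord_mul (p := p) 0 0 using 1
  ext z; simp [siteEnergy, sq]

lemma moment_eq (φ : p.Observable) :
    moment φ = ∑ᶠ x : ℤ, (x : ℝ) * ∫ z, φ z * translate x siteEnergy z ∂p.law := by
  simp only [moment, translate_siteEnergy]

variable (p) in
/-- The square integrable functions for which the sum `≪ φ, g ≫_⋆` has finitely many nonzero
terms for all local `g`. -/
def Pairable : Submodule ℝ p.Observable where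
  carrier := {φ | MemLp φ 2 p.law ∧ ∀ g ∈ p.LocalSq,
    (Function.support fun x => ∫ z, φ z * translate x g z ∂p.law).Finite}
  zero_mem' := ⟨MemLp.zero, fun g _ => by simp⟩
  add_mem' := by
    rintro φ ψ ⟨h, h'⟩ ⟨k, k'⟩
    refine ⟨h.add k, fun g hg => ((h' g hg).union (k' g hg)).subset fun x hx => ?_⟩
    by_contra hn
    simp only [Set.mem_union, Function.mem_support, not_or, not_not] at hn
    refine hx ?_
    simp only [Pi.add_apply, add_mul]
    rw [integral_add (integrable_fun_mul h (memLp_translate hg.1 x))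
      (integrable_fun_mul k (memLp_translate hg.1 x)), hn.1, hn.2, add_zero]
  smul_mem' := by
    rintro r φ ⟨h, h'⟩
    refine ⟨h.const_smul r, fun g hg => (h' g hg).subset fun x hx hn => hx ?_⟩
    simp only [Pi.smul_apply, smul_eq_mul, mul_assoc]
    simp only at hn
    rw [integral_const_mul, hn, mul_zero]

lemma IsLocalMove.increment_mem {θ : p.Phase → p.Phase} (hθ : IsLocalMove θ) {F : p.Observable}
    (hF : MemLp F 2 p.law) : increment θ F ∈ p.Pairable :=
  ⟨MemLp.increment hθ.1 hF, fun _ hg => hθ.finite_integral hF hg⟩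

lemma quad₀_le {S : Submodule ℝ p.Observable}
    (h : ∀ F ∈ p.HomQuad, ∀ x, siteGrad x F ∈ S ∧ bondGrad x F ∈ S) : p.Quad₀ ≤ S := by
  rintro _ ⟨Λ, F, G, hFG, rfl⟩
  exact Submodule.sum_mem _ fun x hx =>
    add_mem (h _ (hFG x hx).1 x).1 (h _ (hFG x hx).2 x).2

lemma quad₀_le_pairable : p.Quad₀ ≤ p.Pairable :=
  quad₀_le fun _ hF x =>
    ⟨(isLocalMove_flip x).increment_mem (homQuad_le_localSq hF).1,
      (isLocalMove_exchange x (x + 1)).increment_mem (homQuad_le_localSq hF).1⟩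

lemma quad_le_localSq : p.Quad ≤ p.LocalSq := quad_le_homQuad.trans homQuad_le_localSq

lemma pairing_add_left {φ ψ g : p.Observable} (hφ : φ ∈ p.Pairable) (hψ : ψ ∈ p.Pairable)
    (hg : g ∈ p.LocalSq) : pairing (φ + ψ) g = pairing φ g + pairing ψ g := by
  unfold pairing
  rw [← finsum_add_distrib (hφ.2 g hg) (hψ.2 g hg)]
  refine finsum_congr fun x => ?_
  simp only [Pi.add_apply, add_mul]
  exact integral_add (integrable_fun_mul hφ.1 (memLp_translate hg.1 x))
    (integrable_fun_mul hψ.1 (memLp_translate hg.1 x))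

lemma pairing_smul_left (r : ℝ) (φ g : p.Observable) :
    pairing (r • φ) g = r * pairing φ g := by
  unfold pairing
  rw [← smul_eq_mul, smul_finsum]
  refine finsum_congr fun x => ?_
  simp only [Pi.smul_apply, smul_eq_mul, mul_assoc]
  rw [integral_const_mul]

lemma pairing_add_right {φ g h : p.Observable} (hφ : φ ∈ p.Pairable) (hg : g ∈ p.LocalSq)
    (hh : h ∈ p.LocalSq) : pairing φ (g + h) = pairing φ g + pairing φ h := by
  unfold pairing
  rw [← finsum_add_distrib (hφ.2 g hg) (hφ.2 h hh)]
  refine finsum_congr fun x => ?_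
  simp only [translate, Pi.add_apply, mul_add]
  exact integral_add (integrable_fun_mul hφ.1 (memLp_translate hg.1 x))
    (integrable_fun_mul hφ.1 (memLp_translate hh.1 x))

lemma pairing_smul_right (r : ℝ) (φ g : p.Observable) :
    pairing φ (r • g) = r * pairing φ g := by
  unfold pairing
  rw [← smul_eq_mul, smul_finsum]
  refine finsum_congr fun x => ?_
  simp only [translate, Pi.smul_apply, smul_eq_mul]
  rw [← integral_const_mul]
  congr 1; ext z; ring

lemma moment_add {φ ψ : p.Observable} (hφ : φ ∈ p.Pairable) (hψ : ψ ∈ p.Pairable) :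
    moment (φ + ψ) = moment φ + moment ψ := by
  rw [moment_eq, moment_eq, moment_eq, ← finsum_add_distrib
    ((hφ.2 _ siteEnergy_mem).subset (Function.support_mul_subset_right _ _))
    ((hψ.2 _ siteEnergy_mem).subset (Function.support_mul_subset_right _ _))]
  refine finsum_congr fun x => ?_
  simp only [Pi.add_apply, add_mul]
  rw [integral_add (integrable_fun_mul hφ.1 (memLp_translate siteEnergy_mem.1 x))
    (integrable_fun_mul hψ.1 (memLp_translate siteEnergy_mem.1 x)), mul_add]

lemma moment_smul (r : ℝ) (φ : p.Observable) : moment (r • φ) = r * moment φ := by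
  unfold moment
  rw [← smul_eq_mul, smul_finsum]
  refine finsum_congr fun x => ?_
  simp only [Pi.smul_apply, smul_eq_mul, mul_assoc]
  rw [integral_const_mul]
  ring

variable (p) in
/-- The linear functional `(g, a) ↦ ≪ φ, g ≫_⋆ + a ≪ φ ≫_⋆⋆`, as a function of `φ`. -/
def form : p.Quad₀ →ₗ[ℝ] (p.Quad × ℝ) →ₗ[ℝ] ℝ :=
  LinearMap.mk₂ ℝ
    (fun (φ : p.Quad₀) (w : p.Quad × ℝ) =>
      pairing (φ : p.Observable) (w.1 : p.Observable) + w.2 * moment (φ : p.Observable))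
    (fun φ ψ w => by
      rw [Submodule.coe_add, pairing_add_left (quad₀_le_pairable φ.2) (quad₀_le_pairable ψ.2)
        (quad_le_localSq w.1.2), moment_add (quad₀_le_pairable φ.2) (quad₀_le_pairable ψ.2)]
      ring)
    (fun r φ w => by
      rw [Submodule.coe_smul, pairing_smul_left, moment_smul, smul_eq_mul]
      ring)
    (fun φ w w' => by
      rw [Prod.fst_add, Prod.snd_add, Submodule.coe_add, pairing_add_right
        (quad₀_le_pairable φ.2) (quad_le_localSq w.1.2) (quad_le_localSq w'.1.2)]
      ring)
    (fun r φ w => by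
      rw [Prod.smul_fst, Prod.smul_snd, Submodule.coe_smul, pairing_smul_right, smul_eq_mul,
        smul_eq_mul]
      ring)

/-! ### The Dirichlet form is quadratic -/

lemma siteGrad_siteEnergy : siteGrad 0 (fun z : p.Phase => z.2 0 ^ 2) = 0 := by
  ext z; simp [siteGrad, increment, flip]

lemma bondGrad_siteEnergy (z : p.Phase) :
    bondGrad 0 (fun z : p.Phase => z.2 0 ^ 2) z = p.energyGrad z := by
  simp [bondGrad, increment, exchange, energyGrad]

lemma dirichlet_eq (a : ℝ) (g : p.Observable) : dirichlet a g =
    p.γ / 2 * ∫ z, siteGradSum g z ^ 2 ∂p.law +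
      p.lam / 2 * ∫ z, (a * p.energyGrad z + bondGradSum g z) ^ 2 ∂p.law := by
  simp only [dirichlet, siteGrad_siteEnergy, bondGrad_siteEnergy]
  simp

lemma siteGradSum_eq (g : p.Observable) : siteGradSum g = gradSum (flip 0) g := rfl

lemma bondGradSum_eq (g : p.Observable) : bondGradSum g = gradSum (exchange 0 (0 + 1)) g := rfl

lemma memLp_energyGrad : MemLp p.energyGrad 2 p.law := by
  convert (memLp_coord_mul (p := p) 1 1).sub (memLp_coord_mul (p := p) 0 0) using 1
  ext z; simp [energyGrad, sq]

lemma dirichlet_smul (r a : ℝ) (g : p.Observable) :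
    dirichlet (r * a) (r • g) = r ^ 2 * dirichlet a g := by
  rw [dirichlet_eq, dirichlet_eq, siteGradSum_eq, bondGradSum_eq, IsLocalMove.gradSum_smul,
    IsLocalMove.gradSum_smul]
  simp only [Pi.smul_apply, smul_eq_mul, mul_pow, mul_assoc, ← mul_add]
  rw [integral_const_mul, integral_const_mul]
  simp only [siteGradSum_eq, bondGradSum_eq]
  ring

lemma integral_parallelogram {f g : p.Observable} (hf : MemLp f 2 p.law) (hg : MemLp g 2 p.law) :
    (∫ z, (f z + g z) ^ 2 ∂p.law) + ∫ z, (f z - g z) ^ 2 ∂p.law =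
      2 * (∫ z, f z ^ 2 ∂p.law) + 2 * ∫ z, g z ^ 2 ∂p.law := by
  have h1 : Integrable (fun z => (f z + g z) ^ 2) p.law := (hf.add hg).integrable_sq
  have h2 : Integrable (fun z => (f z - g z) ^ 2) p.law := (hf.sub hg).integrable_sq
  rw [← integral_add h1 h2, ← integral_const_mul,
    ← integral_const_mul, ← integral_add (hf.integrable_sq.const_mul 2)
    (hg.integrable_sq.const_mul 2)]
  congr 1; ext z; ring

lemma dirichlet_parallelogram {a b : ℝ} {g h : p.Observable} (hg : g ∈ p.LocalSq)
    (hh : h ∈ p.LocalSq) :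
    dirichlet (a + b) (g + h) + dirichlet (a - b) (g - h) =
      2 * dirichlet a g + 2 * dirichlet b h := by
  have hs : ∀ {θ : p.Phase → p.Phase}, IsLocalMove θ →
      gradSum θ (g - h) = gradSum θ g - gradSum θ h := fun {θ} hθ => by
    rw [sub_eq_add_neg, ← neg_one_smul ℝ h, hθ.gradSum_add hg (Submodule.smul_mem _ _ hh),
      IsLocalMove.gradSum_smul, neg_one_smul, sub_eq_add_neg]
  have h1 := isLocalMove_flip (p := p) 0
  have h2 := isLocalMove_exchange (p := p) 0 (0 + 1)
  have e1 := integral_parallelogram (h1.memLp_gradSum hg) (h1.memLp_gradSum hh)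
  have e2 := integral_parallelogram
    ((memLp_energyGrad.const_mul a).add (h2.memLp_gradSum hg))
    ((memLp_energyGrad.const_mul b).add (h2.memLp_gradSum hh))
  simp only [dirichlet_eq, siteGradSum_eq, bondGradSum_eq, h1.gradSum_add hg hh,
    h2.gradSum_add hg hh, hs h1, hs h2]
  simp only [Pi.add_apply, Pi.sub_apply] at e1 e2 ⊢
  have e3 : ∀ z, (a + b) * p.energyGrad z + (gradSum (exchange 0 (0 + 1)) g z +
      gradSum (exchange 0 (0 + 1)) h z) = a * p.energyGrad z + gradSum (exchange 0 (0 + 1)) g z +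
      (b * p.energyGrad z + gradSum (exchange 0 (0 + 1)) h z) := fun z => by ring
  have e4 : ∀ z, (a - b) * p.energyGrad z + (gradSum (exchange 0 (0 + 1)) g z -
      gradSum (exchange 0 (0 + 1)) h z) = a * p.energyGrad z + gradSum (exchange 0 (0 + 1)) g z -
      (b * p.energyGrad z + gradSum (exchange 0 (0 + 1)) h z) := fun z => by ring
  simp only [e3, e4]
  linear_combination (p.γ / 2) * e1 + (p.lam / 2) * e2

lemma dirichlet_nonneg (a : ℝ) (g : p.Observable) : 0 ≤ dirichlet a g := by
  rw [dirichlet_eq]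
  have h1 := p.γ_pos
  have h2 := p.lam_pos
  have h3 : 0 ≤ ∫ z, siteGradSum g z ^ 2 ∂p.law := integral_nonneg fun z => sq_nonneg _
  have h4 : 0 ≤ ∫ z, (a * p.energyGrad z + bondGradSum g z) ^ 2 ∂p.law :=
    integral_nonneg fun z => sq_nonneg _
  positivity

/-! ### The supremum that defines the semi-norm is finite -/

lemma integral_shift (x : ℤ) (f : p.Observable) :
    ∫ z, f (shift x z) ∂p.law = ∫ z, f z ∂p.law := by
  have e : MeasurableEmbedding (shift (p := p) x) := by
    refine (MeasurableEquiv.mk ⟨shift x, shift (-x), fun z => ?_, fun z => ?_⟩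
      (measurePreserving_shift x).measurable
      (measurePreserving_shift (-x)).measurable).measurableEmbedding <;>
    ext <;> simp [shift]
  exact (measurePreserving_shift x).integral_comp e f

/-- `∇_{0,1} (Γ_g)` is orthogonal to `ω_1² - ω_0²`. -/
lemma integral_energyGrad_mul {g : p.Observable} (hg : g ∈ p.LocalSq) :
    ∫ z, p.energyGrad z * bondGradSum g z ∂p.law = 0 := by
  have hθ := isLocalMove_exchange (p := p) 0 (0 + 1)
  rw [bondGradSum_eq, ← hθ.pairing_increment memLp_energyGrad hg]
  have h1 : increment (exchange 0 (0 + 1)) p.energyGrad = (-2 : ℝ) • p.energyGrad := by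
    ext z; simp [increment, exchange, energyGrad]; ring
  rw [h1, pairing_smul_left]
  obtain ⟨hg2, Λ, hΛ⟩ := hg
  set u : ℤ → ℝ := fun k => ∫ z, translate k siteEnergy z * g z ∂p.law with hu
  have h2 : ∀ x, ∫ z, p.energyGrad z * translate x g z ∂p.law = u (1 - x) - u (-x) := by
    intro x
    rw [← integral_shift (-x), hu]
    simp only
    rw [← integral_sub
      (integrable_fun_mul (memLp_translate siteEnergy_mem.1 _) hg2)
      (integrable_fun_mul (memLp_translate siteEnergy_mem.1 _) hg2)]
    congr 1; ext z
    have : shift x (shift (-x) z) = z := by ext <;> simp [shift]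
    simp only [translate_siteEnergy]
    rw [show p.energyGrad (shift (-x) z) = z.2 (1 - x) ^ 2 - z.2 (-x) ^ 2 by
        simp [energyGrad, shift, neg_add_eq_sub],
      show translate x g (shift (-x) z) = g z by simp only [translate, this]]
    ring
  obtain ⟨k₀, hk₀⟩ : ∃ k, k ∉ Λ := Infinite.exists_notMem_finset Λ
  have h3 : ∀ k ∉ Λ, u k = u k₀ := by
    intro k hk
    have e := isLocalMove_exchange (p := p) k k₀
    have h4 := e.integral_increment_translate (memLp_translate siteEnergy_mem.1 k)
      (g := g) ⟨hg2, Λ, hΛ⟩ 0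
    have h5 : translate 0 g = g := by ext z; simp [translate, shift]
    rw [h5, localIn_exchange hΛ hk hk₀] at h4
    have h6 : increment (exchange k k₀) (translate k (siteEnergy (p := p))) =
        translate k₀ siteEnergy - translate k siteEnergy := by
      ext z; simp [translate_siteEnergy, increment, exchange]
    rw [h6] at h4
    simp only [Pi.sub_apply, Pi.zero_apply, mul_zero, integral_zero, sub_mul] at h4
    rw [integral_sub
      (integrable_fun_mul (memLp_translate siteEnergy_mem.1 _) hg2)
      (integrable_fun_mul (memLp_translate siteEnergy_mem.1 _) hg2)] at h4
    simp only [hu]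
    linarith
  have h7 : (Function.support fun k => u k - u k₀).Finite :=
    Λ.finite_toSet.subset fun k hk => by
      by_contra h
      exact hk (by simp [h3 k h])
  unfold pairing
  have h8 : ∀ x, ∫ z, p.energyGrad z * translate x g z ∂p.law =
      (u (Equiv.subLeft 1 x) - u k₀) - (u (Equiv.neg ℤ x) - u k₀) := by
    intro x; rw [h2]; simp
  simp only [h8]
  rw [finsum_sub_distrib, finsum_comp_equiv (Equiv.subLeft (1 : ℤ)) (f := fun k => u k - u k₀),
    finsum_comp_equiv (Equiv.neg ℤ) (f := fun k => u k - u k₀), sub_self, mul_zero]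
  · exact h7.preimage (Equiv.subLeft (1 : ℤ)).injective.injOn
  · exact h7.preimage (Equiv.neg ℤ).injective.injOn

lemma gradSum_shift {θ θ' : p.Phase → p.Phase} {y : ℤ}
    (h : ∀ z, shift y (θ' z) = θ (shift y z)) (g : p.Observable) (z : p.Phase) :
    gradSum θ' g z = gradSum θ g (shift y z) := by
  unfold gradSum
  rw [← finsum_comp_equiv (Equiv.addRight (-y))
    (f := fun x => increment θ (translate x g) (shift y z))]
  refine finsum_congr fun x => ?_
  have hs : ∀ z : p.Phase, shift x z = shift (x + -y) (shift y z) := by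
    intro z; ext v <;> simp only [shift] <;> ring_nf
  simp only [increment, translate, Equiv.coe_addRight]
  rw [hs (θ' z), hs z, h]

lemma shift_flip (y : ℤ) (z : p.Phase) : shift y (flip y z) = flip 0 (shift y z) := by
  ext v
  · simp [shift, flip]
  · by_cases hv : v = 0
    · subst hv; simp [shift, flip]
    · simp [shift, flip, Function.update, hv]

lemma shift_exchange (y : ℤ) (z : p.Phase) :
    shift y (exchange y (y + 1) z) = exchange 0 (0 + 1) (shift y z) := by
  ext v
  · simp [shift, exchange]
  · simp only [shift, exchange]
    by_cases h0 : v = 0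
    · subst h0; simp
    by_cases h1 : v = 1
    · subst h1; simp
    rw [Equiv.swap_apply_of_ne_of_ne (by simpa using h0) (by simpa using h1),
      Equiv.swap_apply_of_ne_of_ne h0 (by simpa using h1)]

lemma two_integral_mul_le {F K : p.Observable} (hF : MemLp F 2 p.law) (hK : MemLp K 2 p.law)
    {c : ℝ} (hc : 0 < c) :
    2 * ∫ z, F z * K z ∂p.law ≤
      2 / c * (∫ z, F z ^ 2 ∂p.law) + c / 2 * ∫ z, K z ^ 2 ∂p.law := by
  rw [← integral_const_mul, ← integral_const_mul, ← integral_const_mul,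
    ← integral_add (hF.integrable_sq.const_mul _) (hK.integrable_sq.const_mul _)]
  refine integral_mono ((integrable_fun_mul hF hK).const_mul 2)
    ((hF.integrable_sq.const_mul _).add (hK.integrable_sq.const_mul _)) fun z => ?_
  have h : 2 / c * F z ^ 2 + c / 2 * K z ^ 2 - 2 * (F z * K z) =
      2 / c * (F z - c / 2 * K z) ^ 2 := by field_simp; ring
  have h' : 0 ≤ 2 / c * (F z - c / 2 * K z) ^ 2 := by positivity
  simp only
  linarith

lemma moment_siteGrad {F : p.Observable} (hF : MemLp F 2 p.law) (y : ℤ) :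
    moment (siteGrad y F) = 0 := by
  have hθ := isLocalMove_flip (p := p) y
  rw [moment_eq, ← finsum_zero (M := ℝ) (α := ℤ)]
  refine finsum_congr fun x => ?_
  have h : increment (flip y) (translate x (siteEnergy (p := p))) = 0 := by
    ext z
    by_cases h : x = y
    · subst h; simp [translate_siteEnergy, increment, flip]
    · simp [translate_siteEnergy, increment, flip, h]
  rw [siteGrad, hθ.integral_increment_translate hF siteEnergy_mem, h]
  simp

lemma moment_bondGrad {F : p.Observable} (hF : MemLp F 2 p.law) (y : ℤ) :
    moment (bondGrad y F) = - ∫ z, F z * p.energyGrad (shift y z) ∂p.law := by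
  have hθ := isLocalMove_exchange (p := p) y (y + 1)
  rw [moment_eq]
  have h : ∀ x, increment (exchange y (y + 1)) (translate x (siteEnergy (p := p))) =
      ((if x = y then (1 : ℝ) else 0) - if x = y + 1 then (1 : ℝ) else 0) •
        translate y p.energyGrad := by
    intro x
    ext z
    by_cases h : x = y
    · subst h; rw [translate_siteEnergy]
      simp [increment, exchange, translate, energyGrad, shift]
    · by_cases h' : x = y + 1
      · subst h'
        rw [translate_siteEnergy]
        simp [increment, exchange, translate, energyGrad, shift]
      · simp [translate_siteEnergy, increment, exchange, h, h', Equiv.swap_apply_of_ne_of_ne]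
  rw [finsum_eq_sum_of_support_subset (s := {y, y + 1})]
  · rw [Finset.sum_pair (by simp), bondGrad, hθ.integral_increment_translate hF siteEnergy_mem,
      hθ.integral_increment_translate hF siteEnergy_mem, h, h]
    simp [translate, mul_neg, integral_neg]
    ring
  · intro x hx
    by_contra hn
    simp only [Finset.coe_insert, Finset.coe_singleton, Set.mem_insert_iff,
      Set.mem_singleton_iff, not_or] at hn
    refine hx ?_
    simp only [bondGrad]
    rw [hθ.integral_increment_translate hF siteEnergy_mem, h]
    simp [hn.1, hn.2]

lemma exists_bound_siteGrad {F : p.Observable} (hF : MemLp F 2 p.law) (y : ℤ) :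
    ∃ K : ℝ, ∀ g ∈ p.LocalSq, ∀ a : ℝ,
      2 * pairing (siteGrad y F) g + 2 * a * moment (siteGrad y F) ≤ K + dirichlet a g := by
  refine ⟨2 / p.γ * ∫ z, F z ^ 2 ∂p.law, fun g hg a => ?_⟩
  have hθ := isLocalMove_flip (p := p) y
  have h2 := two_integral_mul_le hF (hθ.memLp_gradSum hg) p.γ_pos
  have h3 : ∫ z, gradSum (flip y) g z ^ 2 ∂p.law = ∫ z, siteGradSum g z ^ 2 ∂p.law := by
    simp only [gradSum_shift (shift_flip y) g]
    exact integral_shift y fun z => gradSum (flip 0) g z ^ 2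
  rw [h3] at h2
  rw [moment_siteGrad hF, siteGrad, hθ.pairing_increment hF hg, dirichlet_eq]
  have h4 : 0 ≤ p.lam / 2 * ∫ z, (a * p.energyGrad z + bondGradSum g z) ^ 2 ∂p.law :=
    mul_nonneg (by have := p.lam_pos; positivity) (integral_nonneg fun z => sq_nonneg _)
  linarith

lemma exists_bound_bondGrad {F : p.Observable} (hF : MemLp F 2 p.law) (y : ℤ) :
    ∃ K : ℝ, ∀ g ∈ p.LocalSq, ∀ a : ℝ,
      2 * pairing (bondGrad y F) g + 2 * a * moment (bondGrad y F) ≤ K + dirichlet a g := by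
  refine ⟨2 / p.lam * ∫ z, F z ^ 2 ∂p.law, fun g hg a => ?_⟩
  have hθ := isLocalMove_exchange (p := p) y (y + 1)
  have hX : MemLp (fun z => p.energyGrad (shift y z)) 2 p.law :=
    memLp_translate memLp_energyGrad y
  have hH := hθ.memLp_gradSum hg
  have hK : MemLp (fun z => gradSum (exchange y (y + 1)) g z - a * p.energyGrad (shift y z))
    2 p.law := hH.sub (hX.const_mul a)
  have h2 := two_integral_mul_le hF hK p.lam_pos
  have h3 : ∫ z, (gradSum (exchange y (y + 1)) g z - a * p.energyGrad (shift y z)) ^ 2 ∂p.law =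
      ∫ z, (bondGradSum g z - a * p.energyGrad z) ^ 2 ∂p.law := by
    simp only [gradSum_shift (shift_exchange y) g]
    exact integral_shift y fun z => (bondGradSum g z - a * p.energyGrad z) ^ 2
  have hB : MemLp (bondGradSum g) 2 p.law :=
    (isLocalMove_exchange (p := p) 0 (0 + 1)).memLp_gradSum hg
  have h5 : ∫ z, (bondGradSum g z - a * p.energyGrad z) ^ 2 ∂p.law =
      ∫ z, (a * p.energyGrad z + bondGradSum g z) ^ 2 ∂p.law := by
    have i1 : Integrable (fun z => (bondGradSum g z - a * p.energyGrad z) ^ 2) p.law :=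
      (hB.sub (memLp_energyGrad.const_mul a)).integrable_sq
    have i2 : Integrable (fun z => (a * p.energyGrad z + bondGradSum g z) ^ 2) p.law :=
      ((memLp_energyGrad.const_mul a).add hB).integrable_sq
    rw [← sub_eq_zero, ← integral_sub i1 i2]
    have : ∀ z, (bondGradSum g z - a * p.energyGrad z) ^ 2 -
        (a * p.energyGrad z + bondGradSum g z) ^ 2 =
        (-4 * a) * (p.energyGrad z * bondGradSum g z) := fun z => by ring
    simp only [this]
    rw [integral_const_mul, integral_energyGrad_mul hg, mul_zero]
  have h6 : ∫ z, F z * (gradSum (exchange y (y + 1)) g z - a * p.energyGrad (shift y z)) ∂p.law =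
      (∫ z, F z * gradSum (exchange y (y + 1)) g z ∂p.law) -
        a * ∫ z, F z * p.energyGrad (shift y z) ∂p.law := by
    rw [← integral_const_mul, ← integral_sub (integrable_fun_mul hF hH)
      ((integrable_fun_mul hF hX).const_mul a)]
    congr 1; ext z; ring
  rw [h6, h3, h5] at h2
  rw [moment_bondGrad hF, bondGrad, hθ.pairing_increment hF hg, dirichlet_eq]
  have h4 : 0 ≤ p.γ / 2 * ∫ z, siteGradSum g z ^ 2 ∂p.law :=
    mul_nonneg (by have := p.γ_pos; positivity) (integral_nonneg fun z => sq_nonneg _)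
  linarith

variable (p) in
/-- The functions for which the supremum that defines the semi-norm is finite. -/
def Bounded : Submodule ℝ p.Observable where
  carrier := {φ | φ ∈ p.Pairable ∧ ∃ K : ℝ, ∀ g ∈ p.LocalSq, ∀ a : ℝ,
    2 * pairing φ g + 2 * a * moment φ ≤ K + dirichlet a g}
  zero_mem' := ⟨zero_mem _, 0, fun g _ a => by
    simpa [pairing, moment] using dirichlet_nonneg a g⟩
  add_mem' := by
    rintro φ ψ ⟨hφ, K, hK⟩ ⟨hψ, K', hK'⟩
    refine ⟨add_mem hφ hψ, 2 * K + 2 * K', fun g hg a => ?_⟩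
    have hg' : (2⁻¹ : ℝ) • g ∈ p.LocalSq := Submodule.smul_mem _ _ hg
    have h1 := hK _ hg' (2⁻¹ * a)
    have h2 := hK' _ hg' (2⁻¹ * a)
    rw [dirichlet_smul, pairing_smul_right] at h1 h2
    rw [pairing_add_left hφ hψ hg, moment_add hφ hψ]
    have := dirichlet_nonneg a g
    linarith
  smul_mem' := by
    rintro r φ ⟨hφ, K, hK⟩
    refine ⟨Submodule.smul_mem _ _ hφ, r ^ 2 * K, fun g hg a => ?_⟩
    rw [pairing_smul_left, moment_smul]
    rcases eq_or_ne r 0 with rfl | hr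
    · simpa using dirichlet_nonneg a g
    · have h1 := hK (r⁻¹ • g) (Submodule.smul_mem _ _ hg) (r⁻¹ * a)
      rw [dirichlet_smul, pairing_smul_right] at h1
      have h2 := mul_le_mul_of_nonneg_left h1 (sq_nonneg r)
      have e1 : r ^ 2 * (2 * (r⁻¹ * pairing φ g) + 2 * (r⁻¹ * a) * moment φ) =
          2 * (r * pairing φ g) + 2 * a * (r * moment φ) := by field_simp
      have e2 : r ^ 2 * (K + r⁻¹ ^ 2 * dirichlet a g) = r ^ 2 * K + dirichlet a g := by
        field_simp
      linarith

lemma quad₀_le_bounded : p.Quad₀ ≤ p.Bounded :=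
  quad₀_le fun F hF x => by
    have hF' := (homQuad_le_localSq hF).1
    exact ⟨⟨(isLocalMove_flip x).increment_mem hF', exists_bound_siteGrad hF' x⟩,
      ⟨(isLocalMove_exchange x (x + 1)).increment_mem hF', exists_bound_bondGrad hF' x⟩⟩

/-! ### The Hilbert space -/

section Dual

variable {V W : Type*} [AddCommGroup V] [Module ℝ V] [AddCommGroup W] [Module ℝ W]
  {B : V →ₗ[ℝ] W →ₗ[ℝ] ℝ} {E : W → ℝ}

lemma bound_of_dual (hE : ∀ (r : ℝ) w, E (r • w) = r ^ 2 * E w) {v : V} {K : ℝ}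
    (hK : ∀ w, 2 * B v w - E w ≤ K) (w : W) : B v w ≤ √K * √(E w) := by
  have hK₀ : 0 ≤ K := by
    have h := hK 0
    have h0 : E 0 = 0 := by simpa using hE 0 0
    simpa [h0] using h
  have h1 : discrim (E w) (-2 * B v w) K ≤ 0 := by
    refine discrim_le_zero fun t => ?_
    have h := hK (t • w)
    rw [hE, map_smul, smul_eq_mul] at h
    nlinarith
  rw [← Real.sqrt_mul hK₀]
  refine Real.le_sqrt_of_sq_le ?_
  unfold discrim at h1
  nlinarith

lemma dual_add_le (hE : ∀ (r : ℝ) w, E (r • w) = r ^ 2 * E w) (hE₀ : ∀ w, 0 ≤ E w)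
    (hb : ∀ v, BddAbove (Set.range fun w => 2 * B v w - E w)) (u v : V) :
    √(⨆ w, (2 * B (u + v) w - E w)) ≤
      √(⨆ w, (2 * B u w - E w)) + √(⨆ w, (2 * B v w - E w)) := by
  refine Real.sqrt_le_iff.2 ⟨by positivity, ciSup_le fun w => ?_⟩
  have h1 := bound_of_dual hE (fun w => le_ciSup (hb u) w) w
  have h2 := bound_of_dual hE (fun w => le_ciSup (hb v) w) w
  have h3 := Real.sq_sqrt (hE₀ w)
  rw [map_add, LinearMap.add_apply]
  nlinarith [sq_nonneg (√(⨆ w, (2 * B u w - E w)) + √(⨆ w, (2 * B v w - E w)) - √(E w))]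

lemma dual_smul (hE : ∀ (r : ℝ) w, E (r • w) = r ^ 2 * E w) (hE₀ : ∀ w, 0 ≤ E w)
    (hb : ∀ v, BddAbove (Set.range fun w => 2 * B v w - E w)) (r : ℝ) (v : V) :
    (⨆ w, (2 * B (r • v) w - E w)) = r ^ 2 * ⨆ w, (2 * B v w - E w) := by
  have key : ∀ (r : ℝ), r ≠ 0 → ∀ v : V,
      (⨆ w, (2 * B (r • v) w - E w)) ≤ r ^ 2 * ⨆ w, (2 * B v w - E w) := by
    intro r hr v
    refine ciSup_le fun w => ?_
    have h := mul_le_mul_of_nonneg_left (le_ciSup (hb v) (r⁻¹ • w)) (sq_nonneg r)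
    refine le_trans (le_of_eq ?_) h
    simp only [hE, map_smul, LinearMap.smul_apply, smul_eq_mul]
    field_simp
  rcases eq_or_ne r 0 with rfl | hr
  · have h0 : E 0 = 0 := by simpa using hE 0 0
    simp only [zero_smul, map_zero, LinearMap.zero_apply, mul_zero, zero_sub, ne_eq,
      OfNat.ofNat_ne_zero, not_false_eq_true, zero_pow, zero_mul]
    refine le_antisymm (ciSup_le fun w => neg_nonpos.2 (hE₀ w)) ?_
    have h := le_ciSup (hb 0) 0
    simpa [h0] using h
  · refine le_antisymm (key r hr v) ?_
    have h := key r⁻¹ (inv_ne_zero hr) (r • v)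
    rw [inv_smul_smul₀ hr] at h
    calc _ ≤ r ^ 2 * (r⁻¹ ^ 2 * ⨆ w, (2 * B (r • v) w - E w)) :=
          mul_le_mul_of_nonneg_left h (sq_nonneg r)
      _ = _ := by field_simp

lemma dual_parallelogram_le (hE : ∀ (r : ℝ) w, E (r • w) = r ^ 2 * E w)
    (hp : ∀ w w', E (w + w') + E (w - w') = 2 * E w + 2 * E w')
    (hb : ∀ v, BddAbove (Set.range fun w => 2 * B v w - E w)) (u v : V) :
    (⨆ w, (2 * B (u + v) w - E w)) + (⨆ w, (2 * B (u - v) w - E w)) ≤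
      2 * (⨆ w, (2 * B u w - E w)) + 2 * ⨆ w, (2 * B v w - E w) := by
  rw [← le_sub_iff_add_le]
  refine ciSup_le fun w => ?_
  rw [le_sub_comm]
  refine ciSup_le fun w' => ?_
  have h1 := le_ciSup (hb u) ((2⁻¹ : ℝ) • (w + w'))
  have h2 := le_ciSup (hb v) ((2⁻¹ : ℝ) • (w - w'))
  have h3 := hp w w'
  simp only [hE, map_smul, smul_eq_mul, map_add, map_sub] at h1 h2
  simp only [map_add, map_sub, LinearMap.add_apply, LinearMap.sub_apply]
  linarith

end Dual

lemma tripleNormSq_eq (φ : p.Quad₀) : tripleNormSq (φ : p.Observable) =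
    ⨆ w : p.Quad × ℝ, (2 * p.form φ w - dirichlet w.2 (w.1 : p.Observable)) := by
  unfold tripleNormSq
  refine iSup_congr fun w => ?_
  simp only [form, LinearMap.mk₂_apply]
  ring

lemma bddAbove_form (φ : p.Quad₀) : BddAbove (Set.range fun w : p.Quad × ℝ =>
    2 * p.form φ w - dirichlet w.2 (w.1 : p.Observable)) := by
  obtain ⟨-, K, hK⟩ := quad₀_le_bounded φ.2
  refine ⟨K, ?_⟩
  rintro _ ⟨w, rfl⟩
  have h := hK w.1 (quad_le_localSq w.1.2) w.2
  simp only [form, LinearMap.mk₂_apply]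
  linarith

lemma dirichlet_smul' (r : ℝ) (w : p.Quad × ℝ) :
    dirichlet (r • w).2 ((r • w).1 : p.Observable) =
      r ^ 2 * dirichlet w.2 (w.1 : p.Observable) :=
  dirichlet_smul r w.2 (w.1 : p.Observable)

variable (p) in
/-- `|||·|||₁` as a semi-norm on `Q₀`. -/
def tripleSeminorm : Seminorm ℝ p.Quad₀ :=
  Seminorm.of (fun φ => tripleNorm (φ : p.Observable))
    (fun φ ψ => by
      simp only [tripleNorm, tripleNormSq_eq]
      exact dual_add_le dirichlet_smul' (fun w => dirichlet_nonneg _ _) bddAbove_form φ ψ)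
    (fun r φ => by
      simp only [tripleNorm, tripleNormSq_eq]
      rw [dual_smul dirichlet_smul' (fun w => dirichlet_nonneg _ _) bddAbove_form r φ,
        Real.sqrt_mul (sq_nonneg r), Real.sqrt_sq_eq_abs, Real.norm_eq_abs])

lemma tripleNorm_sq (φ : p.Quad₀) :
    tripleNorm (φ : p.Observable) ^ 2 = tripleNormSq (φ : p.Observable) := by
  refine Real.sq_sqrt ?_
  rw [tripleNormSq_eq]
  have h := le_ciSup (bddAbove_form φ) 0
  have h0 := dirichlet_smul' (p := p) 0 0
  simp only [smul_zero] at h0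
  refine le_trans ?_ h
  simp [show dirichlet (0 : ℝ) (0 : p.Observable) = 0 by simpa using h0]

lemma tripleNorm_parallelogram (φ ψ : p.Quad₀) :
    tripleNorm ((φ + ψ : p.Quad₀) : p.Observable) ^ 2 +
      tripleNorm ((φ - ψ : p.Quad₀) : p.Observable) ^ 2 =
    2 * (tripleNorm (φ : p.Observable) ^ 2 + tripleNorm (ψ : p.Observable) ^ 2) := by
  have hp : ∀ w w' : p.Quad × ℝ,
      dirichlet (w + w').2 ((w + w').1 : p.Observable) +
        dirichlet (w - w').2 ((w - w').1 : p.Observable) =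
      2 * dirichlet w.2 (w.1 : p.Observable) + 2 * dirichlet w'.2 (w'.1 : p.Observable) :=
    fun w w' => dirichlet_parallelogram (quad_le_localSq w.1.2) (quad_le_localSq w'.1.2)
  have h1 := dual_parallelogram_le dirichlet_smul' hp bddAbove_form φ ψ
  have h2 := dual_parallelogram_le dirichlet_smul' hp bddAbove_form (φ + ψ) (φ - ψ)
  have e1 : φ + ψ + (φ - ψ) = (2 : ℝ) • φ := by rw [two_smul]; abel
  have e2 : φ + ψ - (φ - ψ) = (2 : ℝ) • ψ := by rw [two_smul]; abel
  rw [e1, e2, dual_smul dirichlet_smul' (fun w => dirichlet_nonneg _ _) bddAbove_form,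
    dual_smul dirichlet_smul' (fun w => dirichlet_nonneg _ _) bddAbove_form] at h2
  simp only [tripleNorm_sq, tripleNormSq_eq]
  linarith

variable (p) in
/-- The space `Q₀`, endowed with the semi-norm `|||·|||₁`. -/
def PreH1 : Type := p.Quad₀

instance : SeminormedAddCommGroup p.PreH1 :=
  p.tripleSeminorm.toAddGroupSeminorm.toSeminormedAddCommGroup

instance : NormedSpace ℝ p.PreH1 :=
  letI : Module ℝ p.PreH1 := inferInstanceAs (Module ℝ p.Quad₀)
  { norm_smul_le := fun r φ => (map_smul_eq_mul p.tripleSeminorm r φ).le }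

variable (p) in
/-- The space `H₁`: the completion of the quotient of `Q₀` by the kernel of `|||·|||₁`. -/
abbrev H1 : Type := UniformSpace.Completion p.PreH1

lemma parallelogram_H1 (x y : p.H1) :
    ‖x + y‖ * ‖x + y‖ + ‖x - y‖ * ‖x - y‖ = 2 * (‖x‖ * ‖x‖ + ‖y‖ * ‖y‖) := by
  induction x, y using UniformSpace.Completion.induction_on₂ with
  | hp => exact isClosed_eq (by fun_prop) (by fun_prop)
  | ih φ ψ =>
    rw [← UniformSpace.Completion.coe_add, ← UniformSpace.Completion.coe_sub]
    simp only [UniformSpace.Completion.norm_coe, ← sq]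
    exact tripleNorm_parallelogram (p := p) φ ψ

/-- The norm of `H₁` is Hilbertian; the inner product is given by polarization. -/
instance : InnerProductSpace ℝ p.H1 :=
  InnerProductSpace.ofNorm (𝕜 := ℝ) (E := p.H1) parallelogram_H1

variable (p) in
/-- The canonical map `Q₀ → H₁`. -/
def toH1 : p.Quad₀ →ₗ[ℝ] p.H1 :=
  (UniformSpace.Completion.toComplₗᵢ (𝕜 := ℝ) (E := p.PreH1)).toLinearMap

lemma denseRange_toH1 : DenseRange p.toH1 :=
  UniformSpace.Completion.denseRange_coe (α := p.PreH1)

lemma norm_toH1 (φ : p.Quad₀) : ‖p.toH1 φ‖ = tripleNorm (φ : p.Observable) :=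
  UniformSpace.Completion.norm_coe (E := p.PreH1) φ

/-! ### The generator maps `Q` to `Q₀` -/

lemma siteGrad_mem {F : p.Observable} (hF : F ∈ p.HomQuad) (x : ℤ) : siteGrad x F ∈ p.Quad₀ :=
  ⟨{x}, fun _ => F, 0, fun _ _ => ⟨hF, zero_mem _⟩, by ext z; simp [bondGrad, increment]⟩

lemma bondGrad_mem {F : p.Observable} (hF : F ∈ p.HomQuad) (x : ℤ) : bondGrad x F ∈ p.Quad₀ :=
  ⟨{x}, 0, fun _ => F, fun _ _ => ⟨zero_mem _, hF⟩, by ext z; simp [siteGrad, increment]⟩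

lemma offDiag_mem (b : p.Coeff) {i j : ℤ} (hij : i ≠ j) :
    weighted (fun ω => ω i * ω j) b ∈ p.Quad₀ := by
  convert Submodule.smul_mem _ (-2⁻¹ : ℝ) (siteGrad_mem (weighted_mem b i j) i) using 1
  ext z
  simp [siteGrad, increment, flip, weighted, Function.update_of_ne hij.symm]
  ring

lemma diag_mem (b : p.Coeff) (i : ℤ) :
    weighted (fun ω => ω (i + 1) * ω (i + 1)) b - weighted (fun ω => ω i * ω i) b ∈ p.Quad₀ := by
  convert bondGrad_mem (weighted_mem b i i) i using 1
  ext z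
  simp [bondGrad, increment, exchange, weighted]

lemma mass_pos (m : p.Disorder) (x : ℤ) : (0 : ℝ) < m x :=
  (inv_pos.2 p.C_pos).trans_le (m x).2.1

variable (p) in
/-- `1 / √(m_x m_{x+1})`. -/
def bondCoeff (x : ℤ) : p.Coeff :=
  ⟨fun m => (√((m x : ℝ) * m (x + 1)))⁻¹, by
    refine Continuous.inv₀ (by fun_prop) fun m => ?_
    exact (Real.sqrt_pos.2 (mul_pos (mass_pos m x) (mass_pos m (x + 1)))).ne',
    {x, x + 1}, fun m m' h => by
      simp only
      rw [h x (by simp), h (x + 1) (by simp)]⟩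

variable (p) in
lemma energyGrad_mem : p.energyGrad ∈ p.Quad₀ := by
  convert diag_mem (1 : p.Coeff) 0 using 1
  ext z; simp [energyGrad, weighted, sq]

variable (p) in
lemma symCurrent_mem : p.symCurrent ∈ p.Quad₀ :=
  Submodule.smul_mem _ p.lam p.energyGrad_mem

lemma antisymCurrent_mem : p.antisymCurrent ∈ p.Quad₀ := by
  convert Submodule.smul_mem _ (2 : ℝ) (offDiag_mem (p.bondCoeff 0) zero_ne_one) using 1
  ext z; simp [antisymCurrent, weighted, bondCoeff]; ring

lemma current_mem : p.current ∈ p.Quad₀ := add_mem antisymCurrent_mem p.symCurrent_mem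

lemma finite_siteGrad {f : p.Observable} (hf : f ∈ p.HomQuad) :
    {x | siteGrad x f ≠ 0}.Finite := by
  obtain ⟨-, Λ, hΛ⟩ := homQuad_le_localSq hf
  exact Λ.finite_toSet.subset fun x hx => by
    by_contra h
    exact hx (localIn_flip hΛ h)

lemma finite_bondGrad {f : p.Observable} (hf : f ∈ p.HomQuad) :
    {x | bondGrad x f ≠ 0}.Finite := by
  obtain ⟨-, Λ, hΛ⟩ := homQuad_le_localSq hf
  refine (Λ.finite_toSet.union (Λ.finite_toSet.image fun u => u - 1)).subset fun x hx => ?_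
  by_contra h
  exact hx (localIn_exchange hΛ (fun h' => h (Or.inl h'))
    fun h' => h (Or.inr ⟨x + 1, h', by simp⟩))

lemma finsum_eq_of_finite {D : ℤ → p.Observable} (hD : {x | D x ≠ 0}.Finite) (z : p.Phase) :
    ∑ᶠ x, D x z = (∑ x ∈ hD.toFinset, D x) z := by
  rw [Finset.sum_apply]
  refine finsum_eq_sum_of_support_subset _ fun x hx => ?_
  simp only [Set.Finite.coe_toFinset, Set.mem_ofPred_eq]
  exact fun h => hx (by simp [h])

lemma symGen_eq {f : p.Observable} (hf : f ∈ p.HomQuad) : p.symGen f =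
    p.γ • (∑ x ∈ (finite_siteGrad hf).toFinset, siteGrad x f) +
      p.lam • ∑ x ∈ (finite_bondGrad hf).toFinset, bondGrad x f := by
  ext z
  simp only [symGen, finsum_eq_of_finite (finite_siteGrad hf),
    finsum_eq_of_finite (finite_bondGrad hf), Pi.add_apply, Pi.smul_apply, smul_eq_mul]

lemma symGen_mem {f : p.Observable} (hf : f ∈ p.HomQuad) : p.symGen f ∈ p.Quad₀ := by
  rw [symGen_eq hf]
  exact add_mem
    (Submodule.smul_mem _ _ (Submodule.sum_mem _ fun x _ => siteGrad_mem hf x))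
    (Submodule.smul_mem _ _ (Submodule.sum_mem _ fun x _ => bondGrad_mem hf x))

lemma symGen_add {f g : p.Observable} (hf : f ∈ p.HomQuad) (hg : g ∈ p.HomQuad) :
    p.symGen (f + g) = p.symGen f + p.symGen g := by
  ext z
  simp only [symGen, Pi.add_apply]
  have h1 : ∀ x, siteGrad x (f + g) z = siteGrad x f z + siteGrad x g z := fun x => by
    simp [siteGrad, increment_add]
  have h2 : ∀ x, bondGrad x (f + g) z = bondGrad x f z + bondGrad x g z := fun x => by
    simp [bondGrad, increment_add]
  simp only [h1, h2]
  rw [finsum_add_distrib, finsum_add_distrib]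
  · ring
  · exact (finite_bondGrad hf).subset fun x hx h => hx (by simp [h])
  · exact (finite_bondGrad hg).subset fun x hx h => hx (by simp [h])
  · exact (finite_siteGrad hf).subset fun x hx h => hx (by simp [h])
  · exact (finite_siteGrad hg).subset fun x hx h => hx (by simp [h])

lemma symGen_smul (r : ℝ) (f : p.Observable) : p.symGen (r • f) = r • p.symGen f := by
  ext z
  simp only [symGen, Pi.smul_apply, smul_eq_mul, siteGrad, bondGrad, increment_smul]
  simp only [← smul_eq_mul, ← smul_finsum]
  simp only [smul_eq_mul]
  ring

variable (p) in
/-- The local functions that are differentiable in each coordinate of `ω`. -/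
def LocalDiff : Submodule ℝ p.Observable where
  carrier := {f | (∀ (z : p.Phase) (x : ℤ),
      DifferentiableAt ℝ (fun t : ℝ => f (z.1, Function.update z.2 x t)) (z.2 x)) ∧
    ∃ Λ : Finset ℤ, LocalIn Λ f}
  zero_mem' := ⟨fun z x => differentiableAt_const 0, ∅, fun _ _ _ _ => rfl⟩
  add_mem' := by
    classical
    rintro f g ⟨hf, Λ, hΛ⟩ ⟨hg, Λ', hΛ'⟩
    refine ⟨fun z x => (hf z x).add (hg z x), Λ ∪ Λ', fun m ω ω' h => ?_⟩
    simp only [Pi.add_apply]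
    rw [hΛ m ω ω' fun x hx => h x (Finset.mem_union_left _ hx),
      hΛ' m ω ω' fun x hx => h x (Finset.mem_union_right _ hx)]
  smul_mem' := by
    rintro r f ⟨hf, Λ, hΛ⟩
    exact ⟨fun z x => (hf z x).const_mul r, Λ, fun m ω ω' h => by simp [hΛ m ω ω' h]⟩

lemma hasDerivAt_update (ω : ℤ → ℝ) (x i : ℤ) (s : ℝ) :
    HasDerivAt (fun t : ℝ => Function.update ω x t i) (if i = x then 1 else 0) s := by
  by_cases h : i = x
  · subst h; simpa using hasDerivAt_id' s
  · simpa [h] using hasDerivAt_const s (ω i)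

lemma hasDerivAt_weighted (b : p.Coeff) (i j x : ℤ) (z : p.Phase) :
    HasDerivAt (fun t : ℝ =>
        weighted (fun ω => ω i * ω j) b (z.1, Function.update z.2 x t))
      ((b : p.Disorder → ℝ) z.1 *
        ((if i = x then 1 else 0) * z.2 j + z.2 i * (if j = x then 1 else 0))) (z.2 x) := by
  have h := ((hasDerivAt_update z.2 x i (z.2 x)).mul
    (hasDerivAt_update z.2 x j (z.2 x))).const_mul ((b : p.Disorder → ℝ) z.1)
  simp only [Function.update_eq_self] at h
  exact h

lemma homQuad_le_localDiff : p.HomQuad ≤ p.LocalDiff :=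
  homQuad_le fun b i j => ⟨fun z x => (hasDerivAt_weighted b i j x z).differentiableAt,
    (homQuad_le_localSq (weighted_mem b i j)).2⟩

lemma finite_deriv {f : p.Observable} (hf : f ∈ p.LocalDiff) (z : p.Phase) :
    {x | deriv (fun t : ℝ => f (z.1, Function.update z.2 x t)) (z.2 x) ≠ 0}.Finite := by
  obtain ⟨-, Λ, hΛ⟩ := hf
  refine Λ.finite_toSet.subset fun x hx => ?_
  by_contra h
  refine hx ?_
  have : (fun t : ℝ => f (z.1, Function.update z.2 x t)) = fun _ => f z := by
    ext t
    refine hΛ _ _ _ fun y hy => Function.update_of_ne ?_ _ _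
    rintro rfl; exact h hy
  rw [this]; simp

lemma antisymGen_add {f g : p.Observable} (hf : f ∈ p.LocalDiff) (hg : g ∈ p.LocalDiff) :
    antisymGen (f + g) = antisymGen f + antisymGen g := by
  ext z
  simp only [antisymGen, Pi.add_apply]
  rw [← finsum_add_distrib
    ((finite_deriv hf z).subset fun x hx h => hx (by simp [h]))
    ((finite_deriv hg z).subset fun x hx h => hx (by simp [h]))]
  refine finsum_congr fun x => ?_
  rw [deriv_fun_add (hf.1 z x) (hg.1 z x), mul_add]

lemma antisymGen_smul (r : ℝ) {f : p.Observable} (hf : f ∈ p.LocalDiff) :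
    antisymGen (r • f) = r • antisymGen f := by
  ext z
  simp only [antisymGen, Pi.smul_apply]
  rw [smul_finsum]
  refine finsum_congr fun x => ?_
  simp only [smul_eq_mul]
  rw [deriv_const_mul _ (hf.1 z x)]
  ring

lemma antisymGen_weighted (b : p.Coeff) (i j : ℤ) :
    antisymGen (weighted (fun ω => ω i * ω j) b) =
      (weighted (fun ω => ω (i + 1) * ω j) (p.bondCoeff i * b) -
        weighted (fun ω => ω (i - 1) * ω j) (p.bondCoeff (i - 1) * b)) +
      (weighted (fun ω => ω i * ω (j + 1)) (p.bondCoeff j * b) -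
        weighted (fun ω => ω i * ω (j - 1)) (p.bondCoeff (j - 1) * b)) := by
  ext z
  simp only [antisymGen, (hasDerivAt_weighted b i j _ z).deriv]
  have h : ∀ x : ℤ, (z.2 (x + 1) / √((z.1 x : ℝ) * z.1 (x + 1)) -
      z.2 (x - 1) / √((z.1 (x - 1) : ℝ) * z.1 x)) * ((b : p.Disorder → ℝ) z.1 *
        ((if i = x then 1 else 0) * z.2 j + z.2 i * (if j = x then 1 else 0))) =
      (if i = x then (z.2 (i + 1) / √((z.1 i : ℝ) * z.1 (i + 1)) -
      z.2 (i - 1) / √((z.1 (i - 1) : ℝ) * z.1 i)) * ((b : p.Disorder → ℝ) z.1 * z.2 j) else 0) +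
      (if j = x then (z.2 (j + 1) / √((z.1 j : ℝ) * z.1 (j + 1)) -
      z.2 (j - 1) / √((z.1 (j - 1) : ℝ) * z.1 j)) * ((b : p.Disorder → ℝ) z.1 * z.2 i)
        else 0) := by
    intro x
    by_cases h1 : i = x <;> by_cases h2 : j = x
    · subst h1; subst h2; simp only [if_true]; ring
    · subst h1; simp [h2]
    · subst h2; simp [h1]
    · simp [h1, h2]
  simp only [h]
  rw [finsum_add_distrib, finsum_eq_single _ i fun x hx => if_neg hx.symm,
    finsum_eq_single _ j fun x hx => if_neg hx.symm, if_pos rfl, if_pos rfl]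
  · simp only [weighted, bondCoeff, LinearMap.coe_mk, AddHom.coe_mk, Pi.add_apply, Pi.sub_apply,
      MulMemClass.coe_mul, Pi.mul_apply, sub_add_cancel]
    ring
  · refine (Set.finite_singleton i).subset fun x hx => ?_
    by_contra h'
    exact hx (if_neg fun h'' => h' h''.symm)
  · refine (Set.finite_singleton j).subset fun x hx => ?_
    by_contra h'
    exact hx (if_neg fun h'' => h' h''.symm)

lemma antisymGen_weighted_mem (b : p.Coeff) (i j : ℤ) :
    antisymGen (weighted (fun ω => ω i * ω j) b) ∈ p.Quad₀ := by
  rw [antisymGen_weighted]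
  by_cases h1 : j = i + 1
  · subst h1
    rw [show ∀ A B C D : p.Observable, A - B + (C - D) = (A - D) + (C - B) by intros; abel]
    refine add_mem ?_ (sub_mem (offDiag_mem _ (by omega)) (offDiag_mem _ (by omega)))
    have := diag_mem (p.bondCoeff i * b) i
    simpa only [add_sub_cancel_right] using this
  by_cases h2 : i = j + 1
  · subst h2
    rw [show ∀ A B C D : p.Observable, A - B + (C - D) = (C - B) + (A - D) by intros; abel]
    refine add_mem ?_ (sub_mem (offDiag_mem _ (by omega)) (offDiag_mem _ (by omega)))
    have := diag_mem (p.bondCoeff j * b) j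
    simpa only [add_sub_cancel_right] using this
  exact add_mem (sub_mem (offDiag_mem _ (by omega)) (offDiag_mem _ (by omega)))
    (sub_mem (offDiag_mem _ (by omega)) (offDiag_mem _ (by omega)))

lemma antisymGen_mem {f : p.Observable} (hf : f ∈ p.HomQuad) : antisymGen f ∈ p.Quad₀ := by
  let S : Submodule ℝ p.Observable :=
    { carrier := {f | f ∈ p.LocalDiff ∧ antisymGen f ∈ p.Quad₀}
      zero_mem' := ⟨zero_mem _, by
        have h := antisymGen_smul (p := p) 0 (zero_mem p.LocalDiff)
        rw [zero_smul, zero_smul] at h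
        rw [h]; exact zero_mem _⟩
      add_mem' := fun {f g} hf hg => ⟨add_mem hf.1 hg.1, by
        rw [antisymGen_add hf.1 hg.1]; exact add_mem hf.2 hg.2⟩
      smul_mem' := fun r f hf => ⟨Submodule.smul_mem _ _ hf.1, by
        rw [antisymGen_smul r hf.1]; exact Submodule.smul_mem _ _ hf.2⟩ }
  have h : p.HomQuad ≤ S := homQuad_le fun b i j =>
    ⟨homQuad_le_localDiff (weighted_mem b i j), antisymGen_weighted_mem b i j⟩
  exact (h hf).2

lemma gen_mem {f : p.Observable} (hf : f ∈ p.HomQuad) : p.gen f ∈ p.Quad₀ :=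
  add_mem (antisymGen_mem hf) (symGen_mem hf)

variable (p) in
/-- The generator `L^m` as a linear map from `Q` to `Q₀`. -/
def genQuad : p.Quad →ₗ[ℝ] p.Quad₀ where
  toFun f := ⟨p.gen f, gen_mem (quad_le_homQuad f.2)⟩
  map_add' f g := by
    have hf := quad_le_homQuad f.2
    have hg := quad_le_homQuad g.2
    ext1
    simp only [gen, Submodule.coe_add]
    rw [antisymGen_add (homQuad_le_localDiff hf) (homQuad_le_localDiff hg), symGen_add hf hg]
    abel
  map_smul' r f := by
    have hf := quad_le_homQuad f.2
    ext1
    simp only [gen, Submodule.coe_smul, RingHom.id_apply]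
    rw [antisymGen_smul r (homQuad_le_localDiff hf), symGen_smul, smul_add]

variable (p) in
/-- The closure of `L^m Q` in `H₁`. -/
def closureGenQuad : Submodule ℝ p.H1 :=
  (LinearMap.range (p.toH1 ∘ₗ p.genQuad)).topologicalClosure

end DisorderedChain

end

/-! Write S and A for the symmetric and antisymmetric parts of the generator. The semi-norm is dual
to the Dirichlet form on pairs (f, a), and `Quad₀` itself contains the Riesz representatives of that
form: for w = (f, a) and `riesz w` = -S f + a j^S, the inner product of φ with `riesz w` is ≪φ, f≫_⋆
+ a ≪φ≫_⋆⋆, and the squared norm of `riesz w` is D_0(a ω_0² + Γ_f) (`inner_toH1_riesz`,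
`norm_sq_toH1_riesz`). Hence these vectors are total in H₁ (`eq_zero_of_inner_riesz`). Since ω_1² -
ω_0² pairs to zero with every local function (`pairing_energyGrad`), j^S is orthogonal to S Q. So H₁
is the orthogonal sum of the closure of S Q and the line of j^S.

Passing from S to A + S tilts the first summand but keeps it a complement of the line. This is a
Hilbert space argument (`isCompl_closure_range_span`) that needs two facts: S f is orthogonal to A
f, because A is antisymmetric under the law and commutes with translations
(`pairing_antisymGen_self`), and the norm of A f is at most a constant times that of S f
(`exists_norm_antisymQuad_le`).

The second fact, the sector condition, is where quadratic functions matter. The semi-norm does not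
distinguish an element of `Quad₀` from its translates, so f may be replaced by θ(m)(ω_1² - ω_0²) +
∑_k φ_k(m) ω_0 ω_{k+1}. Duality against suitable test functions shows that the norm of S f controls
the L² norms of the discrete Laplacian of θ and of the family (φ_k). Conversely, a function that is
odd under a single flip or exchange has semi-norm bounded by its L² norm. The image under A of the
φ-part splits into five groups of this kind, and the image of the θ-part reduces modulo translations
to one monomial whose coefficient contains only the Laplacian of θ. The coefficients 1/√(m_x
m_{x+1}) are at most C, which gives the bound.

The last two statements read off the coordinate along ω_1² - ω_0², which is nonzero in H₁. -/

noncomputable section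

namespace DisorderedChain

/-! ### Decomposition along an operator that satisfies the sector condition -/

section Sector

variable {H V : Type*} [NormedAddCommGroup H] [InnerProductSpace ℝ H]
  [AddCommGroup V] [Module ℝ V] {S A : V →ₗ[ℝ] H} {u : H} {K : ℝ}

/-- Pairing with S f removes both A f and u and leaves ‖S f‖²; Cauchy–Schwarz concludes. -/
lemma norm_le_of_sector_of_orthogonal (hu : ∀ f, inner ℝ u (S f) = 0)
    (hSA : ∀ f, inner ℝ (S f) (A f) = 0) (f : V) (a : ℝ) :
    ‖S f‖ ≤ ‖(A + S) f - a • u‖ := by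
  have h1 : inner ℝ (S f) ((A + S) f - a • u) = ‖S f‖ ^ 2 := by
    rw [LinearMap.add_apply, inner_sub_right, inner_add_right, hSA, inner_smul_right,
      real_inner_comm u, hu, real_inner_self_eq_norm_sq]
    ring
  have h2 := real_inner_le_norm (S f) ((A + S) f - a • u)
  rw [h1, sq] at h2
  rcases (norm_nonneg (S f)).eq_or_lt' with h | h
  · rw [h]; exact norm_nonneg _
  · exact le_of_mul_le_mul_left h2 h

/-- If (A + S) f_n tends to a multiple of u, the preceding bound forces S f_n → 0, then A f_n → 0 by
boundedness, so the limit is 0. -/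
lemma disjoint_closure_range_span (hu : ∀ f, inner ℝ u (S f) = 0)
    (hSA : ∀ f, inner ℝ (S f) (A f) = 0) (hA : ∀ f, ‖A f‖ ≤ K * ‖S f‖) :
    Disjoint (LinearMap.range (A + S)).topologicalClosure (Submodule.span ℝ {u}) := by
  rw [Submodule.disjoint_def]
  intro x hx hxu
  obtain ⟨a, rfl⟩ := Submodule.mem_span_singleton.1 hxu
  obtain ⟨v, hv, hlim⟩ := mem_closure_iff_seq_limit.1 hx
  choose f hf using hv
  have h0 : Tendsto (fun n => ‖(A + S) (f n) - a • u‖) atTop (𝓝 0) := by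
    simp only [hf]
    exact tendsto_iff_norm_sub_tendsto_zero.1 hlim
  have h1 : Tendsto (fun n => S (f n)) atTop (𝓝 0) :=
    squeeze_zero_norm (fun n => norm_le_of_sector_of_orthogonal hu hSA (f n) a) h0
  have h2 : Tendsto (fun n => A (f n)) atTop (𝓝 0) :=
    squeeze_zero_norm (fun n => hA (f n)) (by simpa using h1.norm.const_mul K)
  have h3 : Tendsto v atTop (𝓝 0) := by
    have h : v = fun n => A (f n) + S (f n) := by ext n; rw [← hf n]; rfl
    rw [h]
    simpa using h2.add h1
  exact tendsto_nhds_unique hlim h3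

/-- Orthogonality to u places h in the closure of the range of S. Along S f_n → h, the numbers ⟨h, S
f_n⟩ tend to ‖h‖²; they also equal -⟨h, A f_n⟩, which tends to 0 because A f_n is bounded and
orthogonal to S f_n. -/
lemma eq_zero_of_orthogonal_range [CompleteSpace H]
    (hS : ∀ h : H, inner ℝ h u = 0 → (∀ f, inner ℝ h (S f) = 0) → h = 0)
    (hu : ∀ f, inner ℝ u (S f) = 0)
    (hSA : ∀ f, inner ℝ (S f) (A f) = 0) (hA : ∀ f, ‖A f‖ ≤ K * ‖S f‖)
    {h : H} (h1 : inner ℝ h u = 0) (h2 : ∀ f, inner ℝ h ((A + S) f) = 0) : h = 0 := by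
  have hd : h ∈ (LinearMap.range S).topologicalClosure := by
    rw [← Submodule.orthogonal_orthogonal_eq_closure, Submodule.mem_orthogonal]
    intro k hk
    rw [Submodule.mem_orthogonal] at hk
    have hk' : ∀ f, inner ℝ k (S f) = 0 := fun f => by
      rw [real_inner_comm]; exact hk _ ⟨f, rfl⟩
    -- A vector k orthogonal to the range of S is a multiple of u: its component orthogonal to u
    -- vanishes by `hS`. The projection on u requires u ≠ 0; if u = 0, then `hS` applies to k
    -- directly.
    by_cases hu0 : inner ℝ u u = (0 : ℝ)
    · rw [inner_self_eq_zero] at hu0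
      rw [hS k (by rw [hu0, inner_zero_right]) hk', inner_zero_left]
    · have := hS (k - (inner ℝ k u / inner ℝ u u : ℝ) • u) (by
        rw [inner_sub_left, real_inner_smul_left, div_mul_cancel₀ _ hu0, sub_self])
        (fun f => by rw [inner_sub_left, real_inner_smul_left, hk', hu]; simp)
      rw [sub_eq_zero.1 this, real_inner_smul_left, real_inner_comm h u, h1, mul_zero]
  obtain ⟨v, hv, hlim⟩ := mem_closure_iff_seq_limit.1 hd
  choose f hf using hv
  have e1 : ∀ n, inner ℝ h (S (f n)) = inner ℝ (S (f n) - h) (A (f n)) := fun n => by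
    have := h2 (f n)
    rw [LinearMap.add_apply, inner_add_right] at this
    rw [inner_sub_left, hSA]
    linarith
  have hlim' : Tendsto (fun n => S (f n)) atTop (𝓝 h) := by simpa only [hf] using hlim
  have l1 : Tendsto (fun n => ‖S (f n) - h‖ * (K * ‖S (f n)‖)) atTop (𝓝 0) := by
    simpa using (tendsto_iff_norm_sub_tendsto_zero.1 hlim').mul (hlim'.norm.const_mul K)
  have l2 : Tendsto (fun n => inner ℝ h (S (f n))) atTop (𝓝 (0 : ℝ)) := by
    refine squeeze_zero_norm (fun n => ?_) l1
    rw [e1]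
    exact (norm_inner_le_norm _ _).trans (by gcongr; exact hA _)
  have l3 : Tendsto (fun n => inner ℝ h (S (f n))) atTop (𝓝 (inner ℝ h h)) :=
    tendsto_const_nhds.inner hlim'
  exact inner_self_eq_zero.1 (tendsto_nhds_unique l3 l2)

/-- If `A` is antisymmetric with respect to `S` and bounded by it, the closure of the range of
`A + S` is a complement of any line that is a complement of the range of `S`. -/
theorem isCompl_closure_range_span [CompleteSpace H]
    (hS : ∀ h : H, inner ℝ h u = 0 → (∀ f, inner ℝ h (S f) = 0) → h = 0)
    (hu : ∀ f, inner ℝ u (S f) = 0)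
    (hSA : ∀ f, inner ℝ (S f) (A f) = 0) (hA : ∀ f, ‖A f‖ ≤ K * ‖S f‖) :
    IsCompl (LinearMap.range (A + S)).topologicalClosure (Submodule.span ℝ {u}) := by
  refine ⟨disjoint_closure_range_span hu hSA hA, codisjoint_iff.2 ?_⟩
  have hc : IsClosed (((LinearMap.range (A + S)).topologicalClosure ⊔
      Submodule.span ℝ {u} : Submodule ℝ H) : Set H) :=
    -- The sum of a closed subspace and a line is closed, so it suffices that its orthogonal
    -- complement vanishes.
    Submodule.isClosed_sup_finiteDimensional _ _
      (Submodule.isClosed_topologicalClosure _)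
  rw [← hc.submodule_topologicalClosure_eq, Submodule.topologicalClosure_eq_top_iff,
    Submodule.eq_bot_iff]
  intro h hh
  rw [Submodule.mem_orthogonal] at hh
  refine eq_zero_of_orthogonal_range hS hu hSA hA ?_ fun f => ?_ <;> rw [real_inner_comm]
  · exact hh _ (Submodule.mem_sup_right (Submodule.mem_span_singleton_self u))
  · exact hh _ (Submodule.mem_sup_left (Submodule.le_topologicalClosure _ ⟨f, rfl⟩))

end Sector

/-! ### Gaussian moments -/

lemma integral_sq_gaussianReal : ∫ x, x ^ 2 ∂(gaussianReal 0 1) = 1 := by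
  have h := variance_id_gaussianReal (μ := 0) (v := 1)
  rw [variance_of_integral_eq_zero (by fun_prop) (by simp)] at h
  simpa using h

/-- The fourth moment is the fourth derivative at 0 of the moment generating function exp(t²/2). -/
lemma integral_pow_four_gaussianReal : ∫ x, x ^ 4 ∂(gaussianReal 0 1) = 3 := by
  have h := iteratedDeriv_mgf_zero (X := id) (μ := gaussianReal 0 1) (by simp) 4
  simp only [id, Pi.pow_apply] at h
  rw [← h]
  have e : mgf (id : ℝ → ℝ) (gaussianReal 0 1) = fun t => Real.exp (t ^ 2 / 2) := by
    rw [mgf_id_gaussianReal]; ext t; simp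
  have hd : ∀ t : ℝ, HasDerivAt (fun t : ℝ => Real.exp (t ^ 2 / 2)) (Real.exp (t ^ 2 / 2) * t) t :=
    fun t => by
      have h := ((hasDerivAt_pow 2 t).div_const 2).exp
      simpa using h
  -- Derivatives keep the form exp(t²/2) P(t), with P replaced by t P + P'. From P = 1 this produces
  -- t, t² + 1, t³ + 3t, and then a polynomial with constant term 3.
  have step : ∀ (P P' : ℝ → ℝ), (∀ t, HasDerivAt P (P' t) t) →
      deriv (fun t => Real.exp (t ^ 2 / 2) * P t) = fun t => Real.exp (t ^ 2 / 2) * (t * P t + P' t) := by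
    intro P P' hP
    ext t
    rw [((hd t).fun_mul (hP t)).deriv]
    ring
  have e0 : (fun t : ℝ => Real.exp (t ^ 2 / 2)) = fun t => Real.exp (t ^ 2 / 2) * 1 := by simp
  simp only [iteratedDeriv_succ, iteratedDeriv_zero, e]
  rw [e0, step (fun _ => 1) (fun _ => 0) fun t => hasDerivAt_const _ _,
    step (fun t => t * 1 + 0) (fun _ => 1) fun t => by simpa using hasDerivAt_id' t,
    step (fun t => t * (t * 1 + 0) + 1) (fun t => 2 * t) fun t => by
      have h := (hasDerivAt_pow 2 t).add_const 1
      simpa [sq] using h,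
    step (fun t => t * (t * (t * 1 + 0) + 1) + 2 * t) (fun t => 3 * t ^ 2 + 3) fun t => by
      have h := (hasDerivAt_pow 3 t).fun_add ((hasDerivAt_id' t).const_mul 3)
      have e : (fun t : ℝ => t * (t * (t * 1 + 0) + 1) + 2 * t) = fun t => t ^ 3 + 3 * t := by
        ext t; ring
      rw [e]
      simpa using h]
  simp

variable {p : DisorderedChain}

/-! ### The symmetric part of the generator and the Dirichlet form -/

lemma pairing_sum_left {ι : Type*} {s : Finset ι} {D : ι → p.Observable} (hD : ∀ x ∈ s, D x ∈ p.Pairable)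
    {g : p.Observable} (hg : g ∈ p.LocalSq) :
    pairing (∑ x ∈ s, D x) g = ∑ x ∈ s, pairing (D x) g := by
  classical
  induction s using Finset.induction_on with
  | empty => simp [pairing]
  | insert x s hx ih =>
    have h : ∀ y ∈ s, D y ∈ p.Pairable := fun y hy => hD y (Finset.mem_insert_of_mem hy)
    rw [Finset.sum_insert hx, Finset.sum_insert hx, pairing_add_left
      (hD x (Finset.mem_insert_self x s)) (Submodule.sum_mem _ h) hg, ih h]

lemma pairing_sum_right {ι : Type*} {s : Finset ι} {D : ι → p.Observable}
    (hD : ∀ x ∈ s, D x ∈ p.LocalSq) {φ : p.Observable} (hφ : φ ∈ p.Pairable) :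
    pairing φ (∑ x ∈ s, D x) = ∑ x ∈ s, pairing φ (D x) := by
  classical
  induction s using Finset.induction_on with
  | empty => simp [pairing, translate]
  | insert x s hx ih =>
    have h : ∀ y ∈ s, D y ∈ p.LocalSq := fun y hy => hD y (Finset.mem_insert_of_mem hy)
    rw [Finset.sum_insert hx, Finset.sum_insert hx, pairing_add_right hφ
      (hD x (Finset.mem_insert_self x s)) (Submodule.sum_mem _ h), ih h]

lemma moment_sum {s : Finset ℤ} {D : ℤ → p.Observable} (hD : ∀ x ∈ s, D x ∈ p.Pairable) :
    moment (∑ x ∈ s, D x) = ∑ x ∈ s, moment (D x) := by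
  classical
  induction s using Finset.induction_on with
  | empty => simp [moment]
  | insert x s hx ih =>
    have h : ∀ y ∈ s, D y ∈ p.Pairable := fun y hy => hD y (Finset.mem_insert_of_mem hy)
    rw [Finset.sum_insert hx, Finset.sum_insert hx, moment_add
      (hD x (Finset.mem_insert_self x s)) (Submodule.sum_mem _ h), ih h]

lemma shift_shift (x y : ℤ) (z : p.Phase) : shift x (shift y z) = shift (y + x) z := by
  ext v <;> simp only [shift, add_assoc]

lemma shift_zero (z : p.Phase) : shift 0 z = z := by
  ext v <;> simp [shift]

lemma shift_neg_shift (x : ℤ) (z : p.Phase) : shift (-x) (shift x z) = z := by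
  rw [shift_shift, add_neg_cancel, shift_zero]

/-- A formal sum of increments along an involution θ is odd under θ, so the increment operator acts
on it as multiplication by -2. Symmetry of that operator then brings an increment onto both factors.
-/
lemma pairing_increment_eq {θ : p.Phase → p.Phase} (hθ : IsLocalMove θ) {F g : p.Observable}
    (hF : MemLp F 2 p.law) (hg : g ∈ p.LocalSq) :
    pairing (increment θ F) g = -2⁻¹ * ∫ z, increment θ F z * gradSum θ g z ∂p.law := by
  have h : ∀ z, increment θ (gradSum θ g) z = -2 * gradSum θ g z := fun z => by
    have : gradSum θ g (θ z) = -gradSum θ g z := by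
      simp only [gradSum]
      rw [← finsum_neg_distrib]
      refine finsum_congr fun x => ?_
      simp only [increment, hθ.involutive z]
      ring
    simp only [increment, this]
    ring
  rw [integral_increment_mul hθ.1 hθ.2 hF (hθ.memLp_gradSum hg), hθ.pairing_increment hF hg]
  simp only [h, mul_left_comm _ (-2 : ℝ)]
  rw [integral_const_mul]
  ring

lemma increment_shift {θ θ' : p.Phase → p.Phase} {y : ℤ}
    (h : ∀ z, shift y (θ' z) = θ (shift y z)) (f : p.Observable) (z : p.Phase) :
    increment θ' f z = increment θ (translate (-y) f) (shift y z) := by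
  simp only [increment, translate, ← h, shift_neg_shift]

/-- Each increment at y is carried to the origin by a translation that leaves the law invariant. The
sum over y thereby rebuilds the formal sum Γ_f, and the pairing becomes one integral at the origin.
-/
lemma pairing_sum_increment {θ : ℤ → p.Phase → p.Phase} (hθ : ∀ y, IsLocalMove (θ y))
    (h : ∀ y z, shift y (θ y z) = θ 0 (shift y z)) {f g : p.Observable} (hf : f ∈ p.LocalSq)
    (hg : g ∈ p.LocalSq) {T : Finset ℤ} (hT : ∀ y ∉ T, increment (θ y) f = 0) :
    pairing (∑ y ∈ T, increment (θ y) f) g =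
      -2⁻¹ * ∫ z, gradSum (θ 0) f z * gradSum (θ 0) g z ∂p.law := by
  have hc : ∀ y, ∫ z, increment (θ y) f z * gradSum (θ y) g z ∂p.law =
      ∫ z, increment (θ 0) (translate (-y) f) z * gradSum (θ 0) g z ∂p.law := fun y => by
    simp only [increment_shift (h y) f, gradSum_shift (h y) g]
    exact integral_shift y fun z => increment (θ 0) (translate (-y) f) z * gradSum (θ 0) g z
  rw [pairing_sum_left (fun y _ => (hθ y).increment_mem hf.1) hg]
  simp only [pairing_increment_eq (hθ _) hf.1 hg, hc, ← Finset.mul_sum]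
  congr 1
  rw [← integral_finsetSum _ fun y _ => integrable_fun_mul
    (MemLp.increment (hθ 0).1 (memLp_translate hf.1 (-y))) ((hθ 0).memLp_gradSum hg)]
  congr 1; ext z
  rw [← Finset.sum_mul]
  congr 1
  -- The move at y applied to f corresponds to the move at 0 applied to the translate by -y, hence
  -- the reversed summation.
  have e : gradSum (θ 0) f z = ∑ᶠ y, increment (θ 0) (translate (-y) f) z :=
    (finsum_comp_equiv (Equiv.neg ℤ) (f := fun y => increment (θ 0) (translate y f) z)).symm
  rw [e, finsum_eq_sum_of_support_subset]
  intro y hy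
  by_contra hn
  refine hy ?_
  have := congrFun (hT y hn) (shift (-y) z)
  rw [increment_shift (h y) f, shift_shift, neg_add_cancel, shift_zero] at this
  exact this

/-- The exchange of sites 0 and 1 multiplies ω_1² - ω_0² by -1, so its increment is -2 times itself
and `integral_energyGrad_mul` applies. This is what makes j^S orthogonal to S Q in H₁. -/
lemma pairing_energyGrad {g : p.Observable} (hg : g ∈ p.LocalSq) : pairing p.energyGrad g = 0 := by
  have h := integral_energyGrad_mul hg
  rw [bondGradSum_eq, ← (isLocalMove_exchange (p := p) 0 (0 + 1)).pairing_increment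
    memLp_energyGrad hg] at h
  have h1 : increment (exchange 0 (0 + 1)) p.energyGrad = (-2 : ℝ) • p.energyGrad := by
    ext z; simp [increment, exchange, energyGrad]; ring
  rw [h1, pairing_smul_left] at h
  linarith

lemma pairing_symGen {f g : p.Observable} (hf : f ∈ p.HomQuad) (hg : g ∈ p.LocalSq) :
    pairing (p.symGen f) g =
      -(p.γ / 2 * ∫ z, siteGradSum f z * siteGradSum g z ∂p.law +
        p.lam / 2 * ∫ z, bondGradSum f z * bondGradSum g z ∂p.law) := by
  have hf' := homQuad_le_localSq hf
  have m1 : ∀ x, siteGrad x f ∈ p.Pairable := fun x => (isLocalMove_flip x).increment_mem hf'.1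
  have m2 : ∀ x, bondGrad x f ∈ p.Pairable := fun x =>
    (isLocalMove_exchange x (x + 1)).increment_mem hf'.1
  rw [symGen_eq hf, pairing_add_left
    (Submodule.smul_mem _ _ (Submodule.sum_mem _ fun x _ => m1 x))
    (Submodule.smul_mem _ _ (Submodule.sum_mem _ fun x _ => m2 x)) hg,
    pairing_smul_left, pairing_smul_left]
  simp only [siteGrad, bondGrad]
  rw [pairing_sum_increment (θ := fun x => flip x) isLocalMove_flip shift_flip hf' hg
      fun y hy => by simpa [siteGrad] using hy,
    pairing_sum_increment (θ := fun x => exchange x (x + 1))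
      (fun x => isLocalMove_exchange x (x + 1)) shift_exchange hf' hg
      fun y hy => by simpa [bondGrad] using hy]
  simp only [siteGradSum_eq, bondGradSum_eq]
  ring

/-- Flips do not change ω_x², so only exchanges contribute. The moment of the increment at the bond
x is an integral of f against ω_{x+1}² - ω_x², and summing over x gives, up to sign, the pairing of
`energyGrad` with f, which is zero. -/
lemma moment_symGen {f : p.Observable} (hf : f ∈ p.HomQuad) : moment (p.symGen f) = 0 := by
  have hf' := homQuad_le_localSq hf
  have m1 : ∀ x, siteGrad x f ∈ p.Pairable := fun x => (isLocalMove_flip x).increment_mem hf'.1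
  have m2 : ∀ x, bondGrad x f ∈ p.Pairable := fun x =>
    (isLocalMove_exchange x (x + 1)).increment_mem hf'.1
  rw [symGen_eq hf, moment_add
    (Submodule.smul_mem _ _ (Submodule.sum_mem _ fun x _ => m1 x))
    (Submodule.smul_mem _ _ (Submodule.sum_mem _ fun x _ => m2 x)), moment_smul, moment_smul,
    moment_sum fun x _ => m1 x, moment_sum fun x _ => m2 x]
  simp only [moment_siteGrad hf'.1, Finset.sum_const_zero, mul_zero, zero_add]
  refine mul_eq_zero_of_right _ ?_
  have h : ∀ x, moment (bondGrad x f) =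
      -∫ z, p.energyGrad z * translate (-x) f z ∂p.law := fun x => by
    rw [moment_bondGrad hf'.1]
    congr 1
    rw [← integral_shift x fun z => p.energyGrad z * translate (-x) f z]
    simp only [translate, shift_neg_shift, mul_comm]
  refine Eq.trans ?_ (neg_eq_zero.2 (pairing_energyGrad hf'))
  rw [pairing, ← finsum_comp_equiv (Equiv.neg ℤ), ← finsum_neg_distrib]
  refine Eq.symm ((finsum_congr fun x => (h x).symm).trans ?_)
  refine finsum_eq_sum_of_support_subset _ fun x hx => ?_
  by_contra hn
  refine hx ?_
  have : bondGrad x f = 0 := by simpa using hn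
  simp [this, moment]

/-! ### The Riesz representation of the Dirichlet form -/

variable (p) in
/-- The symmetric part of the generator as a linear map from `Q` to `Q₀`. -/
def symQuad : p.Quad →ₗ[ℝ] p.Quad₀ where
  toFun f := ⟨p.symGen f, symGen_mem (quad_le_homQuad f.2)⟩
  map_add' f g := by
    ext1
    exact symGen_add (quad_le_homQuad f.2) (quad_le_homQuad g.2)
  map_smul' r f := by
    ext1
    exact symGen_smul r _

variable (p) in
/-- The antisymmetric part of the generator as a linear map from `Q` to `Q₀`. -/
def antisymQuad : p.Quad →ₗ[ℝ] p.Quad₀ where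
  toFun f := ⟨antisymGen f, antisymGen_mem (quad_le_homQuad f.2)⟩
  map_add' f g := by
    ext1
    exact antisymGen_add (homQuad_le_localDiff (quad_le_homQuad f.2))
      (homQuad_le_localDiff (quad_le_homQuad g.2))
  map_smul' r f := by
    ext1
    exact antisymGen_smul r (homQuad_le_localDiff (quad_le_homQuad f.2))

lemma genQuad_eq : p.genQuad = p.antisymQuad + p.symQuad := rfl

variable (p) in
/-- The symmetric current as an element of `Q₀`. -/
def symCurrent₀ : p.Quad₀ := ⟨p.symCurrent, p.symCurrent_mem⟩

variable (p) in
/-- The map `(f, a) ↦ -S f + a j^S`, which represents the Dirichlet form. -/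
def riesz : p.Quad × ℝ →ₗ[ℝ] p.Quad₀ :=
  (-p.symQuad).coprod (LinearMap.toSpanSingleton ℝ p.Quad₀ p.symCurrent₀)

lemma integral_sq_add {F G : p.Observable} (hF : MemLp F 2 p.law) (hG : MemLp G 2 p.law) :
    ∫ z, (F z + G z) ^ 2 ∂p.law =
      (∫ z, F z ^ 2 ∂p.law) + 2 * (∫ z, F z * G z ∂p.law) + ∫ z, G z ^ 2 ∂p.law := by
  have i1 := hF.integrable_sq
  have i2 := (integrable_fun_mul hF hG).const_mul 2
  have i3 := hG.integrable_sq
  rw [← integral_const_mul, ← integral_add i1 i2, ← integral_add (i1.fun_add i2) i3]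
  congr 1; ext z
  ring

lemma moment_symCurrent : moment p.symCurrent = p.lam / 2 * ∫ z, p.energyGrad z ^ 2 ∂p.law := by
  -- Since `energyGrad` is odd under the exchange, its own increment is -2 times itself.
  have h1 : p.symCurrent = (-(p.lam / 2)) • bondGrad 0 p.energyGrad := by
    ext z; simp [symCurrent, bondGrad, increment, exchange, energyGrad]; ring
  rw [h1, moment_smul, moment_bondGrad memLp_energyGrad]
  simp only [shift_zero, sq]
  ring

/-- The cross term between a(ω_1² - ω_0²) and the exchange increment of Γ_g vanishes by
`integral_energyGrad_mul`, so a and g are decoupled. -/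
lemma dirichlet_eq_add (a : ℝ) {g : p.Observable} (hg : g ∈ p.LocalSq) : dirichlet a g =
    dirichlet 0 g + a ^ 2 * (p.lam / 2 * ∫ z, p.energyGrad z ^ 2 ∂p.law) := by
  have h2 := (isLocalMove_exchange (p := p) 0 (0 + 1)).memLp_gradSum hg
  rw [dirichlet_eq, dirichlet_eq, bondGradSum_eq,
    integral_sq_add (memLp_energyGrad.const_mul a) h2]
  simp only [mul_assoc, mul_pow]
  rw [integral_const_mul, integral_const_mul]
  simp only [← bondGradSum_eq]
  rw [integral_energyGrad_mul hg]
  simp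
  ring

lemma dirichlet_zero_add {g h : p.Observable} (hg : g ∈ p.HomQuad) (hh : h ∈ p.LocalSq) :
    dirichlet 0 (g + h) = dirichlet 0 g - 2 * pairing (p.symGen g) h + dirichlet 0 h := by
  have hg' := homQuad_le_localSq hg
  have h1 := isLocalMove_flip (p := p) 0
  have h2 := isLocalMove_exchange (p := p) 0 (0 + 1)
  rw [pairing_symGen hg hh]
  rw [dirichlet_eq, dirichlet_eq, dirichlet_eq]
  simp only [siteGradSum_eq, bondGradSum_eq, h1.gradSum_add hg' hh,
    h2.gradSum_add hg' hh, Pi.add_apply, zero_mul]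
  simp only [zero_add (_ : ℝ)]
  rw [integral_sq_add (h1.memLp_gradSum hg') (h1.memLp_gradSum hh),
    integral_sq_add (h2.memLp_gradSum hg') (h2.memLp_gradSum hh)]
  ring

/-- The right-hand side is the polarization of the Dirichlet form: S represents it on Q, j^S
represents it along a, and the mixed terms vanish. -/
lemma form_riesz (w v : p.Quad × ℝ) : p.form (p.riesz w) v =
    -pairing (p.symGen w.1) (v.1 : p.Observable) +
      w.2 * v.2 * (p.lam / 2 * ∫ z, p.energyGrad z ^ 2 ∂p.law) := by
  have h1 : p.riesz w = -p.symQuad w.1 + w.2 • p.symCurrent₀ := rfl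
  have h2 : p.form (p.symQuad w.1) v = pairing (p.symGen w.1) (v.1 : p.Observable) := by
    simp only [form, LinearMap.mk₂_apply, symQuad, LinearMap.coe_mk, AddHom.coe_mk]
    rw [moment_symGen (quad_le_homQuad w.1.2)]
    ring
  have h3 : p.form p.symCurrent₀ v = v.2 * (p.lam / 2 * ∫ z, p.energyGrad z ^ 2 ∂p.law) := by
    simp only [form, LinearMap.mk₂_apply, symCurrent₀]
    rw [moment_symCurrent, show p.symCurrent = p.lam • p.energyGrad from rfl, pairing_smul_left,
      pairing_energyGrad (quad_le_localSq v.1.2)]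
    ring
  rw [h1, map_add, map_neg, map_smul, LinearMap.add_apply, LinearMap.neg_apply,
    LinearMap.smul_apply, h2, h3, smul_eq_mul]
  ring

lemma dirichlet_add (w v : p.Quad × ℝ) : dirichlet (w + v).2 ((w + v).1 : p.Observable) =
    dirichlet w.2 (w.1 : p.Observable) + 2 * p.form (p.riesz w) v +
      dirichlet v.2 (v.1 : p.Observable) := by
  rw [dirichlet_eq_add _ (quad_le_localSq (w + v).1.2), dirichlet_eq_add _ (quad_le_localSq w.1.2),
    dirichlet_eq_add _ (quad_le_localSq v.1.2), form_riesz, Prod.fst_add, Prod.snd_add,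
    Submodule.coe_add, dirichlet_zero_add (quad_le_homQuad w.1.2) (quad_le_localSq v.1.2)]
  ring

/-- Completion of the square: after the substitution v ↦ w + v in the supremum, the terms bilinear
in w and v cancel against those of the Dirichlet form. -/
lemma tripleNormSq_add_riesz (φ : p.Quad₀) (w : p.Quad × ℝ) :
    tripleNormSq ((φ + p.riesz w : p.Quad₀) : p.Observable) =
      tripleNormSq (φ : p.Observable) + 2 * p.form φ w + dirichlet w.2 (w.1 : p.Observable) := by
  rw [tripleNormSq_eq, tripleNormSq_eq]
  rw [← Equiv.iSup_comp (Equiv.addLeft w)]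
  have h : ∀ v : p.Quad × ℝ, 2 * p.form (φ + p.riesz w) (Equiv.addLeft w v) -
      dirichlet (Equiv.addLeft w v).2 ((Equiv.addLeft w v).1 : p.Observable) =
      (2 * p.form φ v - dirichlet v.2 (v.1 : p.Observable)) +
        (2 * p.form φ w + dirichlet w.2 (w.1 : p.Observable)) := fun v => by
    -- Together with D(2w) = 4 D(w), this shows that the form of `riesz w` at w is D(w).
    have h0 := dirichlet_add w w
    have h1 := dirichlet_smul' 2 w
    rw [two_smul] at h1
    simp only [Equiv.coe_addLeft, map_add, LinearMap.add_apply]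
    rw [dirichlet_add]
    linarith
  simp only [h]
  rw [← ciSup_add (bddAbove_form φ)]
  ring

lemma norm_sq_toH1 (φ : p.Quad₀) : ‖p.toH1 φ‖ ^ 2 = tripleNormSq (φ : p.Observable) := by
  rw [norm_toH1, tripleNorm_sq]

lemma norm_sq_toH1_riesz (w : p.Quad × ℝ) :
    ‖p.toH1 (p.riesz w)‖ ^ 2 = dirichlet w.2 (w.1 : p.Observable) := by
  have h := tripleNormSq_add_riesz 0 w
  rw [zero_add] at h
  rw [norm_sq_toH1, h, ← norm_sq_toH1]
  simp

/-- Comparing `tripleNormSq_add_riesz` with the expansion of ‖x + y‖² identifies the inner product,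
which is otherwise only given by polarization. -/
lemma inner_toH1_riesz (φ : p.Quad₀) (w : p.Quad × ℝ) :
    inner ℝ (p.toH1 φ) (p.toH1 (p.riesz w)) = p.form φ w := by
  have h := norm_add_sq_real (p.toH1 φ) (p.toH1 (p.riesz w))
  rw [← map_add, norm_sq_toH1, tripleNormSq_add_riesz, norm_sq_toH1_riesz, norm_sq_toH1] at h
  linarith

/-- If h is orthogonal to every `riesz w`, then for φ close to h the supremum defining ‖φ‖² involves
only φ - h, so ‖φ‖ ≤ ‖φ - h‖. An approximation within ‖h‖/3 then gives ‖h‖ < 2‖h‖/3. -/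
lemma eq_zero_of_inner_riesz {h : p.H1} (hh : ∀ w, inner ℝ h (p.toH1 (p.riesz w)) = 0) :
    h = 0 := by
  by_contra hn
  have hpos : 0 < ‖h‖ / 3 := by have := norm_pos_iff.2 hn; positivity
  obtain ⟨φ, hφ⟩ := Metric.denseRange_iff.1 denseRange_toH1 h (‖h‖ / 3) hpos
  have h1 : ‖p.toH1 φ‖ ^ 2 ≤ ‖p.toH1 φ - h‖ ^ 2 := by
    rw [norm_sq_toH1, tripleNormSq_eq]
    refine ciSup_le fun w => ?_
    have h2 := real_inner_le_norm (p.toH1 φ - h) (p.toH1 (p.riesz w))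
    rw [inner_sub_left, inner_toH1_riesz, hh, sub_zero] at h2
    rw [← norm_sq_toH1_riesz]
    nlinarith [sq_nonneg (‖p.toH1 φ - h‖ - ‖p.toH1 (p.riesz w)‖)]
  have h2 := abs_le_of_sq_le_sq' h1 (norm_nonneg _)
  have h3 := norm_sub_norm_le h (p.toH1 φ)
  rw [dist_eq_norm] at hφ
  rw [norm_sub_rev] at h2
  linarith [h2.2]

/-! ### Wick's formula -/

lemma integral_gibbs_pow (i : ℤ) (n : ℕ) :
    ∫ ω, ω i ^ n ∂gibbs = ∫ x, x ^ n ∂(gaussianReal 0 1) := by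
  have h := measurePreserving_eval_infinitePi (fun _ : ℤ => gaussianReal 0 1) i
  rw [← h.map_eq, integral_map h.measurable.aemeasurable (by fun_prop)]
  rfl

lemma integral_gibbs_sq_mul_sq {i j : ℤ} (hij : i ≠ j) : ∫ ω, ω i ^ 2 * ω j ^ 2 ∂gibbs = 1 := by
  have h := (iIndepFun_infinitePi (P := fun _ : ℤ => gaussianReal 0 1)
    (X := fun _ x => x ^ 2) (by fun_prop)).indepFun hij
  have h' := h.integral_fun_mul_eq_mul_integral
    ((measurable_pi_apply i).pow_const 2).aestronglyMeasurable
    ((measurable_pi_apply j).pow_const 2).aestronglyMeasurable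
  change ∫ ω, ω i ^ 2 * ω j ^ 2 ∂(Measure.infinitePi fun _ : ℤ => gaussianReal 0 1) = _ at h'
  rw [gibbs, h']
  have e := fun i => integral_gibbs_pow i 2
  simp only [gibbs, integral_sq_gaussianReal] at e
  rw [e, e, mul_one]

lemma integrable_coeff (b : p.Coeff) : Integrable (b : p.Disorder → ℝ) p.disorderLaw := by
  have hb : Continuous (b : p.Disorder → ℝ) := b.2.1
  obtain ⟨K, hK⟩ := (isCompact_range hb).isBounded.exists_norm_le
  exact Integrable.of_bound hb.measurable.aestronglyMeasurable K
    (Eventually.of_forall fun m => hK _ ⟨m, rfl⟩)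

variable (p) in
/-- The mean of a continuous cylinder function of the disorder. -/
def mean : p.Coeff →ₗ[ℝ] ℝ where
  toFun b := ∫ m, (b : p.Disorder → ℝ) m ∂p.disorderLaw
  map_add' b c := integral_add (integrable_coeff b) (integrable_coeff c)
  map_smul' r _ := integral_const_mul r _

/-- The translates `τ_x b` of a continuous cylinder function of the disorder. -/
def shiftCoeff (x : ℤ) : p.Coeff →ₐ[ℝ] p.Coeff where
  toFun b := ⟨fun m => (b : p.Disorder → ℝ) fun y => m (x + y), by
    have hb : Continuous (b : p.Disorder → ℝ) := b.2.1
    refine ⟨hb.comp (by fun_prop), ?_⟩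
    obtain ⟨Λ, hΛ⟩ := b.2.2
    exact ⟨Λ.map (Equiv.addLeft x).toEmbedding, fun m m' h => hΛ fun y hy =>
      h _ (by simpa using hy)⟩⟩
  map_one' := rfl
  map_mul' _ _ := rfl
  map_zero' := rfl
  map_add' _ _ := rfl
  commutes' _ := rfl

lemma shiftCoeff_apply (x : ℤ) (b : p.Coeff) (m : p.Disorder) :
    (shiftCoeff x b : p.Disorder → ℝ) m = (b : p.Disorder → ℝ) fun y => m (x + y) := rfl

lemma shiftCoeff_shiftCoeff (x y : ℤ) (b : p.Coeff) :
    shiftCoeff x (shiftCoeff y b) = shiftCoeff (x + y) b := by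
  ext m
  simp only [shiftCoeff_apply, add_assoc]

lemma shiftCoeff_zero (b : p.Coeff) : shiftCoeff 0 b = b := by
  ext m
  simp [shiftCoeff_apply]

lemma shiftCoeff_bondCoeff (x y : ℤ) : shiftCoeff x (p.bondCoeff y) = p.bondCoeff (x + y) := by
  ext m
  simp only [shiftCoeff_apply, bondCoeff, add_assoc]

lemma translate_weighted (x : ℤ) (b : p.Coeff) (i j : ℤ) :
    translate x (weighted (fun ω => ω i * ω j) b) =
      weighted (fun ω => ω (x + i) * ω (x + j)) (shiftCoeff x b) := rfl

lemma integral_weighted (b : p.Coeff) (P : (ℤ → ℝ) → ℝ) : ∫ z, weighted P b z ∂p.law =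
    p.mean b * ∫ ω, P ω ∂gibbs :=
  integral_prod_mul _ _

/-- The fourth moments of the standard Gaussian field. -/
def wick (i j k l : ℤ) : ℝ :=
  (if i = j then 1 else 0) * (if k = l then 1 else 0) +
    (if i = k then 1 else 0) * (if j = l then 1 else 0) +
    (if i = l then 1 else 0) * (if j = k then 1 else 0)

/-- The flip at x preserves the law and reverses the sign of the integrand. -/
lemma integral_weighted_eq_zero (b : p.Coeff) {P : (ℤ → ℝ) → ℝ} (x : ℤ)
    (h : ∀ ω, P (Function.update ω x (-ω x)) = -P ω) : ∫ z, weighted P b z ∂p.law = 0 := by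
  have e : MeasurableEmbedding (flip (p := p) x) :=
    (MeasurableEquiv.mk ((flip_involutive x).toPerm (flip x)) (measurePreserving_flip x).measurable
      (measurePreserving_flip x).measurable).measurableEmbedding
  have h1 := (measurePreserving_flip (p := p) x).integral_comp e (weighted P b)
  have h2 : ∀ z, weighted P b (flip x z) = -weighted P b z := fun z => by
    simp [weighted, flip, h]
  simp only [h2, integral_neg] at h1
  linarith

lemma wick_formula (b : p.Coeff) (i j k l : ℤ) :
    ∫ z, (b : p.Disorder → ℝ) z.1 * (z.2 i * z.2 j * (z.2 k * z.2 l)) ∂p.law =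
      p.mean b * wick i j k l := by
  -- Either some site occurs an odd number of times, and the flip there kills both sides, or the
  -- four indices agree or form two distinct equal pairs, and the moments 3 and 1 apply.
  change ∫ z, weighted (fun ω => ω i * ω j * (ω k * ω l)) b z ∂p.law = _
  have odd : ∀ x, (∀ ω : ℤ → ℝ, (Function.update ω x (-ω x) i * Function.update ω x (-ω x) j *
      (Function.update ω x (-ω x) k * Function.update ω x (-ω x) l)) =
        -(ω i * ω j * (ω k * ω l))) → wick i j k l = 0 →
      ∫ z, weighted (fun ω => ω i * ω j * (ω k * ω l)) b z ∂p.law =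
      p.mean b * wick i j k l := fun x hx hw => by
    rw [integral_weighted_eq_zero b x hx, hw, mul_zero]
  have even : ∀ c : (ℤ → ℝ) → ℝ, (∀ ω : ℤ → ℝ, ω i * ω j * (ω k * ω l) = c ω) →
      ∫ ω, c ω ∂gibbs = wick i j k l →
      ∫ z, weighted (fun ω => ω i * ω j * (ω k * ω l)) b z ∂p.law =
      p.mean b * wick i j k l := fun c hc hw => by
    rw [integral_weighted, ← hw]
    simp only [hc]
  by_cases hij : i = j
  · subst hij
    by_cases hkl : k = l
    · subst hkl
      by_cases hik : i = k
      · subst hik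
        refine even (fun ω => ω i ^ 4) (fun ω => by ring) ?_
        rw [integral_gibbs_pow, integral_pow_four_gaussianReal]
        norm_num [wick]
      · refine even (fun ω => ω i ^ 2 * ω k ^ 2) (fun ω => by ring) ?_
        rw [integral_gibbs_sq_mul_sq hik]
        simp [wick, hik]
    · by_cases hik : i = k
      · subst hik
        exact odd l (fun ω => by simp [hkl]) (by simp [wick, hkl])
      · exact odd k (fun ω => by
          simp [Function.update_of_ne hik, Function.update_of_ne (Ne.symm hkl)])
          (by simp [wick, hkl, hik])
  · by_cases hik : i = k
    · subst hik
      by_cases hjl : j = l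
      · subst hjl
        refine even (fun ω => ω i ^ 2 * ω j ^ 2) (fun ω => by ring) ?_
        rw [integral_gibbs_sq_mul_sq hij]
        simp [wick, hij]
      · exact odd j (fun ω => by
          simp [Function.update_of_ne hij, Function.update_of_ne (Ne.symm hjl)])
          (by simp [wick, hij, hjl, Ne.symm hij])
    · by_cases hil : i = l
      · subst hil
        by_cases hjk : j = k
        · subst hjk
          refine even (fun ω => ω i ^ 2 * ω j ^ 2) (fun ω => by ring) ?_
          rw [integral_gibbs_sq_mul_sq hij]
          simp [wick, hij]
        · exact odd j (fun ω => by
            simp [Function.update_of_ne hij, Function.update_of_ne (Ne.symm hjk)])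
            (by simp [wick, hij, hjk, Ne.symm hij])
      · exact odd i (fun ω => by
          simp [Function.update_of_ne (Ne.symm hij), Function.update_of_ne (Ne.symm hik),
            Function.update_of_ne (Ne.symm hil)])
          (by simp [wick, hij, hik, hil])

/-- Expectation of a product of two quadratic monomials. -/
lemma integral_weighted_mul (b c : p.Coeff) (i j k l : ℤ) :
    ∫ z, weighted (fun ω => ω i * ω j) b z * weighted (fun ω => ω k * ω l) c z ∂p.law =
      p.mean (b * c) * wick i j k l := by
  rw [← wick_formula (b * c)]
  congr 1; ext z
  simp [weighted]; ring

/-! ### The antisymmetric part of the generator -/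

/-- Additivity suffices, because scalars are absorbed into the coefficient b. -/
lemma homQuad_induction {P : p.Observable → Prop}
    (hw : ∀ b i j, P (weighted (fun ω => ω i * ω j) b)) (h0 : P 0)
    (hadd : ∀ f ∈ p.HomQuad, ∀ g ∈ p.HomQuad, P f → P g → P (f + g)) {f : p.Observable}
    (hf : f ∈ p.HomQuad) : P f := by
  obtain ⟨c, rfl⟩ := hf
  rw [Finsupp.coe_lsum]
  refine (Finset.sum_induction _ (fun f => f ∈ p.HomQuad ∧ P f)
    (fun f g hf hg => ⟨add_mem hf.1 hg.1, hadd f hf.1 g hg.1 hf.2 hg.2⟩) ⟨zero_mem _, h0⟩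
    fun ij _ => ⟨weighted_mem _ _ _, hw _ _ _⟩).2

lemma antisymGen_zero : antisymGen (0 : p.Observable) = 0 := by
  simpa using antisymGen_smul (p := p) 0 (zero_mem p.LocalDiff)

lemma antisymGen_mem_homQuad {f : p.Observable} (hf : f ∈ p.HomQuad) :
    antisymGen f ∈ p.HomQuad := by
  refine homQuad_induction (P := fun f => antisymGen f ∈ p.HomQuad) (fun b i j => ?_) ?_
    (fun f hf g hg h h' => ?_) hf
  · rw [antisymGen_weighted]
    exact add_mem (sub_mem (weighted_mem _ _ _) (weighted_mem _ _ _))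
      (sub_mem (weighted_mem _ _ _) (weighted_mem _ _ _))
  · rw [antisymGen_zero]; exact zero_mem _
  · rw [antisymGen_add (homQuad_le_localDiff hf) (homQuad_le_localDiff hg)]
    exact add_mem h h'

lemma integrable_homQuad_mul {f g : p.Observable} (hf : f ∈ p.HomQuad) (hg : g ∈ p.HomQuad) :
    Integrable (fun z => f z * g z) p.law :=
  integrable_fun_mul (homQuad_le_localSq hf).1 (homQuad_le_localSq hg).1

lemma integral_antisymGen_weighted_mul (b c : p.Coeff) (i j k l : ℤ) :
    ∫ z, antisymGen (weighted (p := p) (fun ω => ω i * ω j) b) z *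
        weighted (fun ω => ω k * ω l) c z ∂p.law =
      p.mean (p.bondCoeff i * (b * c)) * wick (i + 1) j k l -
      p.mean (p.bondCoeff (i - 1) * (b * c)) *
        wick (i - 1) j k l +
      (p.mean (p.bondCoeff j * (b * c)) * wick i (j + 1) k l -
      p.mean (p.bondCoeff (j - 1) * (b * c)) *
        wick i (j - 1) k l) := by
  rw [antisymGen_weighted]
  simp only [Pi.add_apply, Pi.sub_apply, add_mul, sub_mul]
  have hi : ∀ b' i' j', Integrable (fun z => weighted (fun ω => ω i' * ω j') b' z *
      weighted (fun ω => ω k * ω l) c z) p.law := fun b' i' j' =>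
    integrable_homQuad_mul (weighted_mem _ _ _) (weighted_mem _ _ _)
  rw [integral_add (Integrable.sub' (hi _ _ _) (hi _ _ _)) (Integrable.sub' (hi _ _ _) (hi _ _ _)),
    integral_sub (hi _ _ _) (hi _ _ _), integral_sub (hi _ _ _) (hi _ _ _)]
  simp only [integral_weighted_mul, mul_assoc]

/-- A acts on the ω_x as a derivation with an antisymmetric matrix and does not touch the
coefficients. By Wick's formula the sum of the two sides consists of six terms, each the product of
one contraction and one copy of the antisymmetry identity `key`. -/
lemma integral_antisymGen_mul {f g : p.Observable} (hf : f ∈ p.HomQuad) (hg : g ∈ p.HomQuad) :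
    ∫ z, antisymGen f z * g z ∂p.law = -∫ z, f z * antisymGen g z ∂p.law := by
  refine homQuad_induction (P := fun f => ∫ z, antisymGen f z * g z ∂p.law =
    -∫ z, f z * antisymGen g z ∂p.law) (fun b i j => ?_) ?_ (fun f hf f' hf' h h' => ?_) hf
  · refine homQuad_induction (P := fun g => ∫ z, antisymGen (weighted (p := p) _ b) z * g z ∂p.law =
      -∫ z, weighted _ b z * antisymGen g z ∂p.law) (fun c k l => ?_) ?_
      (fun g hg g' hg' h h' => ?_) hg
    · simp only [mul_comm (weighted _ b _)]
      rw [integral_antisymGen_weighted_mul, integral_antisymGen_weighted_mul, mul_comm c b]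
      generalize b * c = a
      have key : ∀ (i j : ℤ), p.mean (p.bondCoeff i * a) * (if i + 1 = j then 1 else 0) -
          p.mean (p.bondCoeff (i - 1) * a) * (if i - 1 = j then 1 else 0) +
          (p.mean (p.bondCoeff j * a) * (if i = j + 1 then 1 else 0) -
          p.mean (p.bondCoeff (j - 1) * a) * (if i = j - 1 then 1 else 0)) = 0 := by
        intro i j
        by_cases h1 : i + 1 = j
        · subst h1
          simp [show i - 1 ≠ i + 1 by omega, show i ≠ i + 1 + 1 by omega]
        · by_cases h2 : i = j + 1
          · subst h2
            simp [show j + 1 + 1 ≠ j by omega, show j + 1 ≠ j - 1 by omega]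
          · simp [h1, h2, show i - 1 ≠ j by omega, show i ≠ j - 1 by omega]
      -- The two Wick expansions list the indices in opposite orders; the Kronecker symbols are put
      -- in a common orientation before the linear combination.
      have c : ∀ x y : ℤ, (if x = y then (1 : ℝ) else 0) = if y = x then 1 else 0 :=
        fun x y => by simp only [eq_comm]
      simp only [wick, c (k + 1) i, c (k + 1) j, c (k - 1) i, c (k - 1) j, c (l + 1) i,
        c (l + 1) j, c (l - 1) i, c (l - 1) j, c k i, c k j, c l i, c l j]
      linear_combination (if k = l then (1 : ℝ) else 0) * key i j +
        (if i = j then (1 : ℝ) else 0) * key k l + (if j = l then (1 : ℝ) else 0) * key i k +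
        (if i = k then (1 : ℝ) else 0) * key j l + (if j = k then (1 : ℝ) else 0) * key i l +
        (if i = l then (1 : ℝ) else 0) * key j k
    · simp [antisymGen_zero]
    · rw [antisymGen_add (homQuad_le_localDiff hg) (homQuad_le_localDiff hg')]
      simp only [Pi.add_apply, mul_add]
      have hw := weighted_mem (p := p) b i j
      rw [integral_add (integrable_homQuad_mul (antisymGen_mem_homQuad hw) hg)
        (integrable_homQuad_mul (antisymGen_mem_homQuad hw) hg'),
        integral_add (integrable_homQuad_mul hw (antisymGen_mem_homQuad hg))
        (integrable_homQuad_mul hw (antisymGen_mem_homQuad hg')), h, h']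
      ring
  · simp [antisymGen_zero]
  · rw [antisymGen_add (homQuad_le_localDiff hf) (homQuad_le_localDiff hf')]
    simp only [Pi.add_apply, add_mul]
    rw [integral_add (integrable_homQuad_mul (antisymGen_mem_homQuad hf) hg)
      (integrable_homQuad_mul (antisymGen_mem_homQuad hf') hg),
      integral_add (integrable_homQuad_mul hf (antisymGen_mem_homQuad hg))
      (integrable_homQuad_mul hf' (antisymGen_mem_homQuad hg)), h, h']
    ring

lemma translate_zero (f : p.Observable) : translate 0 f = f := by
  ext z; simp only [translate, shift_zero]

/-- The shift moves the masses together with ω, so the rates of A are carried along. For fixed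
disorder this would fail. -/
lemma antisymGen_translate (x : ℤ) (f : p.Observable) :
    antisymGen (translate x f) = translate x (antisymGen f) := by
  ext z
  simp only [antisymGen, translate]
  rw [← finsum_comp_equiv (Equiv.addLeft x)]
  refine finsum_congr fun y => ?_
  have h : ∀ t, shift x (z.1, Function.update z.2 (x + y) t) =
      ((shift x z).1, Function.update (shift x z).2 y t) := fun t => by
    ext v
    · rfl
    · by_cases hv : v = y
      · subst hv; simp [shift]
      · simp [shift, hv]
  simp only [Equiv.coe_addLeft, h]
  simp only [shift, add_assoc, add_sub_assoc]

lemma integral_mul_translate (f g : p.Observable) (x : ℤ) :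
    ∫ z, f z * translate x g z ∂p.law = ∫ z, g z * translate (-x) f z ∂p.law := by
  rw [← integral_shift x fun z => g z * translate (-x) f z]
  simp only [translate, shift_neg_shift, mul_comm]

lemma translate_mem_homQuad {f : p.Observable} (hf : f ∈ p.HomQuad) (x : ℤ) :
    translate x f ∈ p.HomQuad :=
  homQuad_induction (P := fun f => translate x f ∈ p.HomQuad)
    (fun b i j => by rw [translate_weighted]; exact weighted_mem _ _ _) (zero_mem _)
    (fun _ _ _ _ h h' => add_mem h h') hf

/-- By antisymmetry and commutation with translations, the term at x is minus the term at -x. -/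
lemma pairing_antisymGen_self {f : p.Observable} (hf : f ∈ p.HomQuad) :
    pairing (antisymGen f) f = 0 := by
  have h : pairing (antisymGen f) f = -pairing (antisymGen f) f := by
    have h1 : ∀ x, ∫ z, antisymGen f z * translate x f z ∂p.law =
        -∫ z, antisymGen f z * translate (Equiv.neg ℤ x) f z ∂p.law := fun x => by
      rw [integral_antisymGen_mul hf (translate_mem_homQuad hf x), antisymGen_translate,
        integral_mul_translate, Equiv.neg_apply]
    rw [pairing, ← finsum_neg_distrib, ← finsum_comp_equiv (Equiv.neg ℤ)
      (f := fun x => -∫ z, antisymGen f z * translate x f z ∂p.law)]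
    exact finsum_congr h1
  linarith

/-! ### Translation invariance of the semi-norm -/

variable (p) in
/-- The elements of `Q₀` at which the functionals that define the semi-norm vanish. -/
def Negligible : Submodule ℝ p.Observable where
  carrier := {φ | φ ∈ p.Quad₀ ∧ moment φ = 0 ∧ ∀ g ∈ p.LocalSq, pairing φ g = 0}
  zero_mem' := ⟨zero_mem _, by simp [moment], fun g _ => by simp [pairing]⟩
  add_mem' := fun {φ ψ} hφ hψ => by
    have h := quad₀_le_pairable hφ.1
    have h' := quad₀_le_pairable hψ.1
    exact ⟨add_mem hφ.1 hψ.1, by rw [moment_add h h', hφ.2.1, hψ.2.1, add_zero],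
      fun g hg => by rw [pairing_add_left h h' hg, hφ.2.2 g hg, hψ.2.2 g hg, add_zero]⟩
  smul_mem' := fun r φ hφ => ⟨Submodule.smul_mem _ _ hφ.1,
    by rw [moment_smul, hφ.2.1, mul_zero],
    fun g hg => by rw [pairing_smul_left, hφ.2.2 g hg, mul_zero]⟩

lemma pairing_translate_right (φ g : p.Observable) (x : ℤ) :
    pairing φ (translate x g) = pairing φ g := by
  rw [pairing, pairing, ← finsum_comp_equiv (Equiv.addRight x)
    (f := fun y => ∫ z, φ z * translate y g z ∂p.law)]
  refine finsum_congr fun y => ?_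
  simp only [translate, shift_shift, Equiv.coe_addRight]

lemma pairing_translate_left (φ g : p.Observable) (x : ℤ) :
    pairing (translate x φ) g = pairing φ g := by
  rw [pairing, pairing, ← finsum_comp_equiv (Equiv.addRight x)]
  refine finsum_congr fun y => ?_
  rw [← integral_shift x fun z => φ z * translate y g z]
  simp only [translate, shift_shift, Equiv.coe_addRight, add_comm]

lemma translate_siteGrad (x y : ℤ) (F : p.Observable) :
    translate x (siteGrad y F) = siteGrad (x + y) (translate x F) := by
  have h : ∀ z : p.Phase, flip y (shift x z) = shift x (flip (x + y) z) := fun z => by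
    ext v
    · simp [shift, flip]
    · by_cases hv : v = y
      · subst hv; simp [shift, flip]
      · simp [shift, flip, hv]
  ext z
  simp only [translate, siteGrad, increment, h]

lemma translate_bondGrad (x y : ℤ) (F : p.Observable) :
    translate x (bondGrad y F) = bondGrad (x + y) (translate x F) := by
  have h : ∀ z : p.Phase, exchange y (y + 1) (shift x z) =
      shift x (exchange (x + y) (x + y + 1) z) := fun z => by
    ext v
    · simp [shift, exchange]
    · simp only [shift, exchange]
      by_cases h0 : v = y
      · subst h0; simp [add_assoc]
      by_cases h1 : v = y + 1
      · subst h1; simp [add_assoc]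
      rw [Equiv.swap_apply_of_ne_of_ne h0 h1,
        Equiv.swap_apply_of_ne_of_ne (by omega) (by omega)]
  ext z
  simp only [translate, bondGrad, increment, h]

/-- The weight x in the moment does not break invariance on `Quad₀`: flip increments have zero
moment, and that of an exchange increment is an integral against a local energy gradient, which
moves with the function. -/
lemma translate_sub_mem {φ : p.Observable} (hφ : φ ∈ p.Quad₀) (x : ℤ) :
    translate x φ - φ ∈ p.Negligible := by
  let T : p.Observable →ₗ[ℝ] p.Observable :=
    { toFun := fun f => translate x f - f
      map_add' := fun f g => by ext z; simp [translate]; ring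
      map_smul' := fun r f => by ext z; simp [translate]; ring }
  have h : p.Quad₀ ≤ p.Negligible.comap T := by
    refine quad₀_le fun F hF y => ?_
    have hF' := (homQuad_le_localSq hF).1
    have hT := translate_mem_homQuad hF x
    have hT' := (homQuad_le_localSq hT).1
    have m1 := quad₀_le_pairable (siteGrad_mem hF y)
    have m2 := quad₀_le_pairable (bondGrad_mem hF y)
    have n1 := siteGrad_mem hT (x + y)
    have n2 := bondGrad_mem hT (x + y)
    have hsub : ∀ {u v : p.Observable}, u ∈ p.Quad₀ → v ∈ p.Quad₀ → moment u = moment v →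
        (∀ g, pairing u g = pairing v g) → u - v ∈ p.Negligible := fun {u v} hu hv e e' => by
      have e1 : u - v = u + (-1 : ℝ) • v := by rw [neg_one_smul, sub_eq_add_neg]
      have hv' := Submodule.smul_mem _ (-1 : ℝ) hv
      refine ⟨sub_mem hu hv, ?_, fun g hg => ?_⟩
      · rw [e1, moment_add (quad₀_le_pairable hu) (quad₀_le_pairable hv'), moment_smul, e]
        ring
      · rw [e1, pairing_add_left (quad₀_le_pairable hu) (quad₀_le_pairable hv') hg,
          pairing_smul_left, e']
        ring
    constructor
    · refine hsub ?_ (siteGrad_mem hF y) ?_ fun g => pairing_translate_left _ g x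
      · rw [translate_siteGrad]; exact n1
      · rw [translate_siteGrad, moment_siteGrad hT', moment_siteGrad hF']
    · refine hsub ?_ (bondGrad_mem hF y) ?_ fun g => pairing_translate_left _ g x
      · rw [translate_bondGrad]; exact n2
      · rw [translate_bondGrad, moment_bondGrad hT', moment_bondGrad hF',
          ← integral_shift x fun z => F z * p.energyGrad (shift y z)]
        simp only [translate, shift_shift]
  exact h hφ

lemma tripleNorm_add_le {φ ψ : p.Observable} (hφ : φ ∈ p.Quad₀) (hψ : ψ ∈ p.Quad₀) :
    tripleNorm (φ + ψ) ≤ tripleNorm φ + tripleNorm ψ := by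
  have h := norm_add_le (p.toH1 ⟨φ, hφ⟩) (p.toH1 ⟨ψ, hψ⟩)
  rwa [← map_add, norm_toH1, norm_toH1, norm_toH1] at h

lemma tripleNorm_sub_le {φ ψ : p.Observable} (hφ : φ ∈ p.Quad₀) (hψ : ψ ∈ p.Quad₀) :
    tripleNorm (φ - ψ) ≤ tripleNorm φ + tripleNorm ψ := by
  have h := norm_sub_le (p.toH1 ⟨φ, hφ⟩) (p.toH1 ⟨ψ, hψ⟩)
  rwa [← map_sub, norm_toH1, norm_toH1, norm_toH1] at h

lemma tripleNorm_congr {φ ψ : p.Observable} (hψ : ψ ∈ p.Quad₀)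
    (h : φ - ψ ∈ p.Negligible) : tripleNorm φ = tripleNorm ψ := by
  have e : φ = φ - ψ + ψ := by abel
  have h1 := quad₀_le_pairable h.1
  have h2 := quad₀_le_pairable hψ
  rw [tripleNorm, tripleNorm, tripleNormSq, tripleNormSq]
  congr 2
  ext w
  rw [e, moment_add h1 h2, pairing_add_left h1 h2 (quad_le_localSq w.1.2), h.2.1,
    h.2.2 _ (quad_le_localSq w.1.2)]
  simp

/-! ### Upper bounds for the semi-norm -/

/-- A function odd under a flip is -1/2 times its own increment, so its pairing is an integral
against the increment of Γ_g. Young's inequality with weight γ lets the Dirichlet form absorb that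
increment and leaves (2/γ)(1/4) = 1/(2γ) times the L² norm squared. -/
lemma tripleNormSq_le_of_flip {φ : p.Observable} (hφ : φ ∈ p.Quad₀) {y : ℤ}
    (h : siteGrad y φ = (-2 : ℝ) • φ) :
    tripleNormSq φ ≤ (2 * p.γ)⁻¹ * ∫ z, φ z ^ 2 ∂p.law := by
  have hm : MemLp φ 2 p.law := (quad₀_le_pairable hφ).1
  have e : φ = (-2⁻¹ : ℝ) • siteGrad y φ := by rw [h, smul_smul]; norm_num
  have hθ := isLocalMove_flip (p := p) y
  refine ciSup_le fun w => ?_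
  have hg := quad_le_localSq w.1.2
  have h1 : moment φ = 0 := by rw [e, moment_smul, moment_siteGrad hm, mul_zero]
  have h2 : pairing φ w.1 = ∫ z, (-2⁻¹ * φ z) * gradSum (flip y) w.1 z ∂p.law := by
    conv_lhs => rw [e]
    rw [pairing_smul_left, siteGrad, hθ.pairing_increment hm hg, ← integral_const_mul]
    simp only [mul_assoc]
  have h3 := two_integral_mul_le (hm.const_mul (-2⁻¹)) (hθ.memLp_gradSum hg) p.γ_pos
  have h4 : ∫ z, gradSum (flip y) (w.1 : p.Observable) z ^ 2 ∂p.law =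
      ∫ z, siteGradSum (w.1 : p.Observable) z ^ 2 ∂p.law := by
    simp only [gradSum_shift (shift_flip y) (w.1 : p.Observable)]
    exact integral_shift y fun z => gradSum (flip 0) (w.1 : p.Observable) z ^ 2
  have h5 : 0 ≤ p.lam / 2 * ∫ z, (w.2 * p.energyGrad z +
      bondGradSum (w.1 : p.Observable) z) ^ 2 ∂p.law :=
    mul_nonneg (by have := p.lam_pos; positivity) (integral_nonneg fun z => sq_nonneg _)
  have h6 : ∫ z, (-2⁻¹ * φ z) ^ 2 ∂p.law = 4⁻¹ * ∫ z, φ z ^ 2 ∂p.law := by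
    rw [← integral_const_mul]
    congr 1; ext z; ring
  rw [h4, h6] at h3
  have h7 : 2 / p.γ * (4⁻¹ * ∫ z, φ z ^ 2 ∂p.law) = (2 * p.γ)⁻¹ * ∫ z, φ z ^ 2 ∂p.law := by
    have := p.γ_pos
    field_simp; ring
  rw [h1, h2, dirichlet_eq]
  linarith

/-- The argument is that for flips, but now the moment contributes as well and has to be combined
with the pairing before Young's inequality is applied. -/
lemma tripleNormSq_le_of_exchange {φ : p.Observable} (hφ : φ ∈ p.Quad₀)
    (h : bondGrad 0 φ = (-2 : ℝ) • φ) :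
    tripleNormSq φ ≤ (2 * p.lam)⁻¹ * ∫ z, φ z ^ 2 ∂p.law := by
  have hm : MemLp φ 2 p.law := (quad₀_le_pairable hφ).1
  have e : φ = (-2⁻¹ : ℝ) • bondGrad 0 φ := by rw [h, smul_smul]; norm_num
  have hθ := isLocalMove_exchange (p := p) 0 (0 + 1)
  refine ciSup_le fun w => ?_
  have hg := quad_le_localSq w.1.2
  have hB : MemLp (bondGradSum (w.1 : p.Observable)) 2 p.law := hθ.memLp_gradSum hg
  -- The moment carries the factor 1/2 and the pairing -1/2, so the combined integrand contains
  -- -a(ω_1² - ω_0²). The Dirichlet form is even in a, so the sign is harmless (`h8`).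
  have hE := (memLp_energyGrad (p := p)).const_mul (-w.2)
  have h1 : moment φ = 2⁻¹ * ∫ z, φ z * p.energyGrad z ∂p.law := by
    conv_lhs => rw [e]
    rw [moment_smul, moment_bondGrad hm]
    simp only [shift_zero]
    ring
  have h2 : pairing φ w.1 = -2⁻¹ * ∫ z, φ z * bondGradSum (w.1 : p.Observable) z ∂p.law := by
    conv_lhs => rw [e]
    rw [pairing_smul_left, bondGrad, hθ.pairing_increment hm hg, ← bondGradSum_eq]
  have h3 := two_integral_mul_le (hm.const_mul (-2⁻¹)) (hE.add hB) p.lam_pos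
  have h4 : ∫ z, (-2⁻¹ * φ z) * ((fun z => -w.2 * p.energyGrad z) +
      bondGradSum (w.1 : p.Observable)) z ∂p.law = pairing φ w.1 + w.2 * moment φ := by
    rw [h1, h2, ← mul_assoc, ← integral_const_mul, ← integral_const_mul,
      ← integral_add ((integrable_fun_mul hm hB).const_mul _)
        ((integrable_fun_mul hm memLp_energyGrad).const_mul _)]
    congr 1; ext z
    simp only [Pi.add_apply]
    ring
  have h5 : 0 ≤ p.γ / 2 * ∫ z, siteGradSum (w.1 : p.Observable) z ^ 2 ∂p.law :=
    mul_nonneg (by have := p.γ_pos; positivity) (integral_nonneg fun z => sq_nonneg _)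
  have h6 : ∫ z, (-2⁻¹ * φ z) ^ 2 ∂p.law = 4⁻¹ * ∫ z, φ z ^ 2 ∂p.law := by
    rw [← integral_const_mul]
    congr 1; ext z; ring
  have h7 : 2 / p.lam * (4⁻¹ * ∫ z, φ z ^ 2 ∂p.law) = (2 * p.lam)⁻¹ * ∫ z, φ z ^ 2 ∂p.law := by
    have := p.lam_pos
    field_simp; ring
  have h8 : dirichlet (-w.2) (w.1 : p.Observable) = dirichlet w.2 (w.1 : p.Observable) := by
    rw [dirichlet_eq_add (-w.2) hg, dirichlet_eq_add w.2 hg, neg_sq]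
  rw [h4, h6] at h3
  simp only [Pi.add_apply] at h3
  rw [← h8, dirichlet_eq]
  linarith

/-! ### Canonical representatives of quadratic functions -/

variable (p) in
/-- `∑_k φ_k(m) ω_0 ω_{k+1}`. -/
def offDiag : (ℕ →₀ p.Coeff) →ₗ[ℝ] p.Observable :=
  Finsupp.lsum ℝ fun k => weighted fun ω => ω 0 * ω (k + 1)

variable (p) in
/-- `ξ(m) (ω_1² - ω_0²)`. -/
def diag : p.Coeff →ₗ[ℝ] p.Observable := weighted fun ω => ω 1 ^ 2 - ω 0 ^ 2

/-- `θ ↦ τ_1 θ + τ_{-1} θ - 2 θ`. -/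
def laplacian (θ : p.Coeff) : p.Coeff := shiftCoeff 1 θ + shiftCoeff (-1) θ - (2 : ℝ) • θ

lemma diag_eq (b : p.Coeff) :
    p.diag b = weighted (fun ω => ω 1 * ω 1) b - weighted (fun ω => ω 0 * ω 0) b := by
  ext z; simp [diag, weighted]; ring

lemma offDiag_eq {φ : ℕ →₀ p.Coeff} {s : Finset ℕ} (hs : φ.support ⊆ s) :
    p.offDiag φ = ∑ k ∈ s, weighted (fun ω => ω 0 * ω (k + 1)) (φ k) := by
  rw [offDiag, Finsupp.coe_lsum]
  exact Finsupp.sum_of_support_subset _ hs _ fun _ _ => map_zero _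

lemma weighted_mem_quad (b : p.Coeff) {i j : ℤ} (hij : i ≠ j) :
    weighted (fun ω => ω i * ω j) b ∈ p.Quad := by
  -- The families that define Q are symmetric, so the coefficient is shared equally between (i, j)
  -- and (j, i).
  refine ⟨Finsupp.single (i, j) ((2⁻¹ : ℝ) • b) + Finsupp.single (j, i) ((2⁻¹ : ℝ) • b),
    fun k l => ?_, ?_⟩
  · simp only [Finsupp.add_apply, Finsupp.single_apply, Prod.mk.injEq]
    rw [add_comm]
    simp only [and_comm]
  · rw [map_add]
    simp only [Finsupp.lsum_single, if_neg hij, if_neg hij.symm]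
    ext z
    simp [weighted]; ring

lemma diag_mem_quad (b : p.Coeff) : p.diag b ∈ p.Quad := by
  refine ⟨Finsupp.single (0, 0) b, fun k l => ?_, ?_⟩
  · simp only [Finsupp.single_apply, Prod.mk.injEq]
    simp only [and_comm]
  · simp [diag]

lemma diag_mem_quad₀ (b : p.Coeff) : p.diag b ∈ p.Quad₀ := by
  rw [diag_eq]; exact diag_mem b 0

lemma offDiag_mem_quad (φ : ℕ →₀ p.Coeff) : p.offDiag φ ∈ p.Quad := by
  rw [offDiag_eq subset_rfl]
  exact Submodule.sum_mem _ fun k _ => weighted_mem_quad _ (by omega)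

lemma offDiag_mem_quad₀ (φ : ℕ →₀ p.Coeff) : p.offDiag φ ∈ p.Quad₀ := by
  rw [offDiag_eq subset_rfl]
  exact Submodule.sum_mem _ fun k _ => offDiag_mem _ (by omega)

lemma integral_weighted_mul_translate (b c : p.Coeff) (i j k l x : ℤ) :
    ∫ z, weighted (fun ω => ω i * ω j) b z * translate x (weighted (fun ω => ω k * ω l) c) z
      ∂p.law = p.mean (b * shiftCoeff x c) * wick i j (x + k) (x + l) := by
  rw [translate_weighted, integral_weighted_mul]

/-- The translate of {0, l + 1} by x matches {0, k + 1} only when x = 0 and k = l, so different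
distances are orthogonal. -/
lemma pairing_weighted_weighted (b c : p.Coeff) (k l : ℕ) :
    pairing (weighted (p := p) (fun ω => ω 0 * ω (k + 1)) b)
      (weighted (fun ω => ω 0 * ω (l + 1)) c) = if k = l then p.mean (b * c) else 0 := by
  simp only [pairing, integral_weighted_mul_translate]
  rw [finsum_eq_single _ 0]
  · by_cases h : k = l
    · subst h
      simp [wick, shiftCoeff_zero, show (0 : ℤ) ≠ k + 1 by omega]
    · simp [wick, h, show (0 : ℤ) ≠ k + 1 by omega, show (0 : ℤ) ≠ l + 1 by omega]
  · intro x hx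
    by_cases h : (k : ℤ) + 1 = x
    · simp [wick, Ne.symm hx, show (0 : ℤ) ≠ k + 1 by omega, show (0 : ℤ) ≠ x + (l + 1) by omega]
    · simp [wick, Ne.symm hx, show (0 : ℤ) ≠ k + 1 by omega, h]

lemma integral_mul_sub_sub {a b c d : p.Observable} (ha : a ∈ p.HomQuad) (hb : b ∈ p.HomQuad)
    (hc : c ∈ p.HomQuad) (hd : d ∈ p.HomQuad) :
    ∫ z, (a - b) z * (c - d) z ∂p.law = (∫ z, a z * c z ∂p.law) - (∫ z, a z * d z ∂p.law) -
      ((∫ z, b z * c z ∂p.law) - ∫ z, b z * d z ∂p.law) := by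
  rw [← integral_sub (integrable_homQuad_mul ha hc) (integrable_homQuad_mul ha hd),
    ← integral_sub (integrable_homQuad_mul hb hc) (integrable_homQuad_mul hb hd),
    ← integral_sub (Integrable.sub' (integrable_homQuad_mul ha hc) (integrable_homQuad_mul ha hd))
      (Integrable.sub' (integrable_homQuad_mul hb hc) (integrable_homQuad_mul hb hd))]
  congr 1; ext z
  simp only [Pi.sub_apply]
  ring

lemma integral_diag_mul_translate_diag (b c : p.Coeff) (x : ℤ) :
    ∫ z, p.diag b z * translate x (p.diag c) z ∂p.law = p.mean (b * shiftCoeff x c) *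
      (wick 1 1 (x + 1) (x + 1) - wick 1 1 x x - (wick 0 0 (x + 1) (x + 1) - wick 0 0 x x)) := by
  have h : translate x (p.diag c) = weighted (fun ω => ω (x + 1) * ω (x + 1)) (shiftCoeff x c) -
      weighted (fun ω => ω (x + 0) * ω (x + 0)) (shiftCoeff x c) := by
    rw [diag_eq]; rfl
  rw [h, diag_eq, integral_mul_sub_sub (weighted_mem _ _ _) (weighted_mem _ _ _)
    (weighted_mem _ _ _) (weighted_mem _ _ _)]
  simp only [integral_weighted_mul, add_zero]
  ring

lemma integral_diag_sq (b : p.Coeff) : ∫ z, p.diag b z ^ 2 ∂p.law = 4 * p.mean (b * b) := by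
  have h := integral_diag_mul_translate_diag b b 0
  simp only [translate_zero, shiftCoeff_zero] at h
  simp only [sq, h]
  norm_num [wick]
  ring

/-- Only the shifts 0, 1 and -1 contribute. The corresponding covariances of the energy gradients
are 4, -2 and -2, which is -2 times the stencil of the Laplacian. -/
lemma pairing_diag_diag (b c : p.Coeff) :
    pairing (p.diag b) (p.diag c) = -2 * p.mean (b * laplacian c) := by
  simp only [pairing, integral_diag_mul_translate_diag]
  rw [finsum_eq_sum_of_support_subset (s := {0, 1, -1})]
  · rw [Finset.sum_insert (by simp), Finset.sum_pair (by norm_num)]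
    simp only [laplacian, mul_sub, mul_add, map_sub, map_add, mul_smul_comm, map_smul,
      shiftCoeff_zero]
    norm_num [wick]
    ring
  · intro x hx
    by_contra hn
    simp only [Finset.coe_insert, Finset.coe_singleton, Set.mem_insert_iff,
      Set.mem_singleton_iff, not_or] at hn
    refine hx ?_
    simp [wick, hn.1, Ne.symm hn.1, Ne.symm hn.2.1, show (0 : ℤ) ≠ x + 1 by omega]

lemma pairing_comm (φ g : p.Observable) : pairing φ g = pairing g φ := by
  rw [pairing, pairing, ← finsum_comp_equiv (Equiv.neg ℤ)
    (f := fun x => ∫ z, g z * translate x φ z ∂p.law)]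
  exact finsum_congr fun x => integral_mul_translate φ g x

lemma pairing_weighted_diag (b c : p.Coeff) (k : ℕ) :
    pairing (weighted (p := p) (fun ω => ω 0 * ω (k + 1)) b) (p.diag c) = 0 := by
  have h := weighted_mem (p := p) b 0 (k + 1)
  have h1 := quad₀_le_pairable (offDiag_mem (p := p) b (show (0 : ℤ) ≠ k + 1 by omega))
  have m := fun j => homQuad_le_localSq (weighted_mem (p := p) c j j)
  have key : ∀ j, pairing (weighted (p := p) (fun ω => ω 0 * ω (k + 1)) b)
      (weighted (fun ω => ω j * ω j) c) = 0 := fun j => by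
    simp only [pairing, integral_weighted_mul_translate]
    rw [finsum_eq_zero_of_forall_eq_zero]
    intro x
    by_cases h0 : 0 = x + j
    · simp [wick, ← h0, show (k : ℤ) + 1 ≠ 0 by omega, show (0 : ℤ) ≠ k + 1 by omega]
    · simp [wick, h0, show (0 : ℤ) ≠ k + 1 by omega]
  rw [diag_eq, sub_eq_add_neg, ← neg_one_smul ℝ, pairing_add_right h1 (m 1)
    (Submodule.smul_mem _ _ (m 0)), pairing_smul_right, key, key]
  simp

/-- `∑_k E[φ_k²]`. -/
def coeffNormSq (φ : ℕ →₀ p.Coeff) : ℝ := ∑ k ∈ insert 0 φ.support, p.mean (φ k * φ k)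

lemma weighted_mem_pairable {s : Finset ℕ} {φ : ℕ → p.Coeff} :
    ∀ k ∈ s, weighted (p := p) (fun ω => ω 0 * ω (k + 1)) (φ k) ∈ p.Pairable := fun _ _ =>
  quad₀_le_pairable (offDiag_mem _ (by omega))

lemma pairing_offDiag_diag (φ : ℕ →₀ p.Coeff) (c : p.Coeff) :
    pairing (p.offDiag φ) (p.diag c) = 0 := by
  rw [offDiag_eq subset_rfl, pairing_sum_left weighted_mem_pairable
    (quad_le_localSq (diag_mem_quad c))]
  exact Finset.sum_eq_zero fun k _ => pairing_weighted_diag _ _ _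

lemma pairing_offDiag_offDiag (φ : ℕ →₀ p.Coeff) :
    pairing (p.offDiag φ) (p.offDiag φ) = coeffNormSq φ := by
  have hs : φ.support ⊆ insert 0 φ.support := Finset.subset_insert _ _
  conv_lhs => rw [offDiag_eq hs]
  rw [pairing_sum_left weighted_mem_pairable (by
    rw [← offDiag_eq hs]; exact quad_le_localSq (offDiag_mem_quad φ))]
  refine Finset.sum_congr rfl fun k hk => ?_
  rw [pairing_sum_right (fun l _ => homQuad_le_localSq (weighted_mem _ _ _))
    (weighted_mem_pairable (φ := φ) k hk)]
  simp only [pairing_weighted_weighted]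
  rw [Finset.sum_ite_eq, if_pos hk]

lemma pairing_offDiag_canonical (θ : p.Coeff) (φ : ℕ →₀ p.Coeff) :
    pairing (p.offDiag φ) (p.diag θ + p.offDiag φ) = coeffNormSq φ := by
  rw [pairing_add_right (quad₀_le_pairable (offDiag_mem_quad₀ φ))
    (quad_le_localSq (diag_mem_quad θ)) (quad_le_localSq (offDiag_mem_quad φ)),
    pairing_offDiag_diag, pairing_offDiag_offDiag, zero_add]

lemma pairing_diag_canonical (ξ θ : p.Coeff) (φ : ℕ →₀ p.Coeff) :
    pairing (p.diag ξ) (p.diag θ + p.offDiag φ) = -2 * p.mean (ξ * laplacian θ) := by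
  rw [pairing_add_right (quad₀_le_pairable (diag_mem_quad₀ ξ))
    (quad_le_localSq (diag_mem_quad θ)) (quad_le_localSq (offDiag_mem_quad φ)),
    pairing_comm _ (p.offDiag φ), pairing_offDiag_diag, pairing_diag_diag, add_zero]

variable (p) in
/-- The functions that agree, up to translations, with `θ(m) (ω_1² - ω_0²) + ∑_k φ_k(m) ω_0 ω_{k+1}`
for some `θ` and `φ`. -/
def CanonicalUpToTranslation : Submodule ℝ p.Observable where
  carrier := {f | f ∈ p.HomQuad ∧ ∃ (θ : p.Coeff) (φ : ℕ →₀ p.Coeff),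
    (∀ ψ ∈ p.Pairable, pairing ψ f = pairing ψ (p.diag θ + p.offDiag φ)) ∧
      antisymGen f - antisymGen (p.diag θ + p.offDiag φ) ∈ p.Negligible}
  zero_mem' := ⟨zero_mem _, 0, 0, by simp, by simp⟩
  add_mem' := by
    rintro f g ⟨hf, θ, φ, h1, h2⟩ ⟨hg, θ', φ', h1', h2'⟩
    have hc := quad_le_homQuad (add_mem (diag_mem_quad θ) (offDiag_mem_quad φ))
    have hc' := quad_le_homQuad (add_mem (diag_mem_quad θ') (offDiag_mem_quad φ'))
    have e : p.diag (θ + θ') + p.offDiag (φ + φ') =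
        p.diag θ + p.offDiag φ + (p.diag θ' + p.offDiag φ') := by
      rw [map_add, map_add]; abel
    refine ⟨add_mem hf hg, θ + θ', φ + φ', fun ψ hψ => ?_, ?_⟩
    · rw [e, pairing_add_right hψ (homQuad_le_localSq hf) (homQuad_le_localSq hg),
        pairing_add_right hψ (homQuad_le_localSq hc) (homQuad_le_localSq hc'), h1 ψ hψ, h1' ψ hψ]
    · rw [e, antisymGen_add (homQuad_le_localDiff hf) (homQuad_le_localDiff hg),
        antisymGen_add (homQuad_le_localDiff hc) (homQuad_le_localDiff hc'), add_sub_add_comm]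
      exact add_mem h2 h2'
  smul_mem' := by
    rintro r f ⟨hf, θ, φ, h1, h2⟩
    have hc := quad_le_homQuad (add_mem (diag_mem_quad θ) (offDiag_mem_quad φ))
    have e : p.diag (r • θ) + p.offDiag (r • φ) = r • (p.diag θ + p.offDiag φ) := by
      rw [map_smul, map_smul, smul_add]
    refine ⟨Submodule.smul_mem _ _ hf, r • θ, r • φ, fun ψ hψ => ?_, ?_⟩
    · rw [e, pairing_smul_right, pairing_smul_right, h1 ψ hψ]
    · rw [e, antisymGen_smul r (homQuad_le_localDiff hf),
        antisymGen_smul r (homQuad_le_localDiff hc), ← smul_sub]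
      exact Submodule.smul_mem _ _ h2

lemma translate_canonical_mem (θ : p.Coeff) (φ : ℕ →₀ p.Coeff) (x : ℤ) :
    translate x (p.diag θ + p.offDiag φ) ∈ p.CanonicalUpToTranslation := by
  have hc := quad_le_homQuad (add_mem (diag_mem_quad θ) (offDiag_mem_quad φ))
  refine ⟨translate_mem_homQuad hc x, θ, φ, fun ψ _ => pairing_translate_right _ _ _, ?_⟩
  rw [antisymGen_translate]
  exact translate_sub_mem (antisymGen_mem hc) x

lemma weighted_mem_canonical_of_lt (b : p.Coeff) {i j : ℤ} (hij : i < j) :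
    weighted (fun ω => ω i * ω j) b ∈ p.CanonicalUpToTranslation := by
  -- The monomial ω_i ω_j is the translate by i of ω_0 ω_{k+1} with k = j - i - 1, so its
  -- coefficient is shifted back by i.
  convert translate_canonical_mem 0 (Finsupp.single (j - i - 1).toNat (shiftCoeff (-i) b)) i using 1
  have h : i + (((j - i - 1).toNat : ℤ) + 1) = j := by omega
  simp only [map_zero, zero_add, offDiag, Finsupp.lsum_single]
  rw [translate_weighted, h, add_zero, shiftCoeff_shiftCoeff, add_neg_cancel, shiftCoeff_zero]

lemma quad_le_canonical : p.Quad ≤ p.CanonicalUpToTranslation := by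
  refine quad_le (fun b i j hij => ?_) fun b i => ?_
  · rcases lt_or_gt_of_ne hij with h | h
    · exact weighted_mem_canonical_of_lt b h
    · convert weighted_mem_canonical_of_lt b h using 1
      ext z
      simp [weighted, mul_comm (z.2 i)]
  · convert translate_canonical_mem (shiftCoeff (-i) b) 0 i using 1
    ext z
    simp [translate, shift, diag, weighted, shiftCoeff_apply]

/-! ### The sector condition -/

lemma mean_mul_self_nonneg (b : p.Coeff) : 0 ≤ p.mean (b * b) :=
  integral_nonneg fun m => mul_self_nonneg ((b : p.Disorder → ℝ) m)

/-- Only the lower bound C⁻¹ on the masses enters: it gives √(m_x m_{x+1}) ≥ C⁻¹. -/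
lemma bondCoeff_mem_Icc (x : ℤ) (m : p.Disorder) :
    0 ≤ (p.bondCoeff x : p.Disorder → ℝ) m ∧ (p.bondCoeff x : p.Disorder → ℝ) m ≤ p.C := by
  have hC := p.C_pos
  refine ⟨inv_nonneg.2 (Real.sqrt_nonneg _), inv_le_of_inv_le₀ hC (Real.le_sqrt_of_sq_le ?_)⟩
  rw [sq]
  exact mul_le_mul (m x).2.1 (m (x + 1)).2.1 (inv_nonneg.2 hC.le) (mass_pos m x).le

lemma mean_bondCoeff_mul_le (x : ℤ) (b : p.Coeff) :
    p.mean (p.bondCoeff x * b * (p.bondCoeff x * b)) ≤ p.C ^ 2 * p.mean (b * b) := by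
  rw [show p.C ^ 2 * p.mean (b * b) = p.mean (p.C ^ 2 • (b * b)) by
    rw [map_smul, smul_eq_mul]]
  refine integral_mono (integrable_coeff _) (integrable_coeff _) fun m => ?_
  obtain ⟨h1, h2⟩ := bondCoeff_mem_Icc x m
  change (p.bondCoeff x : p.Disorder → ℝ) m * (b : p.Disorder → ℝ) m *
    ((p.bondCoeff x : p.Disorder → ℝ) m * (b : p.Disorder → ℝ) m) ≤
      p.C ^ 2 * ((b : p.Disorder → ℝ) m * (b : p.Disorder → ℝ) m)
  have h3 : (p.bondCoeff x : p.Disorder → ℝ) m ^ 2 ≤ p.C ^ 2 := pow_le_pow_left₀ h1 h2 2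
  nlinarith [mul_le_mul_of_nonneg_right h3 (mul_self_nonneg ((b : p.Disorder → ℝ) m))]

lemma integral_sum_weighted_sq {s : Finset ℕ} {i : ℤ} {j : ℕ → ℤ} (hi : ∀ k ∈ s, i ≠ j k)
    (hj : Set.InjOn j s) (d : ℕ → p.Coeff) :
    ∫ z, (∑ k ∈ s, weighted (fun ω => ω i * ω (j k)) (d k)) z ^ 2 ∂p.law =
      ∑ k ∈ s, p.mean (d k * d k) := by
  have hI : ∀ k l, Integrable (fun z => weighted (fun ω => ω i * ω (j k)) (d k) z *
      weighted (fun ω => ω i * ω (j l)) (d l) z) p.law := fun k l =>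
    integrable_homQuad_mul (weighted_mem _ _ _) (weighted_mem _ _ _)
  simp only [Finset.sum_apply, sq, Finset.sum_mul_sum]
  rw [integral_finsetSum _ fun k _ => integrable_finsetSum _ fun l _ => hI k l]
  refine Finset.sum_congr rfl fun k hk => ?_
  rw [integral_finsetSum _ fun l _ => hI k l, Finset.sum_eq_single k]
  · rw [integral_weighted_mul]
    simp [wick, hi k hk]
  · intro l hl hlk
    rw [integral_weighted_mul]
    have : j k ≠ j l := fun h => hlk (hj hl hk h.symm)
    simp [wick, hi k hk, hi l hl, this]
  · exact fun h => absurd hk h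

lemma sum_weighted_mem {s : Finset ℕ} {i : ℤ} {j : ℕ → ℤ} (hi : ∀ k ∈ s, i ≠ j k)
    (d : ℕ → p.Coeff) : ∑ k ∈ s, weighted (p := p) (fun ω => ω i * ω (j k)) (d k) ∈ p.Quad₀ :=
  Submodule.sum_mem _ fun k hk => offDiag_mem _ (hi k hk)

/-- All monomials share the factor ω_i, so the whole sum is odd under a single flip. The flip bound
applies at once and yields an ℓ² bound independent of the number of terms, which the triangle
inequality would not. -/
lemma tripleNorm_sum_weighted_le {s : Finset ℕ} {i : ℤ} {j : ℕ → ℤ} (hi : ∀ k ∈ s, i ≠ j k)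
    (hj : Set.InjOn j s) (d : ℕ → p.Coeff) :
    tripleNorm (∑ k ∈ s, weighted (p := p) (fun ω => ω i * ω (j k)) (d k)) ≤
      √(2 * p.γ)⁻¹ * √(∑ k ∈ s, p.mean (d k * d k)) := by
  have hγ := p.γ_pos
  rw [← Real.sqrt_mul (by positivity), ← integral_sum_weighted_sq hi hj]
  refine Real.sqrt_le_sqrt (tripleNormSq_le_of_flip (y := i) (sum_weighted_mem hi d) ?_)
  ext z
  simp only [siteGrad, increment, Finset.sum_apply, Pi.smul_apply, smul_eq_mul, Finset.mul_sum]
  rw [← Finset.sum_sub_distrib]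
  refine Finset.sum_congr rfl fun k hk => ?_
  simp [weighted, flip, Function.update_of_ne (hi k hk).symm]
  ring

lemma tripleNorm_weighted_le {i j : ℤ} (hij : i ≠ j) (b : p.Coeff) :
    tripleNorm (weighted (p := p) (fun ω => ω i * ω j) b) ≤
      √(2 * p.γ)⁻¹ * √(p.mean (b * b)) := by
  simpa using tripleNorm_sum_weighted_le (s := {0}) (i := i) (j := fun _ => j)
    (fun _ _ => hij) (by simp) fun _ => b

/-- The exchange of sites 0 and 1 changes the sign of this function, and (ω_1² - ω_0²)² has mean 4.
-/
lemma tripleNorm_diag_le (b : p.Coeff) :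
    tripleNorm (p.diag b) ≤ √(2 * p.lam)⁻¹ * (2 * √(p.mean (b * b))) := by
  have hl := p.lam_pos
  rw [show (2 : ℝ) * √(p.mean (b * b)) = √(4 * p.mean (b * b)) by
    rw [Real.sqrt_mul (by norm_num), show (4 : ℝ) = 2 ^ 2 by norm_num, Real.sqrt_sq (by norm_num)],
    ← Real.sqrt_mul (by positivity), ← integral_diag_sq]
  refine Real.sqrt_le_sqrt (tripleNormSq_le_of_exchange (diag_mem_quad₀ b) ?_)
  ext z
  simp [bondGrad, increment, exchange, diag, weighted]
  ring

lemma sum_bondCoeff_le {s t : Finset ℕ} (hst : s ⊆ t) (x : ℕ → ℤ) (d : ℕ → p.Coeff) :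
    √(∑ k ∈ s, p.mean (p.bondCoeff (x k) * d k * (p.bondCoeff (x k) * d k))) ≤
      p.C * √(∑ k ∈ t, p.mean (d k * d k)) := by
  rw [← Real.sqrt_sq p.C_pos.le, ← Real.sqrt_mul (sq_nonneg _), Finset.mul_sum]
  refine Real.sqrt_le_sqrt ((Finset.sum_le_sum fun k _ => mean_bondCoeff_mul_le _ _).trans ?_)
  exact Finset.sum_le_sum_of_subset_of_nonneg hst fun k _ _ =>
    mul_nonneg (sq_nonneg _) (mean_mul_self_nonneg _)

lemma antisymGen_sum {ι : Type*} {s : Finset ι} {D : ι → p.Observable}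
    (hD : ∀ x ∈ s, D x ∈ p.HomQuad) :
    antisymGen (∑ x ∈ s, D x) = ∑ x ∈ s, antisymGen (D x) := by
  classical
  induction s using Finset.induction_on with
  | empty => simp [antisymGen_zero]
  | insert x s hx ih =>
    have h : ∀ y ∈ s, D y ∈ p.HomQuad := fun y hy => hD y (Finset.mem_insert_of_mem hy)
    rw [Finset.sum_insert hx, Finset.sum_insert hx, antisymGen_add
      (homQuad_le_localDiff (hD x (Finset.mem_insert_self x s)))
      (homQuad_le_localDiff (Submodule.sum_mem _ h)), ih h]

/-- A moves one endpoint of the pair {0, k + 1} by one step. For k = 0 the two inward moves make the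
endpoints meet and combine into an energy gradient; in each of the four remaining sums one site (1,
-1, 0 and 0) is common to all monomials, as `tripleNorm_sum_weighted_le` requires. -/
lemma antisymGen_offDiag (φ : ℕ →₀ p.Coeff) : antisymGen (p.offDiag φ) =
    p.diag (p.bondCoeff 0 * φ 0) +
      ∑ k ∈ φ.support.erase 0, weighted (fun ω => ω 1 * ω (k + 1)) (p.bondCoeff 0 * φ k) -
      ∑ k ∈ insert 0 φ.support, weighted (fun ω => ω (-1) * ω (k + 1)) (p.bondCoeff (-1) * φ k) +
      ∑ k ∈ insert 0 φ.support, weighted (fun ω => ω 0 * ω (k + 1 + 1))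
        (p.bondCoeff (k + 1) * φ k) -
      ∑ k ∈ φ.support.erase 0, weighted (fun ω => ω 0 * ω k) (p.bondCoeff k * φ k) := by
  -- With 0 inserted in the support, the term k = 0 can be split off even when φ_0 = 0.
  have h0 : (0 : ℕ) ∈ insert 0 φ.support := Finset.mem_insert_self _ _
  have e1 := Finset.add_sum_erase _
    (fun k : ℕ => weighted (p := p) (fun ω => ω 1 * ω (k + 1)) (p.bondCoeff 0 * φ k)) h0
  have e2 := Finset.add_sum_erase _
    (fun k : ℕ => weighted (p := p) (fun ω => ω 0 * ω k) (p.bondCoeff k * φ k)) h0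
  rw [Finset.erase_insert_eq_erase] at e1 e2
  rw [offDiag_eq (Finset.subset_insert 0 _), antisymGen_sum fun k _ => weighted_mem _ _ _]
  simp only [antisymGen_weighted, Finset.sum_add_distrib, Finset.sum_sub_distrib, zero_add,
    zero_sub, add_sub_cancel_right]
  rw [← e1, ← e2, diag_eq]
  simp only [Nat.cast_zero, zero_add]
  abel

lemma tripleNorm_antisymGen_offDiag_le (φ : ℕ →₀ p.Coeff) :
    tripleNorm (antisymGen (p.offDiag φ)) ≤
      (2 * √(2 * p.lam)⁻¹ * p.C + 4 * (√(2 * p.γ)⁻¹ * p.C)) * √(coeffNormSq φ) := by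
  have hs : φ.support.erase 0 ⊆ insert 0 φ.support :=
    (Finset.erase_subset _ _).trans (Finset.subset_insert _ _)
  have inj : ∀ (s : Finset ℕ) (c : ℤ), Set.InjOn (fun k : ℕ => (k : ℤ) + c) s :=
    fun s c k _ l _ h => by simpa using h
  have ne0 : ∀ k ∈ φ.support.erase 0, k ≠ 0 := fun k hk => (Finset.mem_erase.1 hk).1
  have i1 : ∀ k ∈ φ.support.erase 0, (1 : ℤ) ≠ k + 1 := fun k hk => by
    have := ne0 k hk; omega
  have i2 : ∀ k ∈ insert 0 φ.support, (-1 : ℤ) ≠ k + 1 := fun k _ => by omega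
  have i3 : ∀ k ∈ insert 0 φ.support, (0 : ℤ) ≠ k + 1 + 1 := fun k _ => by omega
  have i4 : ∀ k ∈ φ.support.erase 0, (0 : ℤ) ≠ k := fun k hk => by
    have := ne0 k hk; omega
  have b0 := tripleNorm_diag_le (p.bondCoeff 0 * φ 0)
  have b1 := tripleNorm_sum_weighted_le i1 (inj _ 1) fun k => p.bondCoeff 0 * φ k
  have b2 := tripleNorm_sum_weighted_le i2 (inj _ 1) fun k => p.bondCoeff (-1) * φ k
  have b3 := tripleNorm_sum_weighted_le i3 (fun k _ l _ h => by simpa using h)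
    fun k : ℕ => p.bondCoeff (k + 1) * φ k
  have b4 := tripleNorm_sum_weighted_le i4 (fun k _ l _ h => by simpa using h)
    fun k : ℕ => p.bondCoeff k * φ k
  have c0 := sum_bondCoeff_le (s := {0}) (t := insert 0 φ.support)
    (Finset.singleton_subset_iff.2 (Finset.mem_insert_self _ _)) (fun _ => 0) φ
  have c1 := sum_bondCoeff_le hs (fun _ => 0) φ
  have c2 := sum_bondCoeff_le (subset_refl (insert 0 φ.support)) (fun _ => -1) φ
  have c3 := sum_bondCoeff_le (subset_refl (insert 0 φ.support)) (fun k => k + 1) φ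
  have c4 := sum_bondCoeff_le hs (fun k => k) φ
  rw [Finset.sum_singleton] at c0
  rw [← coeffNormSq] at c0 c1 c2 c3 c4
  have m0 := diag_mem_quad₀ (p.bondCoeff 0 * φ 0)
  have m1 := sum_weighted_mem i1 fun k => p.bondCoeff 0 * φ k
  have m2 := sum_weighted_mem i2 fun k => p.bondCoeff (-1) * φ k
  have m3 := sum_weighted_mem i3 fun k => p.bondCoeff (k + 1) * φ k
  have m4 := sum_weighted_mem i4 fun k => p.bondCoeff k * φ k
  have t1 := tripleNorm_add_le m0 m1
  have t2 := tripleNorm_sub_le (add_mem m0 m1) m2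
  have t3 := tripleNorm_add_le (sub_mem (add_mem m0 m1) m2) m3
  have t4 := tripleNorm_sub_le (add_mem (sub_mem (add_mem m0 m1) m2) m3) m4
  rw [antisymGen_offDiag]
  have hα : 0 ≤ √(2 * p.γ)⁻¹ := Real.sqrt_nonneg _
  have hβ : 0 ≤ √(2 * p.lam)⁻¹ := Real.sqrt_nonneg _
  have d0 := b0.trans (mul_le_mul_of_nonneg_left (mul_le_mul_of_nonneg_left c0 zero_le_two) hβ)
  have d1 := b1.trans (mul_le_mul_of_nonneg_left c1 hα)
  have d2 := b2.trans (mul_le_mul_of_nonneg_left c2 hα)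
  have d3 := b3.trans (mul_le_mul_of_nonneg_left c3 hα)
  have d4 := b4.trans (mul_le_mul_of_nonneg_left c4 hα)
  linarith

lemma antisymGen_diag (θ : p.Coeff) : antisymGen (p.diag θ) =
    weighted (fun ω => ω 1 * ω (1 + 1)) ((2 : ℝ) • (p.bondCoeff 1 * θ)) -
      weighted (fun ω => ω 0 * ω 1) ((4 : ℝ) • (p.bondCoeff 0 * θ)) +
      weighted (fun ω => ω (-1) * ω 0) ((2 : ℝ) • (p.bondCoeff (-1) * θ)) := by
  have h := homQuad_le_localDiff (weighted_mem (p := p) θ 1 1)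
  have h' := homQuad_le_localDiff (weighted_mem (p := p) θ 0 0)
  rw [diag_eq, sub_eq_add_neg, ← neg_one_smul ℝ, antisymGen_add h (Submodule.smul_mem _ _ h'),
    antisymGen_smul _ h', antisymGen_weighted, antisymGen_weighted]
  ext z
  simp [weighted]
  ring

/-- The image of the diagonal term lives on the bonds (-1, 0), (0, 1) and (1, 2). Translating the
outer two to (0, 1) shifts θ by 1 and by -1 and leaves the Laplacian. This is essential, since S f
controls only the Laplacian of θ. -/
lemma antisymGen_diag_sub_mem (θ : p.Coeff) : antisymGen (p.diag θ) -
    weighted (fun ω => ω 0 * ω 1) ((2 : ℝ) • (p.bondCoeff 0 * laplacian θ)) ∈ p.Negligible := by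
  set u : p.Observable :=
    weighted (fun ω => ω 0 * ω 1) ((2 : ℝ) • (p.bondCoeff 0 * shiftCoeff (-1) θ)) with hu
  set v : p.Observable :=
    weighted (fun ω => ω 0 * ω 1) ((2 : ℝ) • (p.bondCoeff 0 * shiftCoeff 1 θ)) with hv
  have h1 := translate_sub_mem (offDiag_mem (p := p)
    ((2 : ℝ) • (p.bondCoeff 0 * shiftCoeff (-1) θ)) zero_ne_one) 1
  have h2 := translate_sub_mem (offDiag_mem (p := p)
    ((2 : ℝ) • (p.bondCoeff 0 * shiftCoeff 1 θ)) zero_ne_one) (-1)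
  rw [translate_weighted, map_smul, map_mul, shiftCoeff_bondCoeff, shiftCoeff_shiftCoeff] at h1 h2
  convert add_mem h1 h2 using 1
  rw [antisymGen_diag]
  ext z
  simp [weighted, laplacian, shiftCoeff_zero]
  ring

lemma tripleNorm_antisymGen_diag_le (θ : p.Coeff) : tripleNorm (antisymGen (p.diag θ)) ≤
    2 * (√(2 * p.γ)⁻¹ * p.C) * √(p.mean (laplacian θ * laplacian θ)) := by
  rw [tripleNorm_congr (offDiag_mem _ zero_ne_one) (antisymGen_diag_sub_mem θ)]
  refine (tripleNorm_weighted_le zero_ne_one _).trans ?_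
  have h := sum_bondCoeff_le (subset_refl {0}) (fun _ => 0) fun _ => laplacian θ
  rw [Finset.sum_singleton, Finset.sum_singleton] at h
  have e : p.mean ((2 : ℝ) • (p.bondCoeff 0 * laplacian θ) *
      (2 : ℝ) • (p.bondCoeff 0 * laplacian θ)) =
      2 ^ 2 * p.mean (p.bondCoeff 0 * laplacian θ * (p.bondCoeff 0 * laplacian θ)) := by
    rw [smul_mul_smul_comm, map_smul, smul_eq_mul]
    norm_num
  rw [e, Real.sqrt_mul (by norm_num), Real.sqrt_sq (by norm_num)]
  have := mul_le_mul_of_nonneg_left h (Real.sqrt_nonneg (2 * p.γ)⁻¹)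
  linarith

lemma riesz_left (f : p.Quad) : p.riesz (f, 0) = -p.symQuad f := by
  simp [riesz]

/-- Cauchy–Schwarz in H₁, the pairing with f being the inner product with -S f. It turns test
functions into lower bounds on the norm of S f. -/
lemma abs_pairing_le {φ : p.Observable} (hφ : φ ∈ p.Quad₀) (f : p.Quad) :
    |pairing φ f| ≤ tripleNorm φ * ‖p.toH1 (p.symQuad f)‖ := by
  have h1 := inner_toH1_riesz ⟨φ, hφ⟩ (f, 0)
  have h2 := abs_real_inner_le_norm (p.toH1 ⟨φ, hφ⟩) (p.toH1 (p.riesz (f, 0)))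
  rw [h1, riesz_left, map_neg, norm_neg, norm_toH1] at h2
  simpa [form] using h2

lemma sqrt_le_of_mul_sqrt_le {x a b : ℝ} (hx : 0 ≤ x) (hb : 0 ≤ b) (h : x ≤ a * √x * b)
    (ha : 0 ≤ a) : √x ≤ a * b := by
  rcases (Real.sqrt_nonneg x).eq_or_lt' with h0 | h0
  · rw [h0]; positivity
  · refine le_of_mul_le_mul_right ?_ h0
    rw [Real.mul_self_sqrt hx]
    linarith

variable (p) in
/-- The sector condition: the antisymmetric part of the generator is bounded by the symmetric
part. -/
theorem exists_norm_antisymQuad_le :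
    ∃ K, ∀ f : p.Quad, ‖p.toH1 (p.antisymQuad f)‖ ≤ K * ‖p.toH1 (p.symQuad f)‖ := by
  set α := √(2 * p.γ)⁻¹ with hα
  set β := √(2 * p.lam)⁻¹ with hβ
  have hα0 : 0 ≤ α := Real.sqrt_nonneg _
  have hβ0 : 0 ≤ β := Real.sqrt_nonneg _
  have hC := p.C_pos.le
  refine ⟨2 * (α * p.C) * β + (2 * β * p.C + 4 * (α * p.C)) * α, fun f => ?_⟩
  obtain ⟨-, θ, φ, h1, h2⟩ := quad_le_canonical f.2
  have md := quad_le_homQuad (diag_mem_quad θ)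
  have mo := quad_le_homQuad (offDiag_mem_quad φ)
  set s := ‖p.toH1 (p.symQuad f)‖ with hs
  have hs0 : 0 ≤ s := norm_nonneg _
  -- The test function is the off-diagonal part of f itself: its pairing with f is ∑_k E[φ_k²] and
  -- its norm at most α times the square root of that sum.
  have hN : √(coeffNormSq φ) ≤ α * s := by
    have hN0 : 0 ≤ coeffNormSq φ := Finset.sum_nonneg fun k _ => mean_mul_self_nonneg _
    refine sqrt_le_of_mul_sqrt_le hN0 hs0 ?_ hα0
    have h3 := abs_pairing_le (offDiag_mem_quad₀ φ) f
    rw [h1 _ (quad₀_le_pairable (offDiag_mem_quad₀ φ)), pairing_offDiag_canonical] at h3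
    refine (le_abs_self _).trans (h3.trans (mul_le_mul_of_nonneg_right ?_ hs0))
    rw [offDiag_eq (Finset.subset_insert 0 _)]
    exact tripleNorm_sum_weighted_le (fun k _ => by omega) (fun k _ l _ h => by simpa using h) _
  -- The test function is the diagonal one with coefficient the Laplacian of θ. The factor 2 in the
  -- pairing cancels the one in `tripleNorm_diag_le`.
  have hM : √(p.mean (laplacian θ * laplacian θ)) ≤ β * s := by
    refine sqrt_le_of_mul_sqrt_le (mean_mul_self_nonneg _) hs0 ?_ hβ0
    have h3 := abs_pairing_le (diag_mem_quad₀ (laplacian θ)) f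
    rw [h1 _ (quad₀_le_pairable (diag_mem_quad₀ _)), pairing_diag_canonical] at h3
    have h4 := (neg_le_abs _).trans
      (h3.trans (mul_le_mul_of_nonneg_right (tripleNorm_diag_le (laplacian θ)) hs0))
    linarith
  have h3 : ‖p.toH1 (p.antisymQuad f)‖ = tripleNorm (antisymGen (p.diag θ + p.offDiag φ)) := by
    rw [norm_toH1]
    exact tripleNorm_congr (antisymGen_mem (add_mem md mo)) h2
  rw [h3, antisymGen_add (homQuad_le_localDiff md) (homQuad_le_localDiff mo)]
  refine (tripleNorm_add_le (antisymGen_mem md) (antisymGen_mem mo)).trans ?_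
  have h4 := (tripleNorm_antisymGen_diag_le θ).trans
    (mul_le_mul_of_nonneg_left hM (by positivity))
  have h5 := (tripleNorm_antisymGen_offDiag_le φ).trans
    (mul_le_mul_of_nonneg_left hN (by positivity))
  linarith

/-! ### The decomposition -/

lemma inner_toH1_symQuad (φ : p.Quad₀) (f : p.Quad) :
    inner ℝ (p.toH1 φ) (p.toH1 (p.symQuad f)) = -pairing (φ : p.Observable) f := by
  have h := inner_toH1_riesz φ (f, 0)
  rw [riesz_left, map_neg, inner_neg_right] at h
  rw [← neg_neg (inner ℝ _ _), h]
  simp [form]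

/-- Tested against g = 0 and a = 1, the function ω_1² - ω_0² has moment 2, which is half of its
second moment 4. -/
lemma toH1_energyGrad_ne_zero : p.toH1 ⟨p.energyGrad, p.energyGrad_mem⟩ ≠ 0 := by
  intro h
  have h1 := inner_toH1_riesz ⟨p.energyGrad, p.energyGrad_mem⟩ (0, 1)
  have e : p.diag 1 = p.energyGrad := by ext z; simp [diag, weighted, energyGrad]
  have h2 := integral_diag_sq (1 : p.Coeff)
  have h3 : p.mean (1 * 1) = 1 := by simp [mean]
  rw [e, h3] at h2
  have h4 := moment_symCurrent (p := p)
  rw [show p.symCurrent = p.lam • p.energyGrad from rfl, moment_smul, h2] at h4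
  rw [h, inner_zero_left] at h1
  simp only [form, LinearMap.mk₂_apply, Submodule.coe_zero, one_mul] at h1
  have h5 : pairing p.energyGrad 0 = 0 := pairing_energyGrad (zero_mem _)
  rw [h5, zero_add] at h1
  rw [← h1] at h4
  have := p.lam_pos
  linarith

lemma toH1_symCurrent : p.toH1 ⟨p.symCurrent, p.symCurrent_mem⟩ =
    p.lam • p.toH1 ⟨p.energyGrad, p.energyGrad_mem⟩ := by
  rw [← map_smul]; rfl

variable (p) in
theorem isCompl_closureGenQuad : IsCompl p.closureGenQuad
    (Submodule.span ℝ {p.toH1 ⟨p.symCurrent, p.symCurrent_mem⟩}) := by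
  obtain ⟨K, hK⟩ := exists_norm_antisymQuad_le p
  rw [closureGenQuad, genQuad_eq, LinearMap.comp_add]
  -- The hypotheses are, in order, totality of the vectors `riesz w`, orthogonality of j^S to S Q,
  -- antisymmetry of A, and the sector condition.
  refine isCompl_closure_range_span (K := K) (fun h hu hS => ?_) (fun f => ?_) (fun f => ?_) hK
  · refine eq_zero_of_inner_riesz fun w => ?_
    have e : p.riesz w = -p.symQuad w.1 + w.2 • p.symCurrent₀ := rfl
    have hu' : inner ℝ h (p.toH1 p.symCurrent₀) = 0 := hu
    have hS' : inner ℝ h (p.toH1 (p.symQuad w.1)) = 0 := hS w.1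
    rw [e, map_add, map_neg, map_smul, inner_add_right, inner_neg_right, inner_smul_right, hu', hS']
    simp
  · rw [toH1_symCurrent, real_inner_smul_left, LinearMap.comp_apply, inner_toH1_symQuad,
      pairing_energyGrad (quad_le_localSq f.2)]
    simp
  · rw [real_inner_comm, LinearMap.comp_apply, LinearMap.comp_apply, inner_toH1_symQuad]
    exact neg_eq_zero.2 (pairing_antisymGen_self (quad_le_homQuad f.2))

lemma existsUnique_add_smul_mem (g : p.Quad₀) : ∃! a : ℝ,
    p.toH1 (g + a • ⟨p.energyGrad, p.energyGrad_mem⟩) ∈ p.closureGenQuad := by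
  have hc := isCompl_closureGenQuad p
  have hl := p.lam_pos.ne'
  set e : p.Quad₀ := ⟨p.energyGrad, p.energyGrad_mem⟩ with he
  obtain ⟨x, hx, y, hy, hxy⟩ := Submodule.mem_sup.1
    (show p.toH1 g ∈ _ ⊔ _ by rw [hc.sup_eq_top]; trivial)
  obtain ⟨s, rfl⟩ := Submodule.mem_span_singleton.1 hy
  -- In H₁, g = x + s j^S with x in the closure, and j^S is λ times the energy gradient; hence a =
  -- -sλ. Two admissible values differ by a multiple of the gradient lying in both summands, so they
  -- coincide.
  refine ⟨-(s * p.lam), ?_, fun b hb => ?_⟩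
  · simp only
    rw [map_add, map_smul, ← hxy, toH1_symCurrent, smul_smul, neg_smul, add_neg_cancel_right]
    exact hx
  · simp only at hb
    rw [map_add, map_smul, ← hxy, toH1_symCurrent, smul_smul, add_assoc, ← add_smul] at hb
    have h1 : (s * p.lam + b) • p.toH1 e ∈ p.closureGenQuad := by
      simpa using sub_mem hb hx
    have h2 : (s * p.lam + b) • p.toH1 e ∈
        Submodule.span ℝ {p.toH1 ⟨p.symCurrent, p.symCurrent_mem⟩} := by
      refine Submodule.mem_span_singleton.2 ⟨(s * p.lam + b) / p.lam, ?_⟩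
      rw [toH1_symCurrent, smul_smul, div_mul_cancel₀ _ hl]
    have h3 := Submodule.disjoint_def.1 hc.disjoint _ h1 h2
    have h4 := (smul_eq_zero.1 h3).resolve_right toH1_energyGrad_ne_zero
    linarith

lemma mem_closureGenQuad_iff (g : p.Quad₀) : p.toH1 g ∈ p.closureGenQuad ↔
    ∃ f : ℕ → p.Quad, Tendsto (fun k => tripleNorm
      ((g : p.Observable) - p.gen (f k : p.Observable))) atTop (𝓝 0) := by
  have hn : ∀ f : p.Quad, tripleNorm ((g : p.Observable) - p.gen (f : p.Observable)) =
      ‖p.toH1 (p.genQuad f) - p.toH1 g‖ := fun f => by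
    rw [norm_sub_rev, ← map_sub, norm_toH1]; rfl
  simp only [hn]
  constructor
  · intro h
    obtain ⟨v, hv, hlim⟩ := mem_closure_iff_seq_limit.1 h
    choose f hf using hv
    refine ⟨f, tendsto_iff_norm_sub_tendsto_zero.1 ?_⟩
    have : (fun k => p.toH1 (p.genQuad (f k))) = v := funext hf
    rw [this]
    exact hlim
  · rintro ⟨f, hf⟩
    exact mem_closure_iff_seq_limit.2
      ⟨_, fun k => ⟨f k, rfl⟩, tendsto_iff_norm_sub_tendsto_zero.2 hf⟩

end DisorderedChain

end

theorem mainTheorem5 (p : DisorderedChain) :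
    -- the decomposition of the Hilbert space
    IsCompl p.closureGenQuad (Submodule.span ℝ {p.toH1 ⟨p.symCurrent, p.symCurrent_mem⟩}) ∧
    -- unique approximation modulo the energy gradient
    (∀ g : p.Quad₀, ∃! a : ℝ,
      p.toH1 (g + a • ⟨p.energyGrad, p.energyGrad_mem⟩) ∈ p.closureGenQuad) ∧
    -- fluctuation-dissipation approximation of the current
    (∃! D : ℝ, ∃ f : ℕ → p.Quad, Filter.Tendsto
      (fun k => DisorderedChain.tripleNorm
        (p.current - D • p.energyGrad - p.gen (f k : p.Observable)))
      Filter.atTop (nhds 0)) := by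
  refine ⟨p.isCompl_closureGenQuad, DisorderedChain.existsUnique_add_smul_mem, ?_⟩
  obtain ⟨a, ha, hu⟩ := DisorderedChain.existsUnique_add_smul_mem
    (⟨p.current, DisorderedChain.current_mem⟩ : p.Quad₀)
  -- The approximation property at D is membership in the closure with a = -D, so existence and
  -- uniqueness of D are those of a.
  have key : ∀ D : ℝ, (∃ f : ℕ → p.Quad, Filter.Tendsto
      (fun k => DisorderedChain.tripleNorm
        (p.current - D • p.energyGrad - p.gen (f k : p.Observable))) Filter.atTop (nhds 0)) ↔
      p.toH1 (⟨p.current, DisorderedChain.current_mem⟩ +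
        (-D) • ⟨p.energyGrad, p.energyGrad_mem⟩) ∈ p.closureGenQuad := fun D => by
    rw [DisorderedChain.mem_closureGenQuad_iff]
    simp only [Submodule.coe_add, Submodule.coe_smul, neg_smul, ← sub_eq_add_neg]
  simp only [key]
  refine ⟨-a, by simpa using ha, fun D hD => ?_⟩
  rw [← hu (-D) hD, neg_neg]
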